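/- Let $T$ be a (finite, simplicial) triangulation of a compact surface without boundary, with vertex set $V$, edge set $E$ and face set $F$; thus every edge lies on exactly two faces. Let $\mathbb R^{3|F|}$ be the space of assignments $x$ of a real number to each angle slot of $T$, and write $\alpha^e_t(x)$ for the number in the slot of the face $t$ opposite to its edge $e$. For an edge $e$ of $t$, if $A=\alpha^e_t(x)$ and $B,C$ are the entries of $x$ in the two slots of $t$ at the ends of $e$, put $\psi^e_t(x)=\frac{B+C-A}{2}$, and put $\psi^e(x)=\psi^e_{t_1}(x)+\psi^e_{t_2}(x)$, where $t_1,t_2$ are the two faces containing $e$. An *angle system* is an $x\in\mathbb R^{3|F|}$ such that all its entries lie in $(0,\pi)$, the entries in each face have sum less than $\pi$, and the entries at each vertex have sum $2\pi$; let $\mathfrak N$ be the set of angle systems. Call $x$ *non-singular* if $\sum_{e\ni v}\psi^e(x)=2\pi$ for every $v\in V$, and *Delaunay* if $\psi^e(x)\in(0,\pi)$ for every $e\in E$. For an edge $e$ shared by the faces $t_1,t_2$ let $w_e\in\mathbb R^{3|F|}$ be $1$ in the two slots of $t_1$ at the ends of $e$, $-1$ in the two slots of $t_2$ at the ends of $e$,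 and $0$ in all other slots; let $\mathfrak C$ be the linear span of the $w_e$, $e\in E$. Call $x,y$ *conformally equivalent* if $x-y\in\mathfrak C$. Call $u\in\mathbb R^{3|F|}$ *uniform* if it is the angle data of a geodesic triangulation with the combinatorics of $T$ of some compact hyperbolic surface without boundary, that is, if its entries are the angles of the geodesic triangles of that triangulation. **Proposition.** Every non-singular Delaunay angle system $x$ is conformally equivalent to exactly one uniform angle system. Equivalently, $(x+\mathfrak C)\cap\mathfrak N$ contains exactly one uniform point. -/

import Mathlib

open scoped UpperHalfPlane Topology Manifold

noncomputable section

/-! ## The hyperbolic plane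

The hyperbolic plane is Mathlib's upper half-plane `ℍ` with its hyperbolic metric. -/

/-- The geodesic segment of the hyperbolic plane with endpoints `a` and `b`. -/
def hypSegment (a b : ℍ) : Set ℍ := {z | dist a z + dist z b = dist a b}

/-- Geodesic convexity in the hyperbolic plane. -/
def HypConvex (S : Set ℍ) : Prop := ∀ a ∈ S, ∀ b ∈ S, hypSegment a b ⊆ S

/-- The geodesic convex hull of a set of points of the hyperbolic plane.  For one, two, three points
it is the point, the geodesic segment, the (filled) geodesic triangle. -/
def hypHull (S : Set ℍ) : Set ℍ := ⋂₀ {C | HypConvex C ∧ S ⊆ C}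

/-- The image of `b` in the Poincare disk under the Cayley transform that takes `a` to the centre
of the disk.  The transform is a conformal isometry, and geodesic rays from the
centre of the disk are Euclidean radii; so, for `b ≠ a`, this complex number points
in the direction in which the geodesic from `a` to `b` leaves `a`. -/
def cayleyAt (a b : ℍ) : ℂ := ((b : ℂ) - a) / ((b : ℂ) - (starRingEnd ℂ) (a : ℂ))

/-- The hyperbolic angle at `a` between the geodesic segments from `a` to `b` and from `a` to `c`. -/
def hypAngle (a b c : ℍ) : ℝ := InnerProductGeometry.angle (cayleyAt a b) (cayleyAt a c)

/-- `f` preserves hyperbolic distances near each point of `S`, within `S`. -/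
def LocallyIsometricOn (f : ℍ → ℍ) (S : Set ℍ) : Prop :=
  ∀ z ∈ S, ∃ U ∈ 𝓝[S] z, ∀ w ∈ U, ∀ w' ∈ U, dist (f w) (f w') = dist w w'

/-- A compact hyperbolic surface without boundary: a compact Hausdorff space with an
atlas of charts in the hyperbolic plane whose transition maps are local isometries. -/
structure IsClosedHyperbolicSurface (G : Type*) [TopologicalSpace G] [ChartedSpace ℍ G] : Prop where
  t2 : T2Space G
  compact : CompactSpace G
  transition : ∀ e ∈ atlas ℍ G, ∀ e' ∈ atlas ℍ G,
    LocallyIsometricOn (e.symm ≫ₕ e') (e.symm ≫ₕ e').source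

/-! ## Triangulations of compact surfaces without boundary -/

/-- A (finite, simplicial) triangulation with vertex set `V` of a compact surface without
boundary, given by its set of faces: every face is a triangle, every vertex lies on a face, every
edge lies on exactly two faces, and the faces around a vertex form a single cycle, i.e. any two of
them are joined by a chain of faces around the vertex in which neighbours share an edge
at the vertex. -/
structure SurfaceTriangulation (V : Type*) [Fintype V] [DecidableEq V] where
  faces : Finset (Finset V)
  card_face : ∀ t ∈ faces, t.card = 3
  exists_face : ∀ v : V, ∃ t ∈ faces, v ∈ t
  two_faces : ∀ t ∈ faces, ∀ e ⊆ t, e.card = 2 → (faces.filter (fun s => e ⊆ s)).card = 2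
  link_connected : ∀ v : V, ∀ s ∈ faces, ∀ t ∈ faces, v ∈ s → v ∈ t →
    Relation.ReflTransGen
      (fun a b : Finset V => a ∈ faces ∧ b ∈ faces ∧ v ∈ a ∩ b ∧ (a ∩ b).card = 2) s t

namespace SurfaceTriangulation

variable {V : Type*} [Fintype V] [DecidableEq V] (T : SurfaceTriangulation V)

/-- The faces of the triangulation. -/
abbrev Face : Type _ := {t : Finset V // t ∈ T.faces}

/-- The edges of the triangulation: the two-element subsets of its faces. -/
abbrev Edge : Type _ := {e : Finset V // e ∈ T.faces.biUnion (fun t => t.powersetCard 2)}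

/-- The space `ℝ^(3|F|)` of assignments of a real number to each angle slot.  The slot of the
face `t` at its vertex `v` is the slot of `t` opposite to the edge `t \ {v}`. -/
abbrev AngleSpace : Type _ := (t : T.Face) → (t.1 : Finset V) → ℝ

variable {T}

/-- The sum `σ^t(x)` of the three angles of the face `t`. -/
def angleSum (x : T.AngleSpace) (t : T.Face) : ℝ := ∑ v, x t v

/-- The curvature `k^t(x) = σ^t(x) - π` of the face `t`. -/
def curvature (x : T.AngleSpace) (t : T.Face) : ℝ := angleSum x t - Real.pi

/-- The total angle `r^v(x)` at the vertex `v`. -/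
def vertexAngle (x : T.AngleSpace) (v : V) : ℝ :=
  ∑ t : T.Face, if h : v ∈ t.1 then x t ⟨v, h⟩ else 0

/-- The covector `ψ^e_t`, for an edge `e` of `t`: if `A` is the angle of `t` opposite to `e` and
`B`, `C` are the angles of `t` at the ends of `e`, it is `(B + C - A) / 2`. -/
def halfPsi (x : T.AngleSpace) (e : T.Edge) (t : T.Face) : ℝ :=
  ∑ v : (t.1 : Finset V), (if (v : V) ∈ e.1 then 1 / 2 else -(1 / 2)) * x t v

/-- The map `Ψ : ℝ^(3|F|) → ℝ^|E|`; its coordinate at `e` is the informal angle complement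
`ψ^e(x) = ψ^e_{t₁}(x) + ψ^e_{t₂}(x)`, where `t₁` and `t₂` are the faces that share `e`. -/
def Psi (x : T.AngleSpace) (e : T.Edge) : ℝ :=
  ∑ t : T.Face, if e.1 ⊆ t.1 then halfPsi x e t else 0

/-- `p ∈ ℝ^|E|` is Delaunay. -/
def IsDelaunay (p : T.Edge → ℝ) : Prop := ∀ e, p e ∈ Set.Ioo 0 Real.pi

/-- `p ∈ ℝ^|E|` is non-singular. -/
def IsNonsingular (p : T.Edge → ℝ) : Prop :=
  ∀ v : V, (∑ e : T.Edge, if v ∈ e.1 then p e else 0) = 2 * Real.pi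

variable (T)

/-- The set `𝔑` of angle systems. -/
def angleSystems : Set T.AngleSpace :=
  {x | (∀ t, curvature x t < 0) ∧ (∀ t v, x t v ∈ Set.Ioo 0 Real.pi) ∧
    ∀ v, vertexAngle x v = 2 * Real.pi}

/-- The vector `w_e` of an edge `e` shared by the faces `s` and `t`: it is `1` at the two
slots of `s` at the ends of `e`, it is `-1` at the two slots of `t` at the ends of `e`, and it
is `0` at all other slots.  (Exchanging `s` and `t` changes its sign.) -/
def conformalVector (e : T.Edge) (s t : T.Face) : T.AngleSpace := fun r v =>
  if (v : V) ∈ e.1 then (if r = s then 1 else if r = t then -1 else 0) else 0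

/-- The space `ℭ` of conformal deformations, spanned by the vectors `w_e`. -/
def conformalDeformations : Submodule ℝ T.AngleSpace :=
  Submodule.span ℝ {w | ∃ (e : T.Edge) (s t : T.Face),
    s ≠ t ∧ e.1 ⊆ s.1 ∧ e.1 ⊆ t.1 ∧ w = T.conformalVector e s t}

variable {T} in
/-- `x` and `y` are conformally equivalent. -/
def ConformallyEquivalent (x y : T.AngleSpace) : Prop := x - y ∈ T.conformalDeformations

/-- A geodesic triangulation, with the combinatorics of `T`, of a hyperbolic surface `G`.  Each
face `t` is a non-degenerate geodesic triangle of the hyperbolic plane, with vertices `pos t v`,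
which is put into `G` by an injective continuous map that is isometric in the charts of `G`.  The
vertices go to points of `G` that do not depend on the face, the triangles cover `G`, and any two
of them meet in `G` exactly along the cell (edge, vertex or nothing) spanned by their
common vertices. -/
structure GeodesicTriangulation (G : Type*) [TopologicalSpace G] [ChartedSpace ℍ G] where
  pos : (t : T.Face) → (t.1 : Finset V) → ℍ
  nondegenerate : ∀ (t : T.Face) (a b c : (t.1 : Finset V)), a ≠ b → b ≠ c → a ≠ c →
    dist (pos t a) (pos t c) < dist (pos t a) (pos t b) + dist (pos t b) (pos t c)
  /-- only the values on the triangle with vertices `pos t v` matter -/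
  map : T.Face → ℍ → G
  continuousOn_map : ∀ t, ContinuousOn (map t) (hypHull (Set.range (pos t)))
  injOn_map : ∀ t, Set.InjOn (map t) (hypHull (Set.range (pos t)))
  isometric_map : ∀ t, ∀ e ∈ atlas ℍ G, LocallyIsometricOn (fun z => e (map t z))
    (hypHull (Set.range (pos t)) ∩ map t ⁻¹' e.source)
  vertexPoint : V → G
  map_pos : ∀ t v, map t (pos t v) = vertexPoint v
  cover : ∀ g : G, ∃ t, g ∈ map t '' hypHull (Set.range (pos t))
  inter : ∀ s t, s ≠ t →
    map s '' hypHull (Set.range (pos s)) ∩ map t '' hypHull (Set.range (pos t)) =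
      map t '' hypHull (pos t '' {v | (v : V) ∈ s.1})

variable {T}

/-- `u` is the angle data of the geodesic triangulation `D`. -/
def GeodesicTriangulation.HasAngles {G : Type*} [TopologicalSpace G] [ChartedSpace ℍ G]
    (D : T.GeodesicTriangulation G) (u : T.AngleSpace) : Prop :=
  ∀ (t : T.Face) (v a b : (t.1 : Finset V)), v ≠ a → v ≠ b → a ≠ b →
    u t v = hypAngle (D.pos t v) (D.pos t a) (D.pos t b)

/-- `u` is uniform: it is the angle data of a geodesic triangulation of a compact
hyperbolic surface without boundary. -/
def IsUniform (u : T.AngleSpace) : Prop :=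
  ∃ (G : Type) (_ : TopologicalSpace G) (_ : ChartedSpace ℍ G),
    IsClosedHyperbolicSurface G ∧ ∃ D : T.GeodesicTriangulation G, D.HasAngles u

end SurfaceTriangulation

end

/-!
The proof is variational.  A triple of positive numbers with sum less than `π` is the angle data of
a hyperbolic triangle, unique up to isometry, so an angle system attaches hyperbolic triangles to
the faces.  It is uniform if and only if the lengths of every edge in its two faces agree
(`IsMatched`), and in a conformal class this is the condition for a critical point of a strictly
concave function.

The function is the sum over the faces of the values of a primitive of `log cos` at half the angle
sum, at half the angle sum minus each angle, and at the complements of the angles.  By the second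
hyperbolic law of cosines in half-angle form, its derivative in the direction of the conformal
vector of an edge is the difference of the numbers `log sinh² (ℓ / 2)` for the two lengths `ℓ` of
the edge (`potentialDeriv_conformalVector`, `edgeLog_eq_log_coshSide`).  Its Hessian is negative
definite (`triangle_hessian_pos`), so a conformal class contains at most one angle system with
matching lengths (`IsMatched.eq_of_sub_mem`).

For existence, the function is maximized over the compact closure of the hyperbolic part of the
conformal class.  Conformal deformations preserve `ψ`, and since `ψ` is positive at every edge, no
face in this closure has an angle `π` (`lt_pi_of_mem_closedConformalClass`).  At every other
degenerate face the slope of the function towards the interior is `+∞`, as `log cos` tends to `-∞`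
at `π / 2`, so the maximum is interior, hence critical (`exists_isMatched`).

In a geodesic triangulation the two triangles at an edge map onto the same arc of the surface, and
their edges have the same length, because arcs that are isometric in the charts are rigid
(`dist_le_of_image_eq`, `isMatched_of_isUniform`).

Conversely, let the lengths match.  The faces at a vertex have a cyclic order
(`exists_cyclic_order`), and as their angles add up to `2π`, the triangles at the vertex can be laid
out around a point of the hyperbolic plane without gap or overlap
(`IsMatched.exists_isFrameSystem`).  In the Lorentz model, the affine extension of this layout,
normalized to the hyperboloid, is a chart on the open star of the vertex in the geometric
realization (`IsFrameSystem.chart`).  The Gram matrices of the positions of two adjacent triangles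
do not depend on the vertex around which they are laid out, so the transition maps are local
isometries, and the realization becomes a closed hyperbolic surface triangulated by the given
triangles (`IsMatched.isUniform`).
-/

noncomputable section

/-! ### The Lorentz model of the hyperbolic plane -/

/-- The Lorentz form of signature `(1, 2)` on `ℝ × ℂ`; it is positive on timelike vectors. -/
def lorentzForm : LinearMap.BilinForm ℝ (ℝ × ℂ) :=
  LinearMap.mk₂ ℝ (fun X Y => X.1 * Y.1 - (X.2.re * Y.2.re + X.2.im * Y.2.im))
    (by intros; simp; ring) (by intros; simp; ring) (by intros; simp; ring) (by intros; simp; ring)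

theorem lorentzForm_apply (X Y : ℝ × ℂ) :
    lorentzForm X Y = X.1 * Y.1 - (X.2.re * Y.2.re + X.2.im * Y.2.im) := rfl

theorem lorentzForm_comm (X Y : ℝ × ℂ) : lorentzForm X Y = lorentzForm Y X := by
  simp only [lorentzForm_apply]; ring

/-- The open convex cone of future-directed timelike vectors. -/
def IsFuture (X : ℝ × ℂ) : Prop := ‖X.2‖ < X.1

theorem IsFuture.add {X Y : ℝ × ℂ} (hX : IsFuture X) (hY : IsFuture Y) : IsFuture (X + Y) :=
  lt_of_le_of_lt (norm_add_le _ _) (add_lt_add hX hY)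

theorem IsFuture.smul {X : ℝ × ℂ} (hX : IsFuture X) {c : ℝ} (hc : 0 < c) : IsFuture (c • X) := by
  simpa [IsFuture, norm_smul, abs_of_pos hc] using (mul_lt_mul_of_pos_left hX hc)

theorem IsFuture.self_pos {X : ℝ × ℂ} (hX : IsFuture X) : 0 < lorentzForm X X := by
  have h0 : 0 ≤ ‖X.2‖ := norm_nonneg _
  have h1 : ‖X.2‖ ^ 2 = X.2.re ^ 2 + X.2.im ^ 2 := by
    rw [Complex.sq_norm, Complex.normSq_apply]; ring
  have h2 : ‖X.2‖ < X.1 := hX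
  rw [lorentzForm_apply]
  nlinarith

theorem IsFuture.re_lt {X : ℝ × ℂ} (hX : IsFuture X) : 0 < X.1 - X.2.re := by
  have := (Complex.abs_re_le_norm X.2)
  have h2 : ‖X.2‖ < X.1 := hX
  have := le_abs_self X.2.re
  linarith

theorem isFuture_of_self_pos {X : ℝ × ℂ} (h0 : 0 < X.1) (h : 0 < lorentzForm X X) :
    IsFuture X := by
  have h1 : ‖X.2‖ ^ 2 = X.2.re ^ 2 + X.2.im ^ 2 := by
    rw [Complex.sq_norm, Complex.normSq_apply]; ring
  rw [lorentzForm_apply] at h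
  refine lt_of_pow_lt_pow_left₀ 2 h0.le ?_
  nlinarith

/-- A nonnegative combination of future-directed timelike vectors, not all coefficients zero, is
future-directed timelike. -/
theorem isFuture_sum {ι : Type*} {s : Finset ι} {l : ι → ℝ} {N : ι → ℝ × ℂ}
    (hl : ∀ i ∈ s, 0 ≤ l i) (hN : ∀ i ∈ s, l i ≠ 0 → IsFuture (N i)) {j : ι} (hj : j ∈ s)
    (hlj : l j ≠ 0) :
    IsFuture (∑ i ∈ s, l i • N i) := by
  classical
  unfold IsFuture
  rw [Prod.snd_sum, Prod.fst_sum]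
  refine lt_of_le_of_lt (norm_sum_le _ _) (Finset.sum_lt_sum (fun i hi => ?_) ⟨j, hj, ?_⟩)
  · rcases eq_or_ne (l i) 0 with h | h
    · simp [h]
    · exact le_of_lt ((hN i hi h).smul (lt_of_le_of_ne (hl i hi) h.symm))
  · exact (hN j hj hlj).smul (lt_of_le_of_ne (hl j hj) hlj.symm)

/-- The point of the hyperboloid `lorentzForm X X = 1` that corresponds to a point of the upper
half-plane; `i` goes to `(1, 0)`. -/
def toLorentz (z : ℍ) : ℝ × ℂ :=
  ((z.re ^ 2 + z.im ^ 2 + 1) / (2 * z.im),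
    ⟨(z.re ^ 2 + z.im ^ 2 - 1) / (2 * z.im), z.re / z.im⟩)

/-- The point of the upper half-plane on the ray spanned by a future-directed timelike vector (with
the value `i` at all other vectors). -/
def ofLorentz (X : ℝ × ℂ) : ℍ :=
  open Classical in if h : IsFuture X then
    ⟨⟨X.2.im / (X.1 - X.2.re), √(lorentzForm X X) / (X.1 - X.2.re)⟩,
      div_pos (Real.sqrt_pos.2 h.self_pos) h.re_lt⟩
  else UpperHalfPlane.I

theorem cosh_dist_eq_lorentzForm (z w : ℍ) :
    Real.cosh (dist z w) = lorentzForm (toLorentz z) (toLorentz w) := by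
  have hz := z.im_pos.ne'
  have hw := w.im_pos.ne'
  rw [UpperHalfPlane.cosh_dist, Complex.dist_eq, Complex.sq_norm, Complex.normSq_apply,
    lorentzForm_apply]
  simp only [toLorentz, Complex.sub_re, Complex.sub_im, UpperHalfPlane.coe_re,
    UpperHalfPlane.coe_im]
  field_simp
  ring

theorem lorentzForm_toLorentz_self (z : ℍ) : lorentzForm (toLorentz z) (toLorentz z) = 1 := by
  rw [← cosh_dist_eq_lorentzForm]; simp

theorem isFuture_toLorentz (z : ℍ) : IsFuture (toLorentz z) := by
  refine isFuture_of_self_pos ?_ (by rw [lorentzForm_toLorentz_self]; exact one_pos)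
  have := z.im_pos
  simp only [toLorentz]
  positivity

theorem eq_zero_of_cosh_eq_one {x : ℝ} (h : Real.cosh x = 1) : x = 0 := by
  by_contra hx
  exact (Real.one_lt_cosh.2 hx).ne' h

theorem toLorentz_injective : Function.Injective toLorentz := by
  intro z w h
  have h1 := cosh_dist_eq_lorentzForm z w
  rw [h, lorentzForm_toLorentz_self] at h1
  exact dist_eq_zero.1 (eq_zero_of_cosh_eq_one h1)

theorem toLorentz_ofLorentz {X : ℝ × ℂ} (hX : IsFuture X) :
    toLorentz (ofLorentz X) = (√(lorentzForm X X))⁻¹ • X := by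
  have h1 := Real.sqrt_pos.2 hX.self_pos
  have h2 := hX.re_lt
  have h3 := Real.sq_sqrt hX.self_pos.le
  have hre : (ofLorentz X).re = X.2.im / (X.1 - X.2.re) := by
    rw [ofLorentz, dif_pos hX]; rfl
  have him : (ofLorentz X).im = √(lorentzForm X X) / (X.1 - X.2.re) := by
    rw [ofLorentz, dif_pos hX]; rfl
  rw [toLorentz, hre, him]
  generalize √(lorentzForm X X) = N at *
  rw [lorentzForm_apply] at h3
  refine Prod.ext ?_ (Complex.ext ?_ ?_)
  · simp only [Prod.smul_fst, smul_eq_mul]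
    field_simp
    nlinarith
  · simp only [Prod.smul_snd, Complex.smul_re, smul_eq_mul]
    field_simp
    nlinarith
  · simp only [Prod.smul_snd, Complex.smul_im, smul_eq_mul]
    field_simp

theorem ofLorentz_toLorentz (z : ℍ) : ofLorentz (toLorentz z) = z := by
  apply toLorentz_injective
  rw [toLorentz_ofLorentz (isFuture_toLorentz z), lorentzForm_toLorentz_self]
  simp

theorem ofLorentz_smul {X : ℝ × ℂ} (hX : IsFuture X) {c : ℝ} (hc : 0 < c) :
    ofLorentz (c • X) = ofLorentz X := by
  apply toLorentz_injective
  rw [toLorentz_ofLorentz hX, toLorentz_ofLorentz (hX.smul hc)]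
  have : lorentzForm (c • X) (c • X) = c ^ 2 * lorentzForm X X := by
    simp only [map_smul, LinearMap.smul_apply, smul_eq_mul]; ring
  rw [this, Real.sqrt_mul (sq_nonneg c), Real.sqrt_sq hc.le, smul_smul]
  congr 1
  field_simp

theorem cosh_dist_ofLorentz {X Y : ℝ × ℂ} (hX : IsFuture X) (hY : IsFuture Y) :
    Real.cosh (dist (ofLorentz X) (ofLorentz Y)) =
      lorentzForm X Y / (√(lorentzForm X X) * √(lorentzForm Y Y)) := by
  rw [cosh_dist_eq_lorentzForm, toLorentz_ofLorentz hX, toLorentz_ofLorentz hY]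
  simp only [map_smul, LinearMap.smul_apply, smul_eq_mul]
  field_simp

theorem dist_ofLorentz_eq {X Y X' Y' : ℝ × ℂ} (hX : IsFuture X) (hY : IsFuture Y)
    (hX' : IsFuture X') (hY' : IsFuture Y') (h1 : lorentzForm X Y = lorentzForm X' Y')
    (h2 : lorentzForm X X = lorentzForm X' X') (h3 : lorentzForm Y Y = lorentzForm Y' Y') :
    dist (ofLorentz X) (ofLorentz Y) = dist (ofLorentz X') (ofLorentz Y') := by
  have := cosh_dist_ofLorentz hX hY
  rw [h1, h2, h3, ← cosh_dist_ofLorentz hX' hY'] at this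
  exact Real.cosh_strictMonoOn.injOn (Set.mem_Ici.2 dist_nonneg) (Set.mem_Ici.2 dist_nonneg) this

theorem ofLorentz_eq_iff {X Y : ℝ × ℂ} (hX : IsFuture X) (hY : IsFuture Y) :
    ofLorentz X = ofLorentz Y ↔ ∃ c : ℝ, 0 < c ∧ X = c • Y := by
  constructor
  · intro h
    have h1 := toLorentz_ofLorentz hX
    rw [h, toLorentz_ofLorentz hY] at h1
    have hx := Real.sqrt_pos.2 hX.self_pos
    have hy := Real.sqrt_pos.2 hY.self_pos
    refine ⟨√(lorentzForm X X) * (√(lorentzForm Y Y))⁻¹, by positivity, ?_⟩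
    rw [mul_smul, h1, smul_smul, mul_inv_cancel₀ hx.ne', one_smul]
  · rintro ⟨c, hc, rfl⟩
    exact ofLorentz_smul hY hc

theorem continuous_lorentzForm_self : Continuous fun X : ℝ × ℂ => lorentzForm X X := by
  simp only [lorentzForm_apply]
  fun_prop

theorem continuous_toLorentz : Continuous toLorentz := by
  have hre : Continuous fun z : ℍ => z.re := UpperHalfPlane.continuous_re
  have him : Continuous fun z : ℍ => z.im := UpperHalfPlane.continuous_im
  have h0 : ∀ z : ℍ, 2 * z.im ≠ 0 := fun z => by have := z.im_pos; positivity
  refine Continuous.prodMk ?_ ?_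
  · exact (((hre.pow 2).add (him.pow 2)).add continuous_const).div (continuous_const.mul him) h0
  · have h : (fun z : ℍ => (⟨(z.re ^ 2 + z.im ^ 2 - 1) / (2 * z.im), z.re / z.im⟩ : ℂ)) =
        fun z : ℍ => (((z.re ^ 2 + z.im ^ 2 - 1) / (2 * z.im) : ℝ) : ℂ) +
          ((z.re / z.im : ℝ) : ℂ) * Complex.I := by
      funext z
      exact (Complex.mk_eq_add_mul_I _ _)
    rw [h]
    have h1 : Continuous fun z : ℍ => (z.re ^ 2 + z.im ^ 2 - 1) / (2 * z.im) :=
      (((hre.pow 2).add (him.pow 2)).sub continuous_const).div (continuous_const.mul him) h0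
    have h2 : Continuous fun z : ℍ => z.re / z.im := hre.div him fun z => z.im_pos.ne'
    exact (Complex.continuous_ofReal.comp h1).add
      ((Complex.continuous_ofReal.comp h2).mul continuous_const)

theorem continuousOn_ofLorentz : ContinuousOn ofLorentz {X | IsFuture X} := by
  rw [continuousOn_iff_continuous_domRestrict, UpperHalfPlane.isEmbedding_coe.continuous_iff]
  have h : (UpperHalfPlane.coe ∘ Set.domRestrict {X | IsFuture X} ofLorentz) =
      fun X : {X : ℝ × ℂ | IsFuture X} => ((X.1.2.im / (X.1.1 - X.1.2.re) : ℝ) : ℂ) +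
        ((√(lorentzForm X.1 X.1) / (X.1.1 - X.1.2.re) : ℝ) : ℂ) * Complex.I := by
    funext X
    have hX : IsFuture X.1 := X.2
    simp only [Function.comp, Set.domRestrict_apply, ofLorentz, dif_pos hX]
    exact (Complex.mk_eq_add_mul_I _ _)
  rw [h]
  have hne : ∀ X : {X : ℝ × ℂ | IsFuture X}, X.1.1 - X.1.2.re ≠ 0 := fun X =>
    (IsFuture.re_lt X.2).ne'
  have hs : Continuous fun X : {X : ℝ × ℂ | IsFuture X} => √(lorentzForm X.1 X.1) :=
    (continuous_lorentzForm_self.comp continuous_subtype_val).sqrt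
  have h0 : Continuous fun X : {X : ℝ × ℂ | IsFuture X} => X.1.1 - X.1.2.re := by fun_prop
  have h1 : Continuous fun X : {X : ℝ × ℂ | IsFuture X} => X.1.2.im := by fun_prop
  exact (Complex.continuous_ofReal.comp (h1.div h0 hne)).add
    ((Complex.continuous_ofReal.comp (hs.div h0 hne)).mul continuous_const)

/-! ### Geodesic segments and hulls -/

theorem mem_hypSegment_of_toLorentz_eq {a b z : ℍ} {s t : ℝ} (hs : 0 ≤ s) (ht : 0 ≤ t)
    (h : toLorentz z = s • toLorentz a + t • toLorentz b) :
    z ∈ hypSegment a b := by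
  have hab := cosh_dist_eq_lorentzForm a b
  have haz : Real.cosh (dist a z) = s + t * Real.cosh (dist a b) := by
    rw [cosh_dist_eq_lorentzForm, h, hab]
    simp [lorentzForm_toLorentz_self]
  have hzb : Real.cosh (dist z b) = s * Real.cosh (dist a b) + t := by
    rw [cosh_dist_eq_lorentzForm, h, hab]
    simp [lorentzForm_toLorentz_self]
  have hzz : s ^ 2 + t ^ 2 + 2 * s * t * Real.cosh (dist a b) = 1 := by
    have := lorentzForm_toLorentz_self z
    rw [h] at this
    simp only [map_add, map_smul, LinearMap.add_apply, LinearMap.smul_apply, smul_eq_mul,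
      lorentzForm_toLorentz_self, lorentzForm_comm (toLorentz b) (toLorentz a), ← hab] at this
    linarith
  have hsd : 0 ≤ Real.sinh (dist a b) := Real.sinh_nonneg_iff.2 dist_nonneg
  have hC := Real.cosh_sq (dist a b)
  have hsaz : Real.sinh (dist a z) = t * Real.sinh (dist a b) := by
    refine (pow_left_inj₀ (Real.sinh_nonneg_iff.2 dist_nonneg) (mul_nonneg ht hsd) two_ne_zero).1 ?_
    rw [Real.sinh_sq, haz, mul_pow, Real.sinh_sq]
    linear_combination hzz
  have hszb : Real.sinh (dist z b) = s * Real.sinh (dist a b) := by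
    refine (pow_left_inj₀ (Real.sinh_nonneg_iff.2 dist_nonneg) (mul_nonneg hs hsd) two_ne_zero).1 ?_
    rw [Real.sinh_sq, hzb, mul_pow, Real.sinh_sq]
    linear_combination hzz
  have hcosh : Real.cosh (dist a z + dist z b) = Real.cosh (dist a b) := by
    rw [Real.cosh_add, haz, hzb, hsaz, hszb]
    linear_combination Real.cosh (dist a b) * hzz - s * t * hC
  exact Real.cosh_strictMonoOn.injOn (Set.mem_Ici.2 (by positivity)) (Set.mem_Ici.2 dist_nonneg)
    hcosh

theorem exists_toLorentz_eq_of_mem_hypSegment {a b z : ℍ} (h : z ∈ hypSegment a b) :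
    ∃ s t : ℝ, 0 ≤ s ∧ 0 ≤ t ∧ toLorentz z = s • toLorentz a + t • toLorentz b := by
  have h : dist a z + dist z b = dist a b := h
  rcases eq_or_ne a b with rfl | hne
  · refine ⟨1, 0, zero_le_one, le_rfl, ?_⟩
    rw [dist_self] at h
    have : dist a z = 0 := by
      linarith [dist_nonneg (x := a) (y := z), dist_nonneg (x := z) (y := a)]
    rw [dist_eq_zero.1 this]
    simp
  have hd : 0 < Real.sinh (dist a b) := Real.sinh_pos_iff.2 (dist_pos.2 hne)
  have hp : 0 ≤ Real.sinh (dist a z) := Real.sinh_nonneg_iff.2 dist_nonneg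
  have hq : 0 ≤ Real.sinh (dist z b) := Real.sinh_nonneg_iff.2 dist_nonneg
  -- the classical weights of a point at given distances from the end points
  set s := Real.sinh (dist z b) / Real.sinh (dist a b) with hs
  set t := Real.sinh (dist a z) / Real.sinh (dist a b) with ht
  have hs0 : 0 ≤ s := by positivity
  have ht0 : 0 ≤ t := by positivity
  have hX : IsFuture (s • toLorentz a + t • toLorentz b) := by
    rcases hs0.eq_or_lt with h0 | h0
    · rcases ht0.eq_or_lt with h1 | h1
      · exfalso
        have e1 : Real.sinh (dist z b) = 0 := by
          rcases div_eq_zero_iff.1 h0.symm with h' | h'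
          · exact h'
          · exact absurd h' hd.ne'
        have e2 : Real.sinh (dist a z) = 0 := by
          rcases div_eq_zero_iff.1 h1.symm with h' | h'
          · exact h'
          · exact absurd h' hd.ne'
        rw [Real.sinh_eq_zero] at e1 e2
        rw [e1, e2] at h
        exact hne (dist_eq_zero.1 (by linarith))
      · rw [← h0, zero_smul, zero_add]
        exact (isFuture_toLorentz b).smul h1
    · rcases ht0.eq_or_lt with h1 | h1
      · rw [← h1, zero_smul, add_zero]
        exact (isFuture_toLorentz a).smul h0
      · exact ((isFuture_toLorentz a).smul h0).add ((isFuture_toLorentz b).smul h1)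
  refine ⟨s, t, hs0, ht0, ?_⟩
  have hab := cosh_dist_eq_lorentzForm a b
  have hsum : Real.sinh (dist a b) =
      Real.sinh (dist a z) * Real.cosh (dist z b) + Real.cosh (dist a z) * Real.sinh (dist z b) := by
    rw [← h, Real.sinh_add]
  have hcsum : Real.cosh (dist a b) =
      Real.cosh (dist a z) * Real.cosh (dist z b) + Real.sinh (dist a z) * Real.sinh (dist z b) := by
    rw [← h, Real.cosh_add]
  have hself : lorentzForm (s • toLorentz a + t • toLorentz b)
      (s • toLorentz a + t • toLorentz b) = 1 := by
    simp only [map_add, map_smul, LinearMap.add_apply, LinearMap.smul_apply, smul_eq_mul,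
      lorentzForm_toLorentz_self, lorentzForm_comm (toLorentz b) (toLorentz a), ← hab]
    rw [hs, ht]
    field_simp
    rw [hsum, hcsum]
    have h1 := Real.cosh_sq (dist a z)
    have h2 := Real.cosh_sq (dist z b)
    linear_combination (- Real.sinh (dist a z) ^ 2) * h2 - Real.sinh (dist z b) ^ 2 * h1
  have hz : lorentzForm (toLorentz z) (s • toLorentz a + t • toLorentz b) = 1 := by
    simp only [map_add, map_smul, smul_eq_mul, ← cosh_dist_eq_lorentzForm]
    rw [hs, ht, dist_comm z a]
    field_simp
    rw [hsum]
    ring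
  have hdist := cosh_dist_ofLorentz (isFuture_toLorentz z) hX
  rw [hz, hself, lorentzForm_toLorentz_self, ofLorentz_toLorentz] at hdist
  simp only [Real.sqrt_one, mul_one, div_one] at hdist
  have hzz : z = ofLorentz (s • toLorentz a + t • toLorentz b) :=
    dist_eq_zero.1 (eq_zero_of_cosh_eq_one hdist)
  have := toLorentz_ofLorentz hX
  rw [← hzz, hself] at this
  simpa using this

theorem mem_hypSegment_iff {a b z : ℍ} : z ∈ hypSegment a b ↔
    ∃ s t : ℝ, 0 ≤ s ∧ 0 ≤ t ∧ toLorentz z = s • toLorentz a + t • toLorentz b :=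
  ⟨exists_toLorentz_eq_of_mem_hypSegment, fun ⟨_, _, hs, ht, h⟩ =>
    mem_hypSegment_of_toLorentz_eq hs ht h⟩

/-- Points of a geodesic segment are as far apart as their distances from an end point tell. -/
theorem dist_eq_abs_sub_of_mem_hypSegment {a b z w : ℍ} (hz : z ∈ hypSegment a b)
    (hw : w ∈ hypSegment a b) : dist z w = |dist a z - dist a w| := by
  have hz' : dist a z + dist z b = dist a b := hz
  have hw' : dist a w + dist w b = dist a b := hw
  wlog hle : dist a z ≤ dist a w generalizing z w
  · rw [dist_comm, abs_sub_comm]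
    exact this hw hz hw' hz' (le_of_not_ge hle)
  obtain ⟨s, t, hs, ht, hst⟩ := exists_toLorentz_eq_of_mem_hypSegment hz
  obtain ⟨s', t', hs', ht', hst'⟩ := exists_toLorentz_eq_of_mem_hypSegment hw
  have hab := cosh_dist_eq_lorentzForm a b
  have key : ∀ {p : ℍ} {s t : ℝ}, 0 ≤ t → toLorentz p = s • toLorentz a + t • toLorentz b →
      Real.cosh (dist a p) = s + t * Real.cosh (dist a b) ∧
        Real.sinh (dist a p) = t * Real.sinh (dist a b) := by
    intro p s t ht h
    have h1 : Real.cosh (dist a p) = s + t * Real.cosh (dist a b) := by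
      rw [cosh_dist_eq_lorentzForm, h, hab]
      simp [lorentzForm_toLorentz_self]
    refine ⟨h1, ?_⟩
    have hzz : s ^ 2 + t ^ 2 + 2 * s * t * Real.cosh (dist a b) = 1 := by
      have := lorentzForm_toLorentz_self p
      rw [h] at this
      simp only [map_add, map_smul, LinearMap.add_apply, LinearMap.smul_apply, smul_eq_mul,
        lorentzForm_toLorentz_self, lorentzForm_comm (toLorentz b) (toLorentz a), ← hab] at this
      linarith
    refine (pow_left_inj₀ (Real.sinh_nonneg_iff.2 dist_nonneg)
      (mul_nonneg ht (Real.sinh_nonneg_iff.2 dist_nonneg)) two_ne_zero).1 ?_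
    rw [Real.sinh_sq, h1, mul_pow, Real.sinh_sq]
    linear_combination hzz
  obtain ⟨c1, s1⟩ := key ht hst
  obtain ⟨c2, s2⟩ := key ht' hst'
  have hzw : Real.cosh (dist z w) = s * s' + (s * t' + s' * t) * Real.cosh (dist a b) + t * t' := by
    rw [cosh_dist_eq_lorentzForm, hst, hst', hab]
    simp only [map_add, map_smul, LinearMap.add_apply, LinearMap.smul_apply, smul_eq_mul,
        lorentzForm_toLorentz_self, lorentzForm_comm (toLorentz b) (toLorentz a)]
    ring
  rw [abs_sub_comm, abs_of_nonneg (sub_nonneg.2 hle)]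
  refine Real.cosh_strictMonoOn.injOn (Set.mem_Ici.2 dist_nonneg)
    (Set.mem_Ici.2 (sub_nonneg.2 hle)) ?_
  rw [Real.cosh_sub, c1, c2, s1, s2, hzw]
  have := Real.cosh_sq (dist a b)
  linear_combination (-t * t') * this

/-- The hyperbolic hull of a finite family of points consists of the points whose vectors are
nonnegative combinations of the vectors of the family. -/
theorem mem_hypHull_image_iff {ι : Type*} [Fintype ι] (N : ι → ℍ) (A : Set ι) (z : ℍ) :
    z ∈ hypHull (N '' A) ↔ ∃ l : ι → ℝ, (∀ i, 0 ≤ l i) ∧ (∀ i, i ∉ A → l i = 0) ∧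
      toLorentz z = ∑ i, l i • toLorentz (N i) := by
  classical
  constructor
  · intro hz
    refine Set.mem_sInter.1 hz {z | ∃ l : ι → ℝ, (∀ i, 0 ≤ l i) ∧ (∀ i, i ∉ A → l i = 0) ∧
      toLorentz z = ∑ i, l i • toLorentz (N i)} ⟨?_, ?_⟩
    · rintro a ⟨l, hl, hlA, ha⟩ b ⟨m, hm, hmA, hb⟩ w hw
      obtain ⟨s, t, hs, ht, hst⟩ := mem_hypSegment_iff.1 hw
      refine ⟨fun i => s * l i + t * m i, fun i => ?_, fun i hi => ?_, ?_⟩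
      · have := hl i
        have := hm i
        positivity
      · simp [hlA i hi, hmA i hi]
      · rw [hst, ha, hb, Finset.smul_sum, Finset.smul_sum, ← Finset.sum_add_distrib]
        simp only [add_smul, mul_smul]
    · rintro _ ⟨i, hi, rfl⟩
      refine ⟨Pi.single i 1, fun j => ?_, fun j hj => ?_, ?_⟩
      · by_cases h : j = i
        · subst h; simp
        · simp [h]
      · have : j ≠ i := fun h => hj (h ▸ hi)
        simp [this]
      · rw [Finset.sum_eq_single i] <;> simp +contextual
  · rintro ⟨l, hl, hlA, hz⟩
    refine Set.mem_sInter.2 ?_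
    rintro C ⟨hC, hNC⟩
    have key : ∀ S : Finset ι, (∃ i ∈ S, l i ≠ 0) →
        ofLorentz (∑ i ∈ S, l i • toLorentz (N i)) ∈ C := by
      intro S
      induction S using Finset.induction_on with
      | empty => simp
      | insert i S hi ih =>
        intro hne
        rw [Finset.sum_insert hi]
        by_cases hli : l i = 0
        · rw [hli, zero_smul, zero_add]
          refine ih ?_
          obtain ⟨j, hj, hlj⟩ := hne
          rcases Finset.mem_insert.1 hj with rfl | hj
          · exact absurd hli hlj
          · exact ⟨j, hj, hlj⟩
        have hiA : i ∈ A := by_contra fun h => hli (hlA i h)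
        have hpos : 0 < l i := lt_of_le_of_ne (hl i) (Ne.symm hli)
        have hiC : N i ∈ C := hNC ⟨i, hiA, rfl⟩
        by_cases hS : ∃ j ∈ S, l j ≠ 0
        · obtain ⟨j, hj, hlj⟩ := hS
          have hF := isFuture_sum (s := S) (N := fun i => toLorentz (N i)) (fun i _ => hl i)
            (fun i _ _ => isFuture_toLorentz _) hj hlj
          have hF' := ((isFuture_toLorentz (N i)).smul hpos).add hF
          refine hC _ hiC _ (ih ⟨j, hj, hlj⟩) (mem_hypSegment_iff.2 ?_)
          set Y := ∑ i ∈ S, l i • toLorentz (N i)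
          set X := l i • toLorentz (N i) + Y
          have hx := Real.sqrt_pos.2 hF'.self_pos
          have hy := Real.sqrt_pos.2 hF.self_pos
          refine ⟨(√(lorentzForm X X))⁻¹ * l i, (√(lorentzForm X X))⁻¹ * √(lorentzForm Y Y),
            by positivity, by positivity, ?_⟩
          rw [toLorentz_ofLorentz hF', toLorentz_ofLorentz hF, smul_smul, mul_assoc,
            mul_inv_cancel₀ hy.ne', mul_one, mul_smul, ← smul_add]
        · push Not at hS
          rw [Finset.sum_eq_zero (fun j hj => by rw [hS j hj, zero_smul]), add_zero,
            ofLorentz_smul (isFuture_toLorentz _) hpos, ofLorentz_toLorentz]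
          exact hiC
    rw [← ofLorentz_toLorentz z, hz]
    refine key Finset.univ ?_
    by_contra! h
    have h0 := isFuture_toLorentz z
    rw [hz, Finset.sum_eq_zero (fun j hj => by rw [h j hj, zero_smul])] at h0
    simp [IsFuture] at h0

theorem mem_hypHull_range_iff {ι : Type*} [Fintype ι] (N : ι → ℍ) (z : ℍ) :
    z ∈ hypHull (Set.range N) ↔ ∃ l : ι → ℝ, (∀ i, 0 ≤ l i) ∧
      toLorentz z = ∑ i, l i • toLorentz (N i) := by
  rw [← Set.image_univ, mem_hypHull_image_iff]
  simp

theorem hypHull_mono {A B : Set ℍ} (h : A ⊆ B) : hypHull A ⊆ hypHull B :=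
  fun _ hz => Set.mem_sInter.2 fun C hC => Set.mem_sInter.1 hz C ⟨hC.1, h.trans hC.2⟩

theorem mem_hypHull_pair_iff {a b z : ℍ} : z ∈ hypHull {a, b} ↔ z ∈ hypSegment a b := by
  have h := mem_hypHull_range_iff ![a, b] z
  rw [Matrix.range_cons, Matrix.range_cons, Matrix.range_empty, Set.union_empty,
    Set.singleton_union] at h
  rw [h, mem_hypSegment_iff]
  constructor
  · rintro ⟨l, hl, hz⟩
    exact ⟨l 0, l 1, hl 0, hl 1, by simpa using hz⟩
  · rintro ⟨s, t, hs, ht, hz⟩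
    refine ⟨![s, t], fun i => ?_, by simpa using hz⟩
    fin_cases i <;> simpa

/-- The hyperbolic law of cosines, for the angle measured by the Cayley transform. -/
theorem cosh_dist_law (a b c : ℍ) : Real.cosh (dist b c) =
    Real.cosh (dist a b) * Real.cosh (dist a c) -
      Real.sinh (dist a b) * Real.sinh (dist a c) * Real.cos (hypAngle a b c) := by
  have ha := a.im_pos
  have hb := b.im_pos
  have hc := c.im_pos
  -- `sinh d(a, b) = |b - a| |b - ā| / (2 im a im b)`
  have hsinh : ∀ b : ℍ, Real.sinh (dist a b) =
      ‖(b : ℂ) - a‖ * ‖(b : ℂ) - (starRingEnd ℂ) (a : ℂ)‖ / (2 * a.im * b.im) := by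
    intro b
    have hb := b.im_pos
    refine (pow_left_inj₀ (Real.sinh_nonneg_iff.2 dist_nonneg) (by positivity) two_ne_zero).1 ?_
    rw [Real.sinh_sq, UpperHalfPlane.cosh_dist, dist_comm, Complex.dist_eq, div_pow, mul_pow,
      Complex.sq_norm, Complex.sq_norm, Complex.normSq_apply, Complex.normSq_apply]
    simp only [Complex.sub_re, Complex.sub_im, UpperHalfPlane.coe_re, UpperHalfPlane.coe_im,
      Complex.conj_re, Complex.conj_im]
    field_simp
    ring
  have hne : ∀ b : ℍ, 0 < ‖(b : ℂ) - (starRingEnd ℂ) (a : ℂ)‖ := by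
    intro b
    have hb := b.im_pos
    refine norm_pos_iff.2 fun h => ?_
    have := congrArg Complex.im h
    simp only [Complex.sub_im, Complex.conj_im, UpperHalfPlane.coe_im, Complex.zero_im] at this
    linarith
  have hang : Real.cos (hypAngle a b c) * (‖cayleyAt a b‖ * ‖cayleyAt a c‖) =
      ((starRingEnd ℂ) (cayleyAt a b) * cayleyAt a c).re := by
    rw [hypAngle, InnerProductGeometry.cos_angle_mul_norm_mul_norm, real_inner_comm,
      Complex.inner, mul_comm, ← Complex.conj_re, map_mul, Complex.conj_conj]
    ring_nf
  have hre : ((starRingEnd ℂ) (cayleyAt a b) * cayleyAt a c).re *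
      (‖(b : ℂ) - (starRingEnd ℂ) (a : ℂ)‖ ^ 2 * ‖(c : ℂ) - (starRingEnd ℂ) (a : ℂ)‖ ^ 2) =
      ((starRingEnd ℂ) ((b : ℂ) - a) * ((b : ℂ) - (starRingEnd ℂ) (a : ℂ)) *
        (((c : ℂ) - a) * (starRingEnd ℂ) ((c : ℂ) - (starRingEnd ℂ) (a : ℂ)))).re := by
    rw [← Complex.ofReal_re (‖(b : ℂ) - (starRingEnd ℂ) (a : ℂ)‖ ^ 2 *
      ‖(c : ℂ) - (starRingEnd ℂ) (a : ℂ)‖ ^ 2), ← Complex.re_mul_ofReal]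
    congr 1
    rw [Complex.ofReal_re, Complex.sq_norm, Complex.sq_norm, Complex.ofReal_mul,
      Complex.normSq_eq_conj_mul_self, Complex.normSq_eq_conj_mul_self, cayleyAt, cayleyAt]
    have h1 : (b : ℂ) - (starRingEnd ℂ) (a : ℂ) ≠ 0 := norm_pos_iff.1 (hne b)
    have h2 : (c : ℂ) - (starRingEnd ℂ) (a : ℂ) ≠ 0 := norm_pos_iff.1 (hne c)
    have h3 : (starRingEnd ℂ) ((b : ℂ) - (starRingEnd ℂ) (a : ℂ)) ≠ 0 := by
      simpa only [ne_eq, map_eq_zero] using h1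
    rw [map_div₀]
    generalize (b : ℂ) - (starRingEnd ℂ) (a : ℂ) = x at *
    generalize (c : ℂ) - (starRingEnd ℂ) (a : ℂ) = y at *
    field_simp
  have hprod : Real.sinh (dist a b) * Real.sinh (dist a c) * Real.cos (hypAngle a b c) =
      ((starRingEnd ℂ) ((b : ℂ) - a) * ((b : ℂ) - (starRingEnd ℂ) (a : ℂ)) *
        (((c : ℂ) - a) * (starRingEnd ℂ) ((c : ℂ) - (starRingEnd ℂ) (a : ℂ)))).re /
        (4 * a.im ^ 2 * b.im * c.im) := by
    rw [← hre, ← hang, hsinh, hsinh, cayleyAt, cayleyAt, norm_div, norm_div]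
    have := (hne b).ne'
    have := (hne c).ne'
    field_simp
    ring
  rw [hprod]
  simp only [UpperHalfPlane.cosh_dist, Complex.dist_eq, Complex.sq_norm, Complex.normSq_apply,
    Complex.mul_re, Complex.mul_im, Complex.sub_re, Complex.sub_im, UpperHalfPlane.coe_re,
    UpperHalfPlane.coe_im, Complex.conj_re, Complex.conj_im]
  field_simp
  ring

/-! ### The potential of a triangle and its concavity -/

/-- A primitive of `log cos`, that is, Lobachevsky's function up to a change of variable and a
linear term. -/
def logCosIntegral (u : ℝ) : ℝ := ∫ v in (0 : ℝ)..u, Real.log (Real.cos v)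

theorem continuous_logCosIntegral : Continuous logCosIntegral :=
  intervalIntegral.continuous_primitive (fun _ _ => intervalIntegrable_log_cos) 0

theorem hasDerivAt_logCosIntegral {u : ℝ} (hu : u ∈ Set.Ioo (-(Real.pi / 2)) (Real.pi / 2)) :
    HasDerivAt logCosIntegral (Real.log (Real.cos u)) u := by
  have hc := (Real.cos_pos_of_mem_Ioo hu).ne'
  refine intervalIntegral.integral_hasDerivAt_right intervalIntegrable_log_cos ?_
    (Real.continuous_cos.continuousAt.log hc)
  exact (Real.measurable_log.comp Real.measurable_cos).stronglyMeasurable.stronglyMeasurableAtFilter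

open Filter in
/-- The graph of the primitive of `log cos` is vertical at `π / 2`. -/
theorem tendsto_slope_logCosIntegral_atTop {d : ℝ} (hd : d < 0) :
    Tendsto (fun r : ℝ => (logCosIntegral (Real.pi / 2 + r * d) - logCosIntegral (Real.pi / 2)) / r)
      (𝓝[>] 0) atTop := by
  have hpi := Real.pi_pos
  have hlog : Tendsto (fun r : ℝ => d * Real.log (r * -d)) (𝓝[>] 0) atTop := by
    refine Tendsto.const_mul_atBot_of_neg hd (Real.tendsto_log_nhdsGT_zero.comp ?_)
    refine tendsto_nhdsWithin_iff.2 ⟨?_, ?_⟩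
    · have : Tendsto (fun r : ℝ => r * -d) (𝓝 0) (𝓝 (0 * -d)) :=
        (continuous_id.mul continuous_const).tendsto 0
      rw [zero_mul] at this
      exact this.mono_left nhdsWithin_le_nhds
    · filter_upwards [self_mem_nhdsWithin] with r hr
      exact mul_pos hr (neg_pos.2 hd)
  refine tendsto_atTop_mono' _ ?_ hlog
  have hsmall : ∀ᶠ r : ℝ in 𝓝[>] 0, r * -d < Real.pi / 2 := by
    have : Tendsto (fun r : ℝ => r * -d) (𝓝 0) (𝓝 (0 * -d)) :=
      (continuous_id.mul continuous_const).tendsto 0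
    rw [zero_mul] at this
    exact (this.mono_left nhdsWithin_le_nhds).eventually (gt_mem_nhds (by positivity))
  filter_upwards [hsmall, self_mem_nhdsWithin] with r hr hr0
  have hr0 : 0 < r := hr0
  have hpos : 0 < r * -d := mul_pos hr0 (neg_pos.2 hd)
  have hlt : Real.pi / 2 + r * d < Real.pi / 2 := by linarith
  obtain ⟨c, ⟨hc1, hc2⟩, hc⟩ := exists_hasDerivAt_eq_slope logCosIntegral
    (fun v => Real.log (Real.cos v)) hlt continuous_logCosIntegral.continuousOn
    (fun v hv => hasDerivAt_logCosIntegral ⟨by linarith [hv.1], hv.2⟩)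
  have hcos0 : 0 < Real.cos c := Real.cos_pos_of_mem_Ioo ⟨by linarith, hc2⟩
  have hcos : Real.cos c ≤ r * -d := by
    rw [← Real.sin_pi_div_two_sub]
    exact (Real.sin_le (by linarith)).trans (by linarith)
  have hl := Real.log_le_log hcos0 hcos
  have heq : (logCosIntegral (Real.pi / 2 + r * d) - logCosIntegral (Real.pi / 2)) / r =
      d * Real.log (Real.cos c) := by
    rw [hc]
    have : Real.pi / 2 - (Real.pi / 2 + r * d) = -(r * d) := by ring
    rw [this]
    have h1 := hr0.ne'
    have h2 := hd.ne
    field_simp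
    ring
  rw [heq]
  exact mul_le_mul_of_nonpos_left hl hd.le

open Filter in
/-- If a sum of values of the primitive of `log cos` never exceeds its initial value along a segment
from a point of the cube `(-π/2, π/2]ⁿ` to an interior point, then the initial point is interior too:
at a coordinate `π/2` the slope towards the interior would be infinite. -/
theorem lt_pi_div_two_of_forall_sum_le {ι : Type*} [Fintype ι] {c d : ι → ℝ}
    (hc : ∀ j, c j ∈ Set.Ioc (-(Real.pi / 2)) (Real.pi / 2))
    (hcd : ∀ j, c j + d j < Real.pi / 2)
    (hmax : ∀ r ∈ Set.Icc (0 : ℝ) 1,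
      ∑ j, logCosIntegral (c j + r * d j) ≤ ∑ j, logCosIntegral (c j)) (j : ι) :
    c j < Real.pi / 2 := by
  classical
  by_contra hj
  have hslope : ∀ i, c i < Real.pi / 2 →
      Tendsto (fun r : ℝ => (logCosIntegral (c i + r * d i) - logCosIntegral (c i)) / r) (𝓝[>] 0)
        (𝓝 (Real.log (Real.cos (c i)) * d i)) := by
    intro i hi
    have h1 : HasDerivAt (fun r : ℝ => logCosIntegral (c i + r * d i))
        (Real.log (Real.cos (c i)) * d i) 0 := by
      have h2 : HasDerivAt (fun r : ℝ => c i + r * d i) (d i) 0 := by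
        simpa using ((hasDerivAt_id (0 : ℝ)).mul_const (d i)).const_add (c i)
      have h3 : HasDerivAt logCosIntegral (Real.log (Real.cos (c i))) (c i + 0 * d i) := by
        rw [zero_mul, add_zero]
        exact hasDerivAt_logCosIntegral ⟨(hc i).1, hi⟩
      exact h3.comp 0 h2
    have := h1.tendsto_slope.mono_left (nhdsWithin_mono 0 (fun r (hr : 0 < r) => hr.ne'))
    refine this.congr' ?_
    filter_upwards with r
    rw [slope_def_field]
    simp
  have hd : ∀ i, ¬ c i < Real.pi / 2 → c i = Real.pi / 2 ∧ d i < 0 := by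
    intro i hi
    have h1 := le_antisymm (hc i).2 (not_lt.1 hi)
    refine ⟨h1, ?_⟩
    have := hcd i
    linarith
  have hbig : Tendsto (fun r : ℝ => ∑ i, (logCosIntegral (c i + r * d i) - logCosIntegral (c i)) / r)
      (𝓝[>] 0) atTop := by
    have hsplit : ∀ r : ℝ, ∑ i, (logCosIntegral (c i + r * d i) - logCosIntegral (c i)) / r =
        ∑ i with c i < Real.pi / 2, (logCosIntegral (c i + r * d i) - logCosIntegral (c i)) / r +
        (∑ i ∈ (Finset.univ.filter fun i => ¬ c i < Real.pi / 2).erase j,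
          (logCosIntegral (c i + r * d i) - logCosIntegral (c i)) / r +
        (logCosIntegral (c j + r * d j) - logCosIntegral (c j)) / r) := by
      intro r
      rw [Finset.sum_erase_add _ _ (by simp at hj ⊢; exact hj),
        Finset.sum_filter_add_sum_filter_not]
    simp only [hsplit]
    refine Tendsto.add_atTop (tendsto_finsetSum _ fun i hi => hslope i (Finset.mem_filter.1 hi).2) ?_
    have htop : ∀ i, ¬ c i < Real.pi / 2 →
        Tendsto (fun r : ℝ => (logCosIntegral (c i + r * d i) - logCosIntegral (c i)) / r)
          (𝓝[>] 0) atTop := by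
      intro i hi
      rw [(hd i hi).1]
      exact tendsto_slope_logCosIntegral_atTop (hd i hi).2
    refine tendsto_atTop_add_left_of_le' _ 0 ?_ (htop j hj)
    have : ∀ᶠ r : ℝ in 𝓝[>] 0, ∀ i, ¬ c i < Real.pi / 2 →
        0 ≤ (logCosIntegral (c i + r * d i) - logCosIntegral (c i)) / r := by
      rw [eventually_all]
      intro i
      by_cases hi : c i < Real.pi / 2
      · simp [hi]
      · filter_upwards [(htop i hi).eventually_ge_atTop 0] with r hr _ using hr
    filter_upwards [this] with r hr
    refine Finset.sum_nonneg fun i hi => hr i ?_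
    simpa using (Finset.mem_of_mem_erase hi)
  have hle : ∀ᶠ r : ℝ in 𝓝[>] 0,
      ∑ i, (logCosIntegral (c i + r * d i) - logCosIntegral (c i)) / r ≤ 0 := by
    filter_upwards [Ioo_mem_nhdsGT (show (0 : ℝ) < 1 by norm_num)] with r hr
    rw [← Finset.sum_div, Finset.sum_sub_distrib]
    exact div_nonpos_of_nonpos_of_nonneg (sub_nonpos.2 (hmax r ⟨hr.1.le, hr.2.le⟩)) hr.1.le
  obtain ⟨r, h1, h2⟩ := (hle.and (hbig.eventually_gt_atTop 0)).exists
  linarith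

/-- Strict monotonicity of the gradient of a sum of primitives of `log cos` along a segment on which
its Hessian is negative. -/
theorem sum_mul_log_cos_lt {ι : Type*} [Fintype ι] {c d : ι → ℝ}
    (h : ∀ r ∈ Set.Icc (0 : ℝ) 1, ∀ j, c j + r * d j ∈ Set.Ioo (-(Real.pi / 2)) (Real.pi / 2))
    (hQ : ∀ r ∈ Set.Icc (0 : ℝ) 1, 0 < ∑ j, Real.tan (c j + r * d j) * d j ^ 2) :
    ∑ j, d j * Real.log (Real.cos (c j + d j)) < ∑ j, d j * Real.log (Real.cos (c j)) := by
  have hder : ∀ r ∈ Set.Icc (0 : ℝ) 1,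
      HasDerivAt (fun r : ℝ => ∑ j, d j * Real.log (Real.cos (c j + r * d j)))
        (∑ j, -(Real.tan (c j + r * d j) * d j ^ 2)) r := by
    intro r hr
    refine HasDerivAt.fun_sum fun j _ => ?_
    have h1 : HasDerivAt (fun r : ℝ => c j + r * d j) (d j) r := by
      simpa using ((hasDerivAt_id r).mul_const (d j)).const_add (c j)
    have hne := (Real.cos_pos_of_mem_Ioo (h r hr j)).ne'
    refine (((h1.cos).log hne).const_mul (d j)).congr_deriv ?_
    rw [Real.tan_eq_sin_div_cos]
    field_simp
  have hanti : StrictAntiOn (fun r : ℝ => ∑ j, d j * Real.log (Real.cos (c j + r * d j)))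
      (Set.Icc 0 1) := by
    refine strictAntiOn_of_deriv_neg (convex_Icc 0 1)
      (fun r hr => (hder r hr).continuousAt.continuousWithinAt) fun r hr => ?_
    rw [interior_Icc] at hr
    have hr' : r ∈ Set.Icc (0 : ℝ) 1 := ⟨hr.1.le, hr.2.le⟩
    rw [(hder r hr').deriv, Finset.sum_neg_distrib]
    exact neg_neg_of_pos (hQ r hr')
  simpa using hanti (Set.left_mem_Icc.2 zero_le_one) (Set.right_mem_Icc.2 zero_le_one) one_pos

/-- Positivity of a ternary quadratic form by completing squares. -/
theorem ternary_form_pos {l m n : ℝ} (hl : 0 < l) (hlm : 1 < l * m)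
    (hdet : 0 < l * m * n + 2 - l - m - n) {a b c : ℝ} (h : ¬(a = 0 ∧ b = 0 ∧ c = 0)) :
    0 < l * a ^ 2 + m * b ^ 2 + n * c ^ 2 + 2 * (a * b + a * c + b * c) := by
  have hp : 0 < l * m - 1 := by linarith
  have hid : l * (l * m - 1) * (l * a ^ 2 + m * b ^ 2 + n * c ^ 2 + 2 * (a * b + a * c + b * c)) =
      (l * m - 1) * (l * a + b + c) ^ 2 + ((l * m - 1) * b + (l - 1) * c) ^ 2 +
        l * (l * m * n + 2 - l - m - n) * c ^ 2 := by ring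
  have hprod : 0 < l * (l * m - 1) := mul_pos hl hp
  refine pos_of_mul_pos_right (?_ : 0 < l * (l * m - 1) * _) hprod.le
  rw [hid]
  rcases eq_or_ne c 0 with rfl | hc
  · rcases eq_or_ne b 0 with rfl | hb
    · have ha : a ≠ 0 := fun ha => h ⟨ha, rfl, rfl⟩
      have : 0 < (l * a) ^ 2 := by positivity
      nlinarith
    · have : 0 < ((l * m - 1) * b) ^ 2 := by positivity
      have h2 : 0 ≤ (l * m - 1) * (l * a + b) ^ 2 := by positivity
      simp only [mul_zero, add_zero]
      nlinarith
  · have : 0 < l * (l * m * n + 2 - l - m - n) * c ^ 2 := by positivity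
    have h2 : 0 ≤ (l * m - 1) * (l * a + b + c) ^ 2 := by positivity
    nlinarith [sq_nonneg ((l * m - 1) * b + (l - 1) * c)]

/-- The negative Hessian of the potential of a hyperbolic triangle is positive definite.  Here
`A`, `B`, `C` are the angles, and the form is evaluated in the direction `a`, `b`, `c`.  In
the coordinates `sin A (s - a) / cos (S - A)`, with `s`, `S` the half sums, it has constant
off-diagonal entries and, up to a positive factor, determinant `4 cos² S`. -/
theorem triangle_hessian_pos {A B C a b c : ℝ} (hA : 0 < A) (hB : 0 < B) (hC : 0 < C)
    (hS : A + B + C < Real.pi) (h : ¬(a = 0 ∧ b = 0 ∧ c = 0)) :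
    0 < Real.tan ((A + B + C) / 2) * ((a + b + c) / 2) ^ 2 +
      (Real.tan ((A + B + C) / 2 - A) * ((a + b + c) / 2 - a) ^ 2 +
        Real.tan ((A + B + C) / 2 - B) * ((a + b + c) / 2 - b) ^ 2 +
        Real.tan ((A + B + C) / 2 - C) * ((a + b + c) / 2 - c) ^ 2) +
      (Real.tan (Real.pi / 2 - A) * a ^ 2 + Real.tan (Real.pi / 2 - B) * b ^ 2 +
        Real.tan (Real.pi / 2 - C) * c ^ 2) := by
  have hpi := Real.pi_pos
  obtain ⟨x, hx⟩ : ∃ x, x = (A + B + C) / 2 - A := ⟨_, rfl⟩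
  obtain ⟨y, hy⟩ : ∃ y, y = (A + B + C) / 2 - B := ⟨_, rfl⟩
  obtain ⟨z, hz⟩ : ∃ z, z = (A + B + C) / 2 - C := ⟨_, rfl⟩
  obtain ⟨p, hp⟩ : ∃ p, p = (a + b + c) / 2 - a := ⟨_, rfl⟩
  obtain ⟨q, hq⟩ : ∃ q, q = (a + b + c) / 2 - b := ⟨_, rfl⟩
  obtain ⟨r, hr⟩ : ∃ r, r = (a + b + c) / 2 - c := ⟨_, rfl⟩
  obtain rfl : A = y + z := by linarith
  obtain rfl : B = x + z := by linarith
  obtain rfl : C = x + y := by linarith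
  obtain rfl : a = q + r := by linarith
  obtain rfl : b = p + r := by linarith
  obtain rfl : c = p + q := by linarith
  rw [← hx, ← hy, ← hz, ← hp, ← hq, ← hr]
  clear hx hy hz hp hq hr
  have e1 : (y + z + (x + z) + (x + y)) / 2 = x + y + z := by ring
  have e2 : (q + r + (p + r) + (p + q)) / 2 = p + q + r := by ring
  rw [e1, e2, Real.tan_pi_div_two_sub, Real.tan_pi_div_two_sub, Real.tan_pi_div_two_sub]
  have hsA : 0 < Real.sin (y + z) := Real.sin_pos_of_pos_of_lt_pi hA (by linarith)
  have hsB : 0 < Real.sin (x + z) := Real.sin_pos_of_pos_of_lt_pi hB (by linarith)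
  have hsC : 0 < Real.sin (x + y) := Real.sin_pos_of_pos_of_lt_pi hC (by linarith)
  have hcx : 0 < Real.cos x := Real.cos_pos_of_mem_Ioo ⟨by linarith, by linarith⟩
  have hcy : 0 < Real.cos y := Real.cos_pos_of_mem_Ioo ⟨by linarith, by linarith⟩
  have hcz : 0 < Real.cos z := Real.cos_pos_of_mem_Ioo ⟨by linarith, by linarith⟩
  have hcs : 0 < Real.cos (x + y + z) := Real.cos_pos_of_mem_Ioo ⟨by linarith, by linarith⟩
  have hs2 : 0 < Real.sin (y + z + (x + z) + (x + y)) :=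
    Real.sin_pos_of_pos_of_lt_pi (by linarith) hS
  set l := Real.sin ((x + z) + (x + y)) / Real.sin (y + z) with hl
  set m := Real.sin ((y + z) + (x + y)) / Real.sin (x + z) with hm
  set n := Real.sin ((y + z) + (x + z)) / Real.sin (x + y) with hn
  have hl0 : 0 < l := div_pos (Real.sin_pos_of_pos_of_lt_pi (by linarith) (by linarith)) hsA
  have hlm : 1 < l * m := by
    rw [hl, hm, div_mul_div_comm, one_lt_div (mul_pos hsA hsB)]
    have : Real.sin (x + z + (x + y)) * Real.sin (y + z + (x + y)) -
        Real.sin (y + z) * Real.sin (x + z) =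
        Real.sin (x + y) * Real.sin (y + z + (x + z) + (x + y)) := by
      rw [show x + z + (x + y) = (x + z) + (x + y) by ring]
      generalize x + z = B
      generalize x + y = C
      generalize y + z = A
      simp only [Real.sin_add, Real.cos_add]
      have hC := Real.sin_sq_add_cos_sq C
      linear_combination (Real.sin A * Real.sin B) * hC
    have h2 := mul_pos hsC hs2
    linarith
  have hdet : l * m * n + 2 - l - m - n = 4 * Real.cos (x + y + z) ^ 2 := by
    have h2 : 4 * Real.cos (x + y + z) ^ 2 = 2 + 2 * Real.cos ((y + z) + (x + z) + (x + y)) := by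
      rw [show (y + z) + (x + z) + (x + y) = 2 * (x + y + z) by ring, Real.cos_two_mul]
      ring
    rw [h2, hl, hm, hn]
    field_simp
    generalize x + z = B
    generalize x + y = C
    generalize y + z = A
    simp only [Real.sin_add, Real.cos_add]
    have hA := Real.sin_sq_add_cos_sq A
    have hB := Real.sin_sq_add_cos_sq B
    have hC := Real.sin_sq_add_cos_sq C
    linear_combination
      (Real.sin C * Real.cos C * Real.sin B ^ 2 + Real.sin B * Real.cos B * Real.sin C ^ 2) * hA +
      (Real.sin C * Real.cos C * Real.sin A ^ 2 + Real.sin A * Real.cos A * Real.sin C ^ 2) * hB +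
      (Real.sin B * Real.cos B * Real.sin A ^ 2 + Real.sin A * Real.cos A * Real.sin B ^ 2) * hC
  have hdet0 : 0 < l * m * n + 2 - l - m - n := by rw [hdet]; positivity
  set K := Real.cos x * Real.cos y * Real.cos z /
    (Real.cos (x + y + z) * (Real.sin (y + z) * Real.sin (x + z) * Real.sin (x + y))) with hK
  have hK0 : 0 < K := by positivity
  -- off-diagonal coefficients
  have off : ∀ {x y z : ℝ}, Real.cos (x + y + z) ≠ 0 → Real.sin (x + y) ≠ 0 →
      Real.tan (x + y + z) + (Real.tan (x + y))⁻¹ =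
        Real.cos z / (Real.cos (x + y + z) * Real.sin (x + y)) := by
    intro x y z h1 h2
    have hz : Real.cos z = Real.cos (x + y + z) * Real.cos (x + y) +
        Real.sin (x + y + z) * Real.sin (x + y) := by
      rw [← Real.cos_sub]; congr 1; ring
    rw [hz, Real.tan_eq_sin_div_cos, Real.tan_eq_sin_div_cos, inv_div]
    field_simp
    ring
  -- diagonal coefficients
  have diag : ∀ {x y z : ℝ}, Real.cos (x + y + z) ≠ 0 → Real.cos x ≠ 0 → Real.sin (x + y) ≠ 0 →
      Real.sin (x + z) ≠ 0 →
      Real.tan (x + y + z) + Real.tan x + (Real.tan (x + z))⁻¹ + (Real.tan (x + y))⁻¹ =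
        Real.sin ((x + z) + (x + y)) * (Real.cos y * Real.cos z) /
          (Real.cos (x + y + z) * Real.cos x * (Real.sin (x + z) * Real.sin (x + y))) := by
    intro x y z h1 h2 h3 h4
    have i1 : Real.tan (x + y + z) + Real.tan x =
        Real.sin ((x + z) + (x + y)) / (Real.cos (x + y + z) * Real.cos x) := by
      rw [show (x + z) + (x + y) = (x + y + z) + x by ring, Real.sin_add, Real.tan_eq_sin_div_cos,
        Real.tan_eq_sin_div_cos]
      field_simp
    have i2 : (Real.tan (x + z))⁻¹ + (Real.tan (x + y))⁻¹ =
        Real.sin ((x + z) + (x + y)) / (Real.sin (x + z) * Real.sin (x + y)) := by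
      rw [Real.sin_add (x + z), Real.tan_eq_sin_div_cos, Real.tan_eq_sin_div_cos]
      field_simp
      ring
    have i3 : Real.cos y * Real.cos z =
        Real.sin (x + z) * Real.sin (x + y) + Real.cos (x + y + z) * Real.cos x := by
      have hx := Real.sin_sq_add_cos_sq x
      simp only [Real.sin_add, Real.cos_add]
      linear_combination (- Real.cos y * Real.cos z) * hx
    rw [i3, add_assoc, i1, i2]
    field_simp
  have hform : Real.tan (x + y + z) * (p + q + r) ^ 2 +
      (Real.tan x * p ^ 2 + Real.tan y * q ^ 2 + Real.tan z * r ^ 2) +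
      ((Real.tan (y + z))⁻¹ * (q + r) ^ 2 + (Real.tan (x + z))⁻¹ * (p + r) ^ 2 +
        (Real.tan (x + y))⁻¹ * (p + q) ^ 2) =
      K * (l * (p * Real.sin (y + z) / Real.cos x) ^ 2 +
        m * (q * Real.sin (x + z) / Real.cos y) ^ 2 + n * (r * Real.sin (x + y) / Real.cos z) ^ 2 +
        2 * ((p * Real.sin (y + z) / Real.cos x) * (q * Real.sin (x + z) / Real.cos y) +
          (p * Real.sin (y + z) / Real.cos x) * (r * Real.sin (x + y) / Real.cos z) +
          (q * Real.sin (x + z) / Real.cos y) * (r * Real.sin (x + y) / Real.cos z))) := by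
    have oxy := off hcs.ne' hsC.ne'
    have oxz := off (x := x) (y := z) (z := y) (by rw [add_right_comm]; exact hcs.ne') hsB.ne'
    have oyz := off (x := y) (y := z) (z := x)
      (by rw [show y + z + x = x + y + z by ring]; exact hcs.ne') hsA.ne'
    have dx := diag hcs.ne' hcx.ne' hsC.ne' hsB.ne'
    have dy := diag (x := y) (y := x) (z := z) (by rw [add_comm y x]; exact hcs.ne') hcy.ne'
      (by rw [add_comm]; exact hsC.ne') hsA.ne'
    have dz := diag (x := z) (y := x) (z := y)
      (by rw [show z + x + y = x + y + z by ring]; exact hcs.ne') hcz.ne'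
      (by rw [add_comm]; exact hsB.ne') (by rw [add_comm]; exact hsA.ne')
    rw [add_right_comm x z y] at oxz
    rw [show y + z + x = x + y + z by ring] at oyz
    rw [add_comm y x] at dy
    rw [show z + x + y = x + y + z by ring, add_comm z x, add_comm z y] at dz
    have split : Real.tan (x + y + z) * (p + q + r) ^ 2 +
      (Real.tan x * p ^ 2 + Real.tan y * q ^ 2 + Real.tan z * r ^ 2) +
      ((Real.tan (y + z))⁻¹ * (q + r) ^ 2 + (Real.tan (x + z))⁻¹ * (p + r) ^ 2 +
        (Real.tan (x + y))⁻¹ * (p + q) ^ 2) =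
      (Real.tan (x + y + z) + Real.tan x + (Real.tan (x + z))⁻¹ + (Real.tan (x + y))⁻¹) * p ^ 2 +
      (Real.tan (x + y + z) + Real.tan y + (Real.tan (y + z))⁻¹ + (Real.tan (x + y))⁻¹) * q ^ 2 +
      (Real.tan (x + y + z) + Real.tan z + (Real.tan (y + z))⁻¹ + (Real.tan (x + z))⁻¹) * r ^ 2 +
      2 * ((Real.tan (x + y + z) + (Real.tan (x + y))⁻¹) * (p * q) +
        (Real.tan (x + y + z) + (Real.tan (x + z))⁻¹) * (p * r) +
        (Real.tan (x + y + z) + (Real.tan (y + z))⁻¹) * (q * r)) := by ring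
    rw [split, oxy, oxz, oyz, dx, dy, dz, hK, hl, hm, hn]
    field_simp
  rw [hform]
  refine mul_pos hK0 (ternary_form_pos hl0 hlm hdet0 fun hz => h ?_)
  have hp : p = 0 := by
    have := hz.1
    simpa [hsA.ne', hcx.ne'] using this
  have hq : q = 0 := by
    have := hz.2.1
    simpa [hsB.ne', hcy.ne'] using this
  have hr : r = 0 := by
    have := hz.2.2
    simpa [hsC.ne', hcz.ne'] using this
  simp [hp, hq, hr]

/-- The affine functions of the angles of a triangle at which its potential evaluates the primitive
of `log cos`: the half angle sum, the half angle sum minus an angle, and the complements of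
the angles. -/
def potentialArg {ι : Type*} [Fintype ι] (A : ι → ℝ) : Option ι ⊕ ι → ℝ
  | .inl none => (∑ i, A i) / 2
  | .inl (some i) => (∑ i, A i) / 2 - A i
  | .inr i => Real.pi / 2 - A i

/-- The linear part of `potentialArg`. -/
def potentialDir {ι : Type*} [Fintype ι] (a : ι → ℝ) : Option ι ⊕ ι → ℝ
  | .inl none => (∑ i, a i) / 2
  | .inl (some i) => (∑ i, a i) / 2 - a i
  | .inr i => - a i

theorem potentialArg_add {ι : Type*} [Fintype ι] (A a : ι → ℝ) (j : Option ι ⊕ ι) :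
    potentialArg (A + a) j = potentialArg A j + potentialDir a j := by
  rcases j with (_ | i) | i <;> simp only [potentialArg, potentialDir, Pi.add_apply,
    Finset.sum_add_distrib] <;> ring

theorem potentialDir_add {ι : Type*} [Fintype ι] (A a : ι → ℝ) (j : Option ι ⊕ ι) :
    potentialDir (A + a) j = potentialDir A j + potentialDir a j := by
  rcases j with (_ | i) | i <;> simp only [potentialDir, Pi.add_apply,
    Finset.sum_add_distrib] <;> ring

theorem potentialDir_smul {ι : Type*} [Fintype ι] (r : ℝ) (a : ι → ℝ) (j : Option ι ⊕ ι) :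
    potentialDir (r • a) j = r * potentialDir a j := by
  rcases j with (_ | i) | i <;> simp only [potentialDir, Pi.smul_apply, smul_eq_mul,
    ← Finset.mul_sum] <;> ring

theorem continuous_potentialArg {ι : Type*} [Fintype ι] (j : Option ι ⊕ ι) :
    Continuous fun A : ι → ℝ => potentialArg A j := by
  rcases j with (_ | i) | i <;> simp only [potentialArg] <;> fun_prop

/-- The angles of a hyperbolic triangle: positive numbers with sum less than `π`. -/
def IsHypAngles {ι : Type*} [Fintype ι] (A : ι → ℝ) : Prop :=
  (∀ i, 0 < A i) ∧ ∑ i, A i < Real.pi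

theorem IsHypAngles.potentialArg_mem {ι : Type*} [Fintype ι] {A : ι → ℝ} (hA : IsHypAngles A)
    (j : Option ι ⊕ ι) : potentialArg A j ∈ Set.Ioo (-(Real.pi / 2)) (Real.pi / 2) := by
  have hs : 0 ≤ ∑ i, A i := Finset.sum_nonneg fun i _ => (hA.1 i).le
  have hle : ∀ i, A i ≤ ∑ i, A i := fun i =>
    Finset.single_le_sum (fun i _ => (hA.1 i).le) (Finset.mem_univ i)
  have h2 := hA.2
  have hpi := Real.pi_pos
  rcases j with (_ | i) | i
  · exact ⟨by simp only [potentialArg]; linarith, by simp only [potentialArg]; linarith⟩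
  · have := hA.1 i
    have := hle i
    exact ⟨by simp only [potentialArg]; linarith, by simp only [potentialArg]; linarith⟩
  · have := hA.1 i
    have := hle i
    exact ⟨by simp only [potentialArg]; linarith, by simp only [potentialArg]; linarith⟩

theorem IsHypAngles.add_smul {ι : Type*} [Fintype ι] {A a : ι → ℝ} (hA : IsHypAngles A)
    (hAa : IsHypAngles (A + a)) {r : ℝ} (hr : r ∈ Set.Icc (0 : ℝ) 1) :
    IsHypAngles (A + r • a) := by
  have hid : ∀ i, (A + r • a) i = (1 - r) * A i + r * (A + a) i := fun i => by
    simp only [Pi.add_apply, Pi.smul_apply, smul_eq_mul]; ring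
  have h1 : 0 ≤ 1 - r := sub_nonneg.2 hr.2
  refine ⟨fun i => ?_, ?_⟩
  · rw [hid]
    rcases hr.1.eq_or_lt with h | h
    · rw [← h]; simpa using hA.1 i
    · exact add_pos_of_nonneg_of_pos (mul_nonneg h1 (hA.1 i).le) (mul_pos h (hAa.1 i))
  · rw [Finset.sum_congr rfl fun i _ => hid i, Finset.sum_add_distrib, ← Finset.mul_sum,
      ← Finset.mul_sum]
    have e1 := hA.2
    have e2 := hAa.2
    rcases hr.1.eq_or_lt with h | h
    · rw [← h]; simpa using e1
    · nlinarith [mul_le_mul_of_nonneg_left e1.le h1, mul_lt_mul_of_pos_left e2 h]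

theorem exists_equiv_fin_three {ι : Type*} [Fintype ι] (h : Fintype.card ι = 3) :
    Nonempty (Fin 3 ≃ ι) := ⟨(Fintype.equivFinOfCardEq h).symm⟩

/-- Strict concavity of the potential of a triangle. -/
theorem sum_potentialDir_mul_lt {ι : Type*} [Fintype ι] (hι : Fintype.card ι = 3) {A a : ι → ℝ}
    (hA : IsHypAngles A) (hAa : IsHypAngles (A + a)) (ha : a ≠ 0) :
    ∑ j, potentialDir a j * Real.log (Real.cos (potentialArg (A + a) j)) <
      ∑ j, potentialDir a j * Real.log (Real.cos (potentialArg A j)) := by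
  simp only [potentialArg_add]
  refine sum_mul_log_cos_lt (fun r hr j => ?_) fun r hr => ?_
  · rw [← potentialDir_smul, ← potentialArg_add]
    exact (hA.add_smul hAa hr).potentialArg_mem j
  · simp only [← potentialDir_smul r a, ← potentialArg_add]
    obtain ⟨e⟩ := exists_equiv_fin_three hι
    have hB := hA.add_smul hAa hr
    generalize A + r • a = B at hB
    obtain ⟨hB0, hBs⟩ := hB
    rw [← e.sum_comp, Fin.sum_univ_three] at hBs
    have := triangle_hessian_pos (a := a (e 0)) (b := a (e 1)) (c := a (e 2))
      (hB0 (e 0)) (hB0 (e 1)) (hB0 (e 2)) hBs ?_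
    · simp only [Fintype.sum_sum_type, Fintype.sum_option, potentialArg, potentialDir,
        ← e.sum_comp, Fin.sum_univ_three]
      simpa only [neg_sq] using this
    · rintro ⟨h0, h1, h2⟩
      refine ha (funext fun i => ?_)
      obtain ⟨k, rfl⟩ := e.surjective i
      fin_cases k <;> assumption

/-- The logarithm of `sinh² (ℓ / 2)`, where `ℓ` is the length of an edge of the hyperbolic triangle
with angles `A`.  The predicate `P` holds for the two ends of the edge. -/
def edgeLog {ι : Type*} [Fintype ι] (A : ι → ℝ) (P : ι → Prop) [DecidablePred P] : ℝ :=
  Real.log (Real.cos ((∑ i, A i) / 2)) +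
    ∑ i, if P i then - Real.log (Real.cos (Real.pi / 2 - A i))
      else Real.log (Real.cos ((∑ i, A i) / 2 - A i))

theorem sum_potentialDir_indicator {ι : Type*} [Fintype ι] (A : ι → ℝ) (P : ι → Prop)
    [DecidablePred P] (hP : ∑ i, (if P i then (1 : ℝ) else 0) = 2) :
    ∑ j, potentialDir (fun i => if P i then (1 : ℝ) else 0) j *
      Real.log (Real.cos (potentialArg A j)) = edgeLog A P := by
  simp only [Fintype.sum_sum_type, Fintype.sum_option, potentialArg, potentialDir, hP, edgeLog]
  rw [div_self two_ne_zero, one_mul, add_assoc, ← Finset.sum_add_distrib]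
  congr 1
  refine Finset.sum_congr rfl fun i _ => ?_
  split_ifs <;> simp

namespace SurfaceTriangulation

variable {V : Type*} [Fintype V] [DecidableEq V] {T : SurfaceTriangulation V}

/-! ### Edges, faces and conformal deformations -/

theorem edge_card (e : T.Edge) : e.1.card = 2 := by
  obtain ⟨t, _, he⟩ := Finset.mem_biUnion.1 e.2
  exact (Finset.mem_powersetCard.1 he).2

/-- The edge of a face spanned by two of its vertices. -/
def edgeOf (t : T.Face) {e : Finset V} (he : e ⊆ t.1) (hc : e.card = 2) : T.Edge :=
  ⟨e, Finset.mem_biUnion.2 ⟨t.1, t.2, Finset.mem_powersetCard.2 ⟨he, hc⟩⟩⟩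

/-- The two faces at an edge. -/
theorem exists_faces_of_edge (t : T.Face) {e : Finset V} (he : e ⊆ t.1) (hc : e.card = 2) :
    ∃ s : T.Face, s ≠ t ∧ e ⊆ s.1 ∧ ∀ r : T.Face, e ⊆ r.1 → r = s ∨ r = t := by
  have h := T.two_faces t.1 t.2 e he hc
  obtain ⟨a, b, hab, h⟩ := Finset.card_eq_two.1 h
  have hmem : ∀ r : T.Face, e ⊆ r.1 ↔ r.1 = a ∨ r.1 = b := by
    intro r
    have : r.1 ∈ T.faces.filter (fun s => e ⊆ s) ↔ r.1 = a ∨ r.1 = b := by rw [h]; simp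
    rw [← this]
    simp [r.2]
  have ha : a ∈ T.faces.filter (fun s => e ⊆ s) := by rw [h]; simp
  have hb : b ∈ T.faces.filter (fun s => e ⊆ s) := by rw [h]; simp
  rcases (hmem t).1 he with hta | htb
  · refine ⟨⟨b, (Finset.mem_filter.1 hb).1⟩, fun hbt => hab ?_, (Finset.mem_filter.1 hb).2,
      fun r hr => ?_⟩
    · rw [← hta, ← hbt]
    · rcases (hmem r).1 hr with h | h
      · exact Or.inr (Subtype.ext (h.trans hta.symm))
      · exact Or.inl (Subtype.ext h)
  · refine ⟨⟨a, (Finset.mem_filter.1 ha).1⟩, fun hat => hab ?_, (Finset.mem_filter.1 ha).2,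
      fun r hr => ?_⟩
    · rw [← htb, ← hat]
    · rcases (hmem r).1 hr with h | h
      · exact Or.inl (Subtype.ext h)
      · exact Or.inr (Subtype.ext (h.trans htb.symm))

theorem eq_or_eq_of_edge_subset {e : Finset V} (hc : e.card = 2) {s t r : T.Face} (hst : s ≠ t)
    (hs : e ⊆ s.1) (ht : e ⊆ t.1) (hr : e ⊆ r.1) : r = s ∨ r = t := by
  obtain ⟨s', _, _, h⟩ := exists_faces_of_edge t ht hc
  rcases h s hs with rfl | h'
  · exact h r hr
  · exact absurd h' hst

theorem card_face_coe (t : T.Face) : Fintype.card (t.1 : Finset V) = 3 := by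
  rw [Fintype.card_coe]
  exact T.card_face t.1 t.2

theorem sum_indicator_edge {e : Finset V} (hc : e.card = 2) (t : T.Face) (he : e ⊆ t.1) :
    ∑ v : (t.1 : Finset V), (if (v : V) ∈ e then (1 : ℝ) else 0) = 2 := by
  rw [Finset.sum_coe_sort t.1 (fun v => if v ∈ e then (1 : ℝ) else 0), Finset.sum_ite_mem,
    Finset.inter_eq_right.2 he]
  simp [hc]

theorem conformalVector_eq_left (e : T.Edge) (s t : T.Face) :
    T.conformalVector e s t s = fun v : (s.1 : Finset V) => if (v : V) ∈ e.1 then (1 : ℝ) else 0 := by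
  funext v
  simp [conformalVector]

theorem conformalVector_eq_right (e : T.Edge) {s t : T.Face} (hst : s ≠ t) :
    T.conformalVector e s t t = (-1 : ℝ) •
      fun v : (t.1 : Finset V) => if (v : V) ∈ e.1 then (1 : ℝ) else 0 := by
  funext v
  simp [conformalVector, hst.symm]

theorem conformalVector_eq_zero (e : T.Edge) {s t r : T.Face} (hs : r ≠ s) (ht : r ≠ t) :
    T.conformalVector e s t r = 0 := by
  funext v
  simp [conformalVector, hs, ht]

theorem vertexAngle_add (x y : T.AngleSpace) (v : V) :
    vertexAngle (x + y) v = vertexAngle x v + vertexAngle y v := by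
  simp only [vertexAngle, ← Finset.sum_add_distrib]
  refine Finset.sum_congr rfl fun t _ => ?_
  split_ifs <;> simp

theorem vertexAngle_smul (r : ℝ) (y : T.AngleSpace) (v : V) :
    vertexAngle (r • y) v = r * vertexAngle y v := by
  simp only [vertexAngle, Finset.mul_sum]
  refine Finset.sum_congr rfl fun t _ => ?_
  split_ifs <;> simp

/-- Conformal deformations preserve the angle sums at the vertices. -/
theorem vertexAngle_eq_zero_of_mem {d : T.AngleSpace} (hd : d ∈ T.conformalDeformations) (v : V) :
    vertexAngle d v = 0 := by
  induction hd using Submodule.span_induction with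
  | mem d hd =>
    obtain ⟨e, s, t, hst, hs, ht, rfl⟩ := hd
    rw [vertexAngle, ← Finset.sum_subset (Finset.subset_univ {s, t}), Finset.sum_pair hst,
      conformalVector_eq_left, conformalVector_eq_right e hst]
    · by_cases hv : v ∈ e.1
      · simp [hs hv, ht hv, hv]
      · simp [hv]
    · intro r _ hr
      simp only [Finset.mem_insert, Finset.mem_singleton, not_or] at hr
      rw [conformalVector_eq_zero e hr.1 hr.2]
      simp
  | zero => simp [vertexAngle]
  | add x y _ _ hx hy => rw [vertexAngle_add, hx, hy, add_zero]
  | smul r x _ hx => rw [vertexAngle_smul, hx, mul_zero]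

theorem halfPsi_add (x y : T.AngleSpace) (e : T.Edge) (t : T.Face) :
    halfPsi (x + y) e t = halfPsi x e t + halfPsi y e t := by
  simp only [halfPsi, ← Finset.sum_add_distrib, Pi.add_apply, mul_add]

theorem halfPsi_smul (r : ℝ) (y : T.AngleSpace) (e : T.Edge) (t : T.Face) :
    halfPsi (r • y) e t = r * halfPsi y e t := by
  simp only [halfPsi, Finset.mul_sum, Pi.smul_apply, smul_eq_mul]
  exact Finset.sum_congr rfl fun v _ => by ring

theorem Psi_eq (x : T.AngleSpace) (e : T.Edge) {s t : T.Face} (hst : s ≠ t) (hs : e.1 ⊆ s.1)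
    (ht : e.1 ⊆ t.1) : Psi x e = halfPsi x e s + halfPsi x e t := by
  rw [Psi, ← Finset.sum_subset (Finset.subset_univ {s, t}), Finset.sum_pair hst, if_pos hs,
    if_pos ht]
  intro r _ hr
  rw [if_neg]
  intro her
  simp only [Finset.mem_insert, Finset.mem_singleton] at hr
  exact hr (eq_or_eq_of_edge_subset (edge_card e) hst hs ht her)

theorem halfPsi_indicator (e e' : T.Edge) (t : T.Face) (he : e.1 ⊆ t.1) (he' : e'.1 ⊆ t.1) :
    ∑ v : (t.1 : Finset V), (if (v : V) ∈ e.1 then 1 / 2 else -(1 / 2)) *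
      (if (v : V) ∈ e'.1 then (1 : ℝ) else 0) = if e = e' then 1 else 0 := by
  rw [Finset.sum_coe_sort t.1 (fun v => (if v ∈ e.1 then (1 / 2 : ℝ) else -(1 / 2)) *
      (if v ∈ e'.1 then (1 : ℝ) else 0))]
  have h1 := edge_card e
  have h2 := edge_card e'
  have h3 := T.card_face t.1 t.2
  simp only [mul_ite, mul_one, mul_zero]
  rw [Finset.sum_ite_mem, Finset.inter_eq_right.2 he']
  split_ifs with h
  · subst h
    rw [Finset.sum_congr rfl fun v hv => if_pos hv]
    simp [h1]
  · have h4 : (e'.1 ∩ e.1).card = 1 := by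
      have hne : e.1 ≠ e'.1 := fun h' => h (Subtype.ext h')
      have hu : (e'.1 ∪ e.1).card ≤ 3 := h3 ▸ Finset.card_le_card (Finset.union_subset he' he)
      have hi := Finset.card_union_add_card_inter e'.1 e.1
      have hlt : (e'.1 ∩ e.1).card < 2 := by
        by_contra! h5
        have h6 : e'.1 ∩ e.1 = e'.1 :=
          Finset.eq_of_subset_of_card_le Finset.inter_subset_left (by omega)
        have h7 : e'.1 ∩ e.1 = e.1 :=
          Finset.eq_of_subset_of_card_le Finset.inter_subset_right (by omega)
        exact hne (h7.symm.trans h6)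
      omega
    have h5 := Finset.card_sdiff_add_card_inter e'.1 e.1
    rw [Finset.sum_ite, Finset.filter_mem_eq_inter, ← Finset.sdiff_eq_filter]
    simp only [Finset.sum_const, h4]
    rw [show (e'.1 \ e.1).card = 1 by omega]
    norm_num

/-- Conformal deformations preserve the informal angle complements of the edges. -/
theorem Psi_eq_zero_of_mem {d : T.AngleSpace} (hd : d ∈ T.conformalDeformations) (e : T.Edge)
    {s t : T.Face} (hst : s ≠ t) (hs : e.1 ⊆ s.1) (ht : e.1 ⊆ t.1) :
    halfPsi d e s + halfPsi d e t = 0 := by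
  induction hd using Submodule.span_induction with
  | mem d hd =>
    obtain ⟨e', s', t', hst', hs', ht', rfl⟩ := hd
    have key : ∀ r : T.Face, e.1 ⊆ r.1 → halfPsi (T.conformalVector e' s' t') e r =
        if e = e' then (if r = s' then 1 else if r = t' then -1 else 0) else 0 := by
      intro r hr
      by_cases h1 : r = s'
      · subst h1
        rw [halfPsi, conformalVector_eq_left, halfPsi_indicator e e' r hr hs']
        simp
      · by_cases h2 : r = t'
        · subst h2
          rw [halfPsi, conformalVector_eq_right e' hst']
          simp only [Pi.smul_apply, smul_eq_mul, mul_left_comm _ (-1 : ℝ), ← Finset.mul_sum]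
          rw [halfPsi_indicator e e' r hr ht']
          simp [h1]
        · rw [halfPsi, conformalVector_eq_zero e' h1 h2]
          simp [h1, h2]
    rw [key s hs, key t ht]
    by_cases he : e = e'
    · subst he
      have hts := hst'.symm
      rcases eq_or_eq_of_edge_subset (edge_card e) hst' hs' ht' hs with rfl | rfl <;>
      rcases eq_or_eq_of_edge_subset (edge_card e) hst' hs' ht' ht with rfl | rfl <;>
      simp_all
    · simp [he]
  | zero => simp [halfPsi]
  | add x y _ _ hx hy => rw [halfPsi_add, halfPsi_add]; linarith
  | smul r x _ hx => rw [halfPsi_smul, halfPsi_smul, ← mul_add, hx, mul_zero]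

/-! ### The variational principle -/

/-- The lengths of the edges of the hyperbolic triangles with the given angles agree in the two
faces at each edge. -/
def IsMatched (u : T.AngleSpace) : Prop :=
  ∀ (e : T.Edge) (s t : T.Face), s ≠ t → e.1 ⊆ s.1 → e.1 ⊆ t.1 →
    edgeLog (u s) (fun v => (v : V) ∈ e.1) = edgeLog (u t) (fun v => (v : V) ∈ e.1)

/-- The derivative at `u` in the direction `d` of the total potential of the faces. -/
def potentialDeriv (u d : T.AngleSpace) : ℝ :=
  ∑ t, ∑ j, potentialDir (d t) j * Real.log (Real.cos (potentialArg (u t) j))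

theorem potentialDeriv_conformalVector (u : T.AngleSpace) (e : T.Edge) {s t : T.Face}
    (hst : s ≠ t) (hs : e.1 ⊆ s.1) (ht : e.1 ⊆ t.1) :
    potentialDeriv u (T.conformalVector e s t) =
      edgeLog (u s) (fun v => (v : V) ∈ e.1) - edgeLog (u t) (fun v => (v : V) ∈ e.1) := by
  rw [potentialDeriv, ← Finset.sum_subset (Finset.subset_univ {s, t}), Finset.sum_pair hst,
    conformalVector_eq_left, conformalVector_eq_right e hst]
  · simp only [potentialDir_smul]
    rw [sum_potentialDir_indicator _ _ (sum_indicator_edge (edge_card e) s hs)]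
    simp only [mul_assoc, ← Finset.mul_sum]
    rw [sum_potentialDir_indicator _ _ (sum_indicator_edge (edge_card e) t ht)]
    ring
  · intro r _ hr
    simp only [Finset.mem_insert, Finset.mem_singleton, not_or] at hr
    rw [conformalVector_eq_zero e hr.1 hr.2, ← zero_smul ℝ (0 : (r.1 : Finset V) → ℝ)]
    simp only [potentialDir_smul]
    simp

theorem IsMatched.potentialDeriv_eq_zero {u d : T.AngleSpace} (hu : IsMatched u)
    (hd : d ∈ T.conformalDeformations) : potentialDeriv u d = 0 := by
  induction hd using Submodule.span_induction with
  | mem d hd =>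
    obtain ⟨e, s, t, hst, hs, ht, rfl⟩ := hd
    rw [potentialDeriv_conformalVector u e hst hs ht, hu e s t hst hs ht, sub_self]
  | zero =>
    rw [potentialDeriv, ← zero_smul ℝ (0 : T.AngleSpace)]
    simp only [Pi.smul_apply, potentialDir_smul]
    simp
  | add x y _ _ hx hy =>
    have : potentialDeriv u (x + y) = potentialDeriv u x + potentialDeriv u y := by
      simp only [potentialDeriv, Pi.add_apply, potentialDir_add, add_mul, Finset.sum_add_distrib]
    rw [this, hx, hy, add_zero]
  | smul r x _ hx =>
    have : potentialDeriv u (r • x) = r * potentialDeriv u x := by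
      simp only [potentialDeriv, Pi.smul_apply, potentialDir_smul, mul_assoc, Finset.mul_sum]
    rw [this, hx, mul_zero]

theorem isHypAngles_of_mem_angleSystems {u : T.AngleSpace} (hu : u ∈ T.angleSystems) (t : T.Face) :
    IsHypAngles (u t) :=
  ⟨fun v => (hu.2.1 t v).1, by have := hu.1 t; rw [curvature, angleSum] at this; linarith⟩

/-- A conformal class contains at most one angle system with matching lengths. -/
theorem IsMatched.eq_of_sub_mem {u u' : T.AngleSpace} (hu : u ∈ T.angleSystems)
    (hu' : u' ∈ T.angleSystems) (hm : IsMatched u) (hm' : IsMatched u')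
    (h : u' - u ∈ T.conformalDeformations) : u' = u := by
  by_contra hne
  have hd := sub_ne_zero.2 hne
  have hlt : potentialDeriv u' (u' - u) < potentialDeriv u (u' - u) := by
    have hA := isHypAngles_of_mem_angleSystems hu
    have hA' := isHypAngles_of_mem_angleSystems hu'
    have hadd : u' = u + (u' - u) := by abel
    obtain ⟨t, ht⟩ := Function.ne_iff.1 hd
    refine Finset.sum_lt_sum (fun t _ => ?_) ⟨t, Finset.mem_univ t, ?_⟩
    · have hadd' : u' t = u t + (u' - u) t := congrFun hadd t
      rcases eq_or_ne ((u' - u) t) 0 with h0 | h0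
      · rw [hadd', h0, add_zero]
      · have := sum_potentialDir_mul_lt (card_face_coe t) (hA t) (hadd' ▸ hA' t) h0
        rw [← hadd'] at this
        exact this.le
    · have hadd' : u' t = u t + (u' - u) t := congrFun hadd t
      have := sum_potentialDir_mul_lt (card_face_coe t) (hA t) (hadd' ▸ hA' t) ht
      rw [← hadd'] at this
      exact this
  rw [hm.potentialDeriv_eq_zero h, hm'.potentialDeriv_eq_zero h] at hlt
  exact lt_irrefl _ hlt

end SurfaceTriangulation

namespace SurfaceTriangulation

variable {V : Type*} [Fintype V] [DecidableEq V] {T : SurfaceTriangulation V}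

/-- The total potential of the faces. -/
def potential (z : T.AngleSpace) : ℝ := ∑ t, ∑ j, logCosIntegral (potentialArg (z t) j)

theorem continuous_potential : Continuous (potential (T := T)) := by
  refine continuous_finsetSum _ fun t _ => continuous_finsetSum _ fun j _ => ?_
  exact continuous_logCosIntegral.comp ((continuous_potentialArg j).comp (continuous_apply t))

/-- The closure of the part of a conformal class that consists of the angle data of hyperbolic
triangles. -/
def closedConformalClass (x : T.AngleSpace) : Set T.AngleSpace :=
  {z | z - x ∈ T.conformalDeformations ∧ ∀ t, (∀ v, 0 ≤ z t v) ∧ ∑ v, z t v ≤ Real.pi}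

theorem isCompact_closedConformalClass (x : T.AngleSpace) :
    IsCompact (closedConformalClass x) := by
  have hclosed : IsClosed (closedConformalClass x) := by
    have h1 : IsClosed {z : T.AngleSpace | z - x ∈ T.conformalDeformations} :=
      (Submodule.closed_of_finiteDimensional T.conformalDeformations).preimage
        (continuous_id.sub continuous_const)
    have h2 : IsClosed {z : T.AngleSpace | ∀ t, (∀ v, 0 ≤ z t v) ∧ ∑ v, z t v ≤ Real.pi} := by
      simp only [Set.ofPred_forall, Set.ofPred_and]
      refine isClosed_iInter fun t => (isClosed_iInter fun v => ?_).inter ?_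
      · exact isClosed_le continuous_const (by fun_prop)
      · exact isClosed_le (by fun_prop) continuous_const
    exact h1.inter h2
  refine (isCompact_univ_pi fun t => isCompact_univ_pi fun _ =>
    isCompact_Icc (a := (0 : ℝ)) (b := Real.pi)).of_isClosed_subset hclosed ?_
  intro z hz t _ v _
  refine ⟨(hz.2 t).1 v, le_trans ?_ (hz.2 t).2⟩
  exact Finset.single_le_sum (f := z t) (fun v _ => (hz.2 t).1 v) (Finset.mem_univ v)

/-- The Delaunay condition excludes Euclidean faces with an angle `π` from the closed conformal
class: the informal angle complement of the edge opposite to such an angle could not be positive. -/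
theorem lt_pi_of_mem_closedConformalClass {x z : T.AngleSpace} (hD : ∀ e, 0 < Psi x e)
    (hz : z ∈ closedConformalClass x) (t : T.Face) (v : (t.1 : Finset V)) : z t v < Real.pi := by
  by_contra! hv
  have hle : ∀ (s : T.Face) (e : T.Edge), halfPsi z e s ≤ (∑ w, z s w) / 2 := by
    intro s e
    rw [halfPsi, Finset.sum_div]
    refine Finset.sum_le_sum fun w _ => ?_
    have := (hz.2 s).1 w
    split_ifs <;> linarith
  have hsplit := Finset.add_sum_erase Finset.univ (z t) (Finset.mem_univ v)
  have hrest : 0 ≤ ∑ w ∈ Finset.univ.erase v, z t w :=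
    Finset.sum_nonneg fun w _ => (hz.2 t).1 w
  have hsum := (hz.2 t).2
  have hrest0 : ∑ w ∈ Finset.univ.erase v, z t w = 0 := by linarith
  have hw : ∀ w, w ≠ v → z t w = 0 := fun w hw =>
    (Finset.sum_eq_zero_iff_of_nonneg fun w _ => (hz.2 t).1 w).1 hrest0 w (by simp [hw])
  have hsub : t.1.erase v ⊆ t.1 := Finset.erase_subset _ _
  have hcard : (t.1.erase v).card = 2 := by
    rw [Finset.card_erase_of_mem v.2, T.card_face t.1 t.2]
  obtain ⟨s, hst, hs, -⟩ := exists_faces_of_edge t hsub hcard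
  set e : T.Edge := edgeOf t hsub hcard
  have ht : halfPsi z e t = -(1 / 2) * z t v := by
    rw [halfPsi, Finset.sum_eq_single v]
    · rw [if_neg]
      exact Finset.notMem_erase (v : V) t.1
    · intro w _ hwv
      rw [hw w hwv, mul_zero]
    · simp
  have h1 := Psi_eq_zero_of_mem hz.1 e hst hs hsub
  have h2 := Psi_eq x e hst hs hsub
  have h3 := hD e
  have h4 := hle s e
  have h5 := (hz.2 s).2
  have h6 : ∀ r, halfPsi z e r = halfPsi (z - x) e r + halfPsi x e r := fun r => by
    rw [← halfPsi_add, sub_add_cancel]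
  have h7 := h6 s
  have h8 := h6 t
  linarith

theorem potentialArg_mem_Ioc {ι : Type*} [Fintype ι] {A : ι → ℝ} (h0 : ∀ i, 0 ≤ A i)
    (hs : ∑ i, A i ≤ Real.pi) (hlt : ∀ i, A i < Real.pi) (j : Option ι ⊕ ι) :
    potentialArg A j ∈ Set.Ioc (-(Real.pi / 2)) (Real.pi / 2) := by
  have hpi := Real.pi_pos
  have hs0 : 0 ≤ ∑ i, A i := Finset.sum_nonneg fun i _ => h0 i
  rcases j with (_ | i) | i
  · exact ⟨by simp only [potentialArg]; linarith, by simp only [potentialArg]; linarith⟩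
  · have h1 : A i ≤ ∑ i, A i := Finset.single_le_sum (fun i _ => h0 i) (Finset.mem_univ i)
    have h2 := h0 i
    have h3 := hlt i
    exact ⟨by simp only [potentialArg]; linarith, by simp only [potentialArg]; linarith⟩
  · have h2 := h0 i
    have h3 := hlt i
    exact ⟨by simp only [potentialArg]; linarith, by simp only [potentialArg]; linarith⟩

/-- The potential attains its maximum over a closed Delaunay conformal class at the angle data of
hyperbolic triangles whose lengths match. -/
theorem exists_isMatched (x : T.AngleSpace) (hx : x ∈ T.angleSystems) (hD : ∀ e, 0 < Psi x e) :
    ∃ u ∈ T.angleSystems, u - x ∈ T.conformalDeformations ∧ IsMatched u := by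
  have hxA := isHypAngles_of_mem_angleSystems hx
  have hxK : x ∈ closedConformalClass x :=
    ⟨by rw [sub_self]; exact Submodule.zero_mem _, fun t =>
      ⟨fun v => ((hxA t).1 v).le, (hxA t).2.le⟩⟩
  obtain ⟨z, hz, hmax⟩ := (isCompact_closedConformalClass x).exists_isMaxOn ⟨x, hxK⟩
    continuous_potential.continuousOn
  have hmax : ∀ y ∈ closedConformalClass x, potential y ≤ potential z := hmax
  have hlt := lt_pi_of_mem_closedConformalClass hD hz
  have hc : ∀ t j, potentialArg (z t) j ∈ Set.Ioc (-(Real.pi / 2)) (Real.pi / 2) := fun t j =>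
    potentialArg_mem_Ioc (hz.2 t).1 (hz.2 t).2 (hlt t) j
  have hadd : ∀ t j (r : ℝ) (d : T.AngleSpace), potentialArg ((z + r • d) t) j =
      potentialArg (z t) j + r * potentialDir (d t) j := fun t j r d => by
    rw [← potentialDir_smul, ← potentialArg_add]
    rfl
  -- the maximum is not on the boundary
  have hint : ∀ p : (t : T.Face) × (Option (t.1 : Finset V) ⊕ (t.1 : Finset V)),
      potentialArg (z p.1) p.2 < Real.pi / 2 := by
    refine lt_pi_div_two_of_forall_sum_le (d := fun p => potentialDir ((x - z) p.1) p.2)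
      (fun p => hc p.1 p.2) (fun p => ?_) fun r hr => ?_
    · have := hadd p.1 p.2 1 (x - z)
      rw [one_mul] at this
      rw [← this, one_smul, add_sub_cancel]
      exact ((hxA p.1).potentialArg_mem p.2).2
    · have hmem : z + r • (x - z) ∈ closedConformalClass x := by
        refine ⟨?_, fun t => ⟨fun v => ?_, ?_⟩⟩
        · have : z + r • (x - z) - x = (1 - r) • (z - x) := by module
          rw [this]
          exact Submodule.smul_mem _ _ hz.1
        · have : (z + r • (x - z)) t v = (1 - r) * z t v + r * x t v := by
            simp only [Pi.add_apply, Pi.smul_apply, Pi.sub_apply, smul_eq_mul]; ring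
          rw [this]
          exact add_nonneg (mul_nonneg (sub_nonneg.2 hr.2) ((hz.2 t).1 v))
            (mul_nonneg hr.1 ((hxA t).1 v).le)
        · have : ∀ v, (z + r • (x - z)) t v = (1 - r) * z t v + r * x t v := fun v => by
            simp only [Pi.add_apply, Pi.smul_apply, Pi.sub_apply, smul_eq_mul]; ring
          rw [Finset.sum_congr rfl fun v _ => this v, Finset.sum_add_distrib, ← Finset.mul_sum,
            ← Finset.mul_sum]
          nlinarith [mul_le_mul_of_nonneg_left (hz.2 t).2 (sub_nonneg.2 hr.2),
            mul_le_mul_of_nonneg_left (hxA t).2.le hr.1]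
      have := hmax _ hmem
      simp only [potential, hadd] at this
      rw [Fintype.sum_sigma, Fintype.sum_sigma]
      exact this
  have hzA : ∀ t, IsHypAngles (z t) := by
    refine fun t => ⟨fun v => ?_, ?_⟩
    · have := hint ⟨t, .inr v⟩
      simp only [potentialArg] at this
      linarith
    · have := hint ⟨t, .inl none⟩
      simp only [potentialArg] at this
      linarith
  refine ⟨z, ⟨fun t => ?_, fun t v => ⟨(hzA t).1 v, hlt t v⟩, fun v => ?_⟩, hz.1, ?_⟩
  · have := (hzA t).2
    rw [curvature, angleSum]
    linarith
  · rw [← hx.2.2 v, ← sub_add_cancel z x, vertexAngle_add, vertexAngle_eq_zero_of_mem hz.1,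
      zero_add]
  -- the derivative in every conformal direction vanishes at the maximum
  intro e s t hst hs ht
  rw [← sub_eq_zero, ← potentialDeriv_conformalVector z e hst hs ht]
  set w := T.conformalVector e s t with hw
  have hwC : w ∈ T.conformalDeformations := Submodule.subset_span ⟨e, s, t, hst, hs, ht, rfl⟩
  have hev : ∀ᶠ r : ℝ in 𝓝 0, z + r • w ∈ closedConformalClass x := by
    have hcont : ∀ t v, Continuous fun r : ℝ => (z + r • w) t v := fun t v => by
      simp only [Pi.add_apply, Pi.smul_apply, smul_eq_mul]
      fun_prop
    have h1 : ∀ᶠ r : ℝ in 𝓝 0, ∀ t v, 0 < (z + r • w) t v := by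
      refine Filter.eventually_all.2 fun t => Filter.eventually_all.2 fun v => ?_
      refine (hcont t v).continuousAt.eventually (lt_mem_nhds ?_)
      simpa using (hzA t).1 v
    have h2 : ∀ᶠ r : ℝ in 𝓝 0, ∀ t, ∑ v, (z + r • w) t v < Real.pi := by
      refine Filter.eventually_all.2 fun t => ?_
      have : Continuous fun r : ℝ => ∑ v, (z + r • w) t v :=
        continuous_finsetSum _ fun v _ => hcont t v
      refine this.continuousAt.eventually (gt_mem_nhds ?_)
      simpa using (hzA t).2
    filter_upwards [h1, h2] with r h1 h2
    refine ⟨?_, fun t => ⟨fun v => (h1 t v).le, (h2 t).le⟩⟩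
    rw [add_sub_right_comm]
    exact Submodule.add_mem _ hz.1 (Submodule.smul_mem _ _ hwC)
  have hlocal : IsLocalMax (fun r : ℝ => potential (z + r • w)) 0 := by
    filter_upwards [hev] with r hr
    simpa using hmax _ hr
  have hderiv : HasDerivAt (fun r : ℝ => potential (z + r • w)) (potentialDeriv z w) 0 := by
    simp only [potential, potentialDeriv, hadd]
    refine HasDerivAt.fun_sum fun t _ => HasDerivAt.fun_sum fun j _ => ?_
    have h2 : HasDerivAt (fun r : ℝ => potentialArg (z t) j + r * potentialDir (w t) j)
        (potentialDir (w t) j) 0 := by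
      simpa using ((hasDerivAt_id (0 : ℝ)).mul_const (potentialDir (w t) j)).const_add
        (potentialArg (z t) j)
    have h3 : HasDerivAt logCosIntegral (Real.log (Real.cos (potentialArg (z t) j)))
        (potentialArg (z t) j + 0 * potentialDir (w t) j) := by
      rw [zero_mul, add_zero]
      exact hasDerivAt_logCosIntegral ((hzA t).potentialArg_mem j)
    rw [mul_comm]
    exact h3.comp 0 h2
  exact hlocal.hasDerivAt_eq_zero hderiv

end SurfaceTriangulation

/-! ### Lengths and angles of a hyperbolic triangle -/

/-- The hyperbolic cosine of the side between the angles `A` and `B` of the hyperbolic triangle with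
angles `A`, `B`, `C`. -/
def coshSide (A B C : ℝ) : ℝ := (Real.cos C + Real.cos A * Real.cos B) / (Real.sin A * Real.sin B)

theorem coshSide_swap (A B C : ℝ) : coshSide A B C = coshSide B A C := by
  rw [coshSide, coshSide, mul_comm (Real.cos A), mul_comm (Real.sin A)]

/-- The second hyperbolic law of cosines follows from the first. -/
theorem cosh_eq_coshSide {a b c A B C : ℝ} (ha : 0 < a) (hb : 0 < b) (hc : 0 < c)
    (hA : 0 < Real.sin A) (hB : 0 < Real.sin B)
    (h1 : Real.cosh a = Real.cosh b * Real.cosh c - Real.sinh b * Real.sinh c * Real.cos A)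
    (h2 : Real.cosh b = Real.cosh a * Real.cosh c - Real.sinh a * Real.sinh c * Real.cos B)
    (h3 : Real.cosh c = Real.cosh a * Real.cosh b - Real.sinh a * Real.sinh b * Real.cos C) :
    Real.cosh c = coshSide A B C := by
  have sa := Real.sinh_pos_iff.2 ha
  have sb := Real.sinh_pos_iff.2 hb
  have sc := Real.sinh_pos_iff.2 hc
  have ea := Real.cosh_sq a
  have eb := Real.cosh_sq b
  have ec := Real.cosh_sq c
  have eA := Real.sin_sq_add_cos_sq A
  have eB := Real.sin_sq_add_cos_sq B
  have e4 : Real.sin A * Real.sinh b * Real.sinh c = Real.sin B * Real.sinh a * Real.sinh c := by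
    refine (pow_left_inj₀ (by positivity) (by positivity) two_ne_zero).1 ?_
    have i1 : (Real.sin A * Real.sinh b * Real.sinh c) ^ 2 =
        Real.sinh b ^ 2 * Real.sinh c ^ 2 -
          (Real.cosh b * Real.cosh c - Real.cosh a) ^ 2 := by
      have : Real.cosh b * Real.cosh c - Real.cosh a = Real.sinh b * Real.sinh c * Real.cos A := by
        linarith
      rw [this]
      linear_combination (Real.sinh b ^ 2 * Real.sinh c ^ 2) * eA
    have i2 : (Real.sin B * Real.sinh a * Real.sinh c) ^ 2 =
        Real.sinh a ^ 2 * Real.sinh c ^ 2 -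
          (Real.cosh a * Real.cosh c - Real.cosh b) ^ 2 := by
      have : Real.cosh a * Real.cosh c - Real.cosh b = Real.sinh a * Real.sinh c * Real.cos B := by
        linarith
      rw [this]
      linear_combination (Real.sinh a ^ 2 * Real.sinh c ^ 2) * eB
    rw [i1, i2]
    rw [← sub_eq_iff_eq_add] at ea eb ec
    rw [← ea, ← eb, ← ec]
    ring
  have hprod : Real.sin A * Real.sin B * (Real.sinh a * Real.sinh b * Real.sinh c ^ 2) =
      Real.sinh b ^ 2 * Real.sinh c ^ 2 - (Real.cosh b * Real.cosh c - Real.cosh a) ^ 2 := by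
    have : Real.cosh b * Real.cosh c - Real.cosh a = Real.sinh b * Real.sinh c * Real.cos A := by
      linarith
    rw [this]
    linear_combination (Real.sinh b ^ 2 * Real.sinh c ^ 2) * eA -
      (Real.sin A * Real.sinh b * Real.sinh c) * e4
  have hpos : 0 < Real.sinh a * Real.sinh b * Real.sinh c ^ 2 := by positivity
  rw [coshSide, eq_div_iff (mul_pos hA hB).ne']
  refine mul_right_cancel₀ hpos.ne' ?_
  rw [mul_assoc, hprod]
  have c1 : Real.sinh b * Real.sinh c * Real.cos A = Real.cosh b * Real.cosh c - Real.cosh a := by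
    linarith
  have c2 : Real.sinh a * Real.sinh c * Real.cos B = Real.cosh a * Real.cosh c - Real.cosh b := by
    linarith
  have c3 : Real.sinh a * Real.sinh b * Real.cos C = Real.cosh a * Real.cosh b - Real.cosh c := by
    linarith
  have rhs : (Real.cos C + Real.cos A * Real.cos B) *
      (Real.sinh a * Real.sinh b * Real.sinh c ^ 2) =
      (Real.cosh a * Real.cosh b - Real.cosh c) * Real.sinh c ^ 2 +
      (Real.cosh b * Real.cosh c - Real.cosh a) * (Real.cosh a * Real.cosh c - Real.cosh b) := by
    rw [← c1, ← c2, ← c3]; ring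
  rw [rhs]
  rw [← sub_eq_iff_eq_add] at ea eb ec
  rw [← eb, ← ec]
  ring

/-- Half-angle form of the second law of cosines. -/
theorem coshSide_sub_one {A B C : ℝ} (hA : Real.sin A ≠ 0) (hB : Real.sin B ≠ 0) :
    (coshSide A B C - 1) / 2 = Real.cos ((A + B + C) / 2) * Real.cos ((A + B + C) / 2 - C) /
      (Real.sin A * Real.sin B) := by
  have h : Real.cos C = 2 * (Real.cos ((A + B + C) / 2) * Real.cos ((A + B + C) / 2 - C)) -
      Real.cos (A + B) := by
    have h1 : Real.cos (A + B) = Real.cos ((A + B + C) / 2 + ((A + B + C) / 2 - C)) := by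
      congr 1; ring
    have h2 : Real.cos C = Real.cos ((A + B + C) / 2 - ((A + B + C) / 2 - C)) := by
      congr 1; ring
    rw [h1, h2, Real.cos_add, Real.cos_sub _ ((A + B + C) / 2 - C)]
    ring_nf
  rw [coshSide, h, Real.cos_add]
  field_simp
  ring

theorem one_lt_coshSide {A B C : ℝ} (hA : 0 < A) (hB : 0 < B) (hC : 0 < C)
    (hs : A + B + C < Real.pi) : 1 < coshSide A B C := by
  have h1 : 0 < Real.sin A := Real.sin_pos_of_pos_of_lt_pi hA (by linarith)
  have h2 : 0 < Real.sin B := Real.sin_pos_of_pos_of_lt_pi hB (by linarith)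
  have h3 := coshSide_sub_one (C := C) h1.ne' h2.ne'
  have h4 : 0 < Real.cos ((A + B + C) / 2) :=
    Real.cos_pos_of_mem_Ioo ⟨by linarith, by linarith⟩
  have h5 : 0 < Real.cos ((A + B + C) / 2 - C) :=
    Real.cos_pos_of_mem_Ioo ⟨by linarith, by linarith⟩
  have h6 : 0 < (coshSide A B C - 1) / 2 := by rw [h3]; positivity
  linarith

theorem univ_eq_of_card_eq_three {ι : Type*} [Fintype ι] [DecidableEq ι]
    (hι : Fintype.card ι = 3) {a b c : ι} (hab : a ≠ b) (hbc : b ≠ c) (hac : a ≠ c) :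
    (Finset.univ : Finset ι) = {a, b, c} := by
  symm
  rw [← Finset.card_eq_iff_eq_univ, hι]
  exact Finset.card_eq_three.2 ⟨a, b, c, hab, hac, hbc, rfl⟩

theorem sum_of_card_eq_three {ι M : Type*} [Fintype ι] [AddCommMonoid M]
    (hι : Fintype.card ι = 3) {a b c : ι} (hab : a ≠ b) (hbc : b ≠ c) (hac : a ≠ c) (f : ι → M) :
    ∑ i, f i = f a + f b + f c := by
  classical
  rw [univ_eq_of_card_eq_three hι hab hbc hac, Finset.sum_insert (by simp [hab, hac]),
    Finset.sum_pair hbc, add_assoc]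

/-- `edgeLog` is the logarithm of the square of the hyperbolic sine of half the length. -/
theorem edgeLog_eq_log_coshSide {ι : Type*} [Fintype ι] (hι : Fintype.card ι = 3) {A : ι → ℝ}
    (hA : IsHypAngles A) {a b c : ι} (hab : a ≠ b) (hbc : b ≠ c) (hac : a ≠ c) (P : ι → Prop)
    [DecidablePred P] (ha : P a) (hb : P b) (hc : ¬ P c) :
    edgeLog A P = Real.log ((coshSide (A a) (A b) (A c) - 1) / 2) := by
  have hs := hA.2
  rw [sum_of_card_eq_three hι hab hbc hac] at hs
  have h0a := hA.1 a
  have h0b := hA.1 b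
  have h0c := hA.1 c
  have h1 : 0 < Real.sin (A a) := Real.sin_pos_of_pos_of_lt_pi h0a (by linarith)
  have h2 : 0 < Real.sin (A b) := Real.sin_pos_of_pos_of_lt_pi h0b (by linarith)
  have h4 : 0 < Real.cos ((A a + A b + A c) / 2) :=
    Real.cos_pos_of_mem_Ioo ⟨by linarith, by linarith⟩
  have h5 : 0 < Real.cos ((A a + A b + A c) / 2 - A c) :=
    Real.cos_pos_of_mem_Ioo ⟨by linarith, by linarith⟩
  rw [coshSide_sub_one h1.ne' h2.ne', edgeLog, sum_of_card_eq_three hι hab hbc hac,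
    sum_of_card_eq_three hι hab hbc hac, if_pos ha, if_pos hb, if_neg hc,
    Real.cos_pi_div_two_sub, Real.cos_pi_div_two_sub, Real.log_div (by positivity) (by positivity),
    Real.log_mul h4.ne' h5.ne', Real.log_mul h1.ne' h2.ne']
  ring

/-! ### Rigidity of geodesic segments in a hyperbolic surface -/

theorem isCompact_hypSegment (a b : ℍ) : IsCompact (hypSegment a b) := by
  have hclosed : IsClosed (hypSegment a b) :=
    isClosed_eq (by fun_prop) continuous_const
  refine (isCompact_closedBall a (dist a b)).of_isClosed_subset hclosed fun z hz => ?_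
  have hz : dist a z + dist z b = dist a b := hz
  rw [Metric.mem_closedBall, dist_comm]
  linarith [dist_nonneg (x := z) (y := b)]

/-- Parametrization of a geodesic segment by arc length. -/
theorem exists_arcLength_param (a b : ℍ) :
    ∃ p : ℝ → hypSegment a b, Continuous p ∧
      ∀ r ∈ Set.Icc 0 (dist a b), dist a (p r) = r := by
  rcases eq_or_ne a b with rfl | hne
  · refine ⟨fun _ => ⟨a, by simp [hypSegment]⟩, continuous_const, fun r hr => ?_⟩
    rw [dist_self] at hr ⊢
    exact le_antisymm hr.1 hr.2
  have hd : 0 < dist a b := dist_pos.2 hne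
  have hsd : 0 < Real.sinh (dist a b) := Real.sinh_pos_iff.2 hd
  set d := dist a b with hd_def
  have hab : Real.cosh d = lorentzForm (toLorentz a) (toLorentz b) := cosh_dist_eq_lorentzForm a b
  let X : ℝ → ℝ × ℂ := fun r => Real.sinh (d - r) • toLorentz a + Real.sinh r • toLorentz b
  have hXc : Continuous X :=
    ((Real.continuous_sinh.comp (continuous_const.sub continuous_id)).smul continuous_const).add
      (Real.continuous_sinh.smul continuous_const)
  have hXF : ∀ r ∈ Set.Icc 0 d, IsFuture (X r) := by
    intro r hr
    rcases hr.1.eq_or_lt with h | h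
    · have : X r = Real.sinh d • toLorentz a := by simp [X, ← h]
      rw [this]
      exact (isFuture_toLorentz a).smul hsd
    · have h2 : 0 < Real.sinh r := Real.sinh_pos_iff.2 h
      rcases hr.2.eq_or_lt with h' | h'
      · have : X r = Real.sinh d • toLorentz b := by simp [X, h']
        rw [this]
        exact (isFuture_toLorentz b).smul hsd
      · exact ((isFuture_toLorentz a).smul (Real.sinh_pos_iff.2 (sub_pos.2 h'))).add
          ((isFuture_toLorentz b).smul h2)
  have hself : ∀ r, lorentzForm (X r) (X r) = Real.sinh d ^ 2 := by
    intro r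
    have h1 := Real.cosh_sq d
    have h2 := Real.cosh_sq r
    simp only [X, map_add, map_smul, LinearMap.add_apply, LinearMap.smul_apply, smul_eq_mul,
      lorentzForm_toLorentz_self, lorentzForm_comm (toLorentz b) (toLorentz a), ← hab]
    rw [Real.sinh_sub]
    linear_combination (Real.sinh d ^ 2) * h2 - (Real.sinh r ^ 2) * h1
  have hmem : ∀ r ∈ Set.Icc 0 d, ofLorentz (X r) ∈ hypSegment a b := by
    intro r hr
    refine mem_hypSegment_iff.2 ⟨(Real.sinh d)⁻¹ * Real.sinh (d - r),
      (Real.sinh d)⁻¹ * Real.sinh r, ?_, ?_, ?_⟩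
    · exact mul_nonneg (inv_nonneg.2 hsd.le) (Real.sinh_nonneg_iff.2 (sub_nonneg.2 hr.2))
    · exact mul_nonneg (inv_nonneg.2 hsd.le) (Real.sinh_nonneg_iff.2 hr.1)
    · rw [toLorentz_ofLorentz (hXF r hr), hself, Real.sqrt_sq hsd.le, mul_smul, mul_smul,
        ← smul_add]
  have hdist : ∀ r ∈ Set.Icc 0 d, dist a (ofLorentz (X r)) = r := by
    intro r hr
    refine Real.cosh_strictMonoOn.injOn (Set.mem_Ici.2 dist_nonneg) (Set.mem_Ici.2 hr.1) ?_
    rw [cosh_dist_eq_lorentzForm, toLorentz_ofLorentz (hXF r hr), hself, Real.sqrt_sq hsd.le]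
    simp only [X, map_add, map_smul, smul_eq_mul, lorentzForm_toLorentz_self, ← hab]
    rw [Real.sinh_sub]
    field_simp
    ring
  refine ⟨fun r => ⟨ofLorentz (X (Set.projIcc 0 d hd.le r)), hmem _ (Set.projIcc 0 d hd.le r).2⟩,
    ?_, fun r hr => ?_⟩
  · refine Continuous.subtype_mk ?_ _
    exact continuousOn_ofLorentz.comp_continuous
      (hXc.comp (continuous_subtype_val.comp continuous_projIcc))
      fun r => hXF _ (Set.projIcc 0 d hd.le r).2
  · have : (Set.projIcc 0 d hd.le r : ℝ) = r := by rw [Set.projIcc_of_mem hd.le hr]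
    change dist a (ofLorentz (X (Set.projIcc 0 d hd.le r))) = r
    rw [this]
    exact hdist r hr

theorem LocallyIsometricOn.mono {f : ℍ → ℍ} {S S' : Set ℍ} (h : LocallyIsometricOn f S)
    (hS : S' ⊆ S) : LocallyIsometricOn f S' := fun z hz =>
  let ⟨U, hU, hd⟩ := h z (hS hz)
  ⟨U, nhdsWithin_mono z hS hU, hd⟩

/-- If two geodesic segments are mapped onto the same arc of a surface, isometrically in the charts,
then the second one is not longer than the first one. -/
theorem dist_le_of_image_eq {G : Type*} [TopologicalSpace G] [ChartedSpace ℍ G] [T2Space G]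
    {f f' : ℍ → G} {a b a' b' : ℍ} (hf : ContinuousOn f (hypSegment a b))
    (hf' : ContinuousOn f' (hypSegment a' b')) (hinj : Set.InjOn f' (hypSegment a' b'))
    (hiso : ∀ e ∈ atlas ℍ G,
      LocallyIsometricOn (fun z => e (f z)) (hypSegment a b ∩ f ⁻¹' e.source))
    (hiso' : ∀ e ∈ atlas ℍ G,
      LocallyIsometricOn (fun z => e (f' z)) (hypSegment a' b' ∩ f' ⁻¹' e.source))
    (himage : f '' hypSegment a b ⊆ f' '' hypSegment a' b') (ha : f a = f' a') (hb : f b = f' b') :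
    dist a' b' ≤ dist a b := by
  have haS : a ∈ hypSegment a b := by simp [hypSegment]
  have hbS : b ∈ hypSegment a b := by simp [hypSegment]
  have haS' : a' ∈ hypSegment a' b' := by simp [hypSegment]
  have hbS' : b' ∈ hypSegment a' b' := by simp [hypSegment]
  have hex : ∀ z : hypSegment a b, ∃ z' : hypSegment a' b', f' z' = f z := by
    intro z
    obtain ⟨z', hz', h⟩ := himage ⟨z, z.2, rfl⟩
    exact ⟨⟨z', hz'⟩, h⟩
  choose τ hτ using hex
  have : CompactSpace (hypSegment a' b') := isCompact_iff_compactSpace.1 (isCompact_hypSegment a' b')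
  have hemb : Topology.IsClosedEmbedding (fun z : hypSegment a' b' => f' z) :=
    (continuousOn_iff_continuous_domRestrict.1 hf').isClosedEmbedding
      (fun z w h => Subtype.ext (hinj z.2 w.2 h))
  have hτc : Continuous τ := by
    rw [hemb.isEmbedding.continuous_iff]
    have : (fun z : hypSegment a' b' => f' z) ∘ τ = fun z : hypSegment a b => f z :=
      funext hτ
    rw [this]
    exact continuousOn_iff_continuous_domRestrict.1 hf
  have hτa : (τ ⟨a, haS⟩ : ℍ) = a' := hinj (τ _).2 haS' ((hτ _).trans ha)
  have hτb : (τ ⟨b, hbS⟩ : ℍ) = b' := hinj (τ _).2 hbS' ((hτ _).trans hb)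
  obtain ⟨p, hpc, hp⟩ := exists_arcLength_param a b
  have hp0 : p 0 = ⟨a, haS⟩ := by
    have := hp 0 ⟨le_rfl, dist_nonneg⟩
    exact Subtype.ext (dist_eq_zero.1 this).symm
  have hp1 : p (dist a b) = ⟨b, hbS⟩ := by
    have h1 := hp (dist a b) ⟨dist_nonneg, le_rfl⟩
    have h2 : dist a (p (dist a b)) + dist (p (dist a b) : ℍ) b = dist a b := (p (dist a b)).2
    refine Subtype.ext (dist_eq_zero.1 (?_ : dist (p (dist a b) : ℍ) b = 0))
    linarith
  set h : ℝ → ℝ := fun r => dist a' (τ (p r)) with hh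
  have hc : Continuous h := by
    have : Continuous fun r => ((τ (p r) : hypSegment a' b') : ℍ) :=
      continuous_subtype_val.comp (hτc.comp hpc)
    exact continuous_const.dist this
  -- locally, distances in the first segment are distances in the second one
  have hloc : ∀ r₀ ∈ Set.Icc 0 (dist a b), ∀ᶠ r in 𝓝 r₀, r ∈ Set.Icc 0 (dist a b) →
      h r ≤ h r₀ + |r - r₀| := by
    intro r₀ hr₀
    set e := chartAt ℍ (f (p r₀)) with he
    have hea := chart_mem_atlas ℍ (f (p r₀))
    have hsrc : f (p r₀) ∈ e.source := mem_chart_source ℍ _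
    have hsrc' : f' (τ (p r₀)) ∈ e.source := by rw [hτ]; exact hsrc
    obtain ⟨U, hU, hUd⟩ := hiso e hea (p r₀) ⟨(p r₀).2, hsrc⟩
    obtain ⟨U', hU', hUd'⟩ := hiso' e hea (τ (p r₀)) ⟨(τ (p r₀)).2, hsrc'⟩
    rw [nhdsWithin_inter_of_mem' ((hf _ (p r₀).2).preimage_mem_nhdsWithin
      (e.open_source.mem_nhds hsrc))] at hU
    rw [nhdsWithin_inter_of_mem' ((hf' _ (τ (p r₀)).2).preimage_mem_nhdsWithin
      (e.open_source.mem_nhds hsrc'))] at hU'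
    have n1 : ∀ᶠ r in 𝓝 r₀, (p r : ℍ) ∈ U :=
      (hpc.tendsto r₀) (preimage_coe_mem_nhds_subtype.2 hU)
    have n2 : ∀ᶠ r in 𝓝 r₀, ((τ (p r) : hypSegment a' b') : ℍ) ∈ U' :=
      ((hτc.comp hpc).tendsto r₀) (preimage_coe_mem_nhds_subtype.2 hU')
    filter_upwards [n1, n2] with r h1 h2 hr
    have h10 : (p r₀ : ℍ) ∈ U := n1.self_of_nhds
    have h20 : ((τ (p r₀) : hypSegment a' b') : ℍ) ∈ U' := n2.self_of_nhds
    have hdist : dist (τ (p r₀) : ℍ) (τ (p r)) = |r - r₀| := by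
      rw [← hUd' _ h20 _ h2]
      simp only [hτ]
      rw [hUd _ h10 _ h1, dist_eq_abs_sub_of_mem_hypSegment (p r₀).2 (p r).2, hp r hr, hp r₀ hr₀,
        abs_sub_comm]
    rw [← hdist]
    exact dist_triangle _ _ _
  have hsub : Set.Icc 0 (dist a b) ⊆ {r | h r ≤ r} := by
    refine IsClosed.Icc_subset_of_forall_exists_gt
      ((isClosed_le hc continuous_id).inter isClosed_Icc) ?_ ?_
    · change h 0 ≤ 0
      simp [hh, hp0, hτa]
    · rintro r₀ ⟨hr₀, hr₀1, hr₀2⟩ y hy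
      have h1 := nhdsWithin_le_nhds (s := Set.Ioi r₀) (hloc r₀ ⟨hr₀1, hr₀2.le⟩)
      have h2 : Set.Ioo r₀ (min y (dist a b)) ∈ 𝓝[>] r₀ := Ioo_mem_nhdsGT (lt_min hy hr₀2)
      obtain ⟨r, hr1, hr2⟩ := (Filter.Eventually.and h1 h2).exists
      refine ⟨r, ?_, hr2.1, (hr2.2.trans_le (min_le_left _ _)).le⟩
      have h3 := hr1 ⟨hr₀1.trans hr2.1.le, (hr2.2.trans_le (min_le_right _ _)).le⟩
      have hr₀ : h r₀ ≤ r₀ := hr₀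
      rw [abs_of_pos (sub_pos.2 hr2.1)] at h3
      change h r ≤ r
      linarith
  have hfin : h (dist a b) ≤ dist a b := hsub ⟨dist_nonneg, le_rfl⟩
  rwa [hh, show (fun r => dist a' (τ (p r) : ℍ)) (dist a b) = dist a' (τ (p (dist a b)) : ℍ)
    from rfl, hp1, hτb] at hfin

/-! ### Lengths match in a geodesic triangulation -/

namespace SurfaceTriangulation

variable {V : Type*} [Fintype V] [DecidableEq V] {T : SurfaceTriangulation V}

/-- The vertex of a face opposite to an edge. -/
theorem exists_third_vertex (t : T.Face) {a b : V} (hab : a ≠ b) (ha : a ∈ t.1) (hb : b ∈ t.1) :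
    ∃ c ∈ t.1, a ≠ c ∧ b ≠ c ∧ t.1 = {a, b, c} := by
  have hsub : ({a, b} : Finset V) ⊆ t.1 := by
    intro v hv
    rcases Finset.mem_insert.1 hv with rfl | hv
    · exact ha
    · rw [Finset.mem_singleton.1 hv]; exact hb
  have h3 := T.card_face t.1 t.2
  have hlt : ({a, b} : Finset V).card < t.1.card := by rw [h3, Finset.card_pair hab]; norm_num
  obtain ⟨c, hct, hc⟩ := Finset.exists_mem_notMem_of_card_lt_card hlt
  simp only [Finset.mem_insert, Finset.mem_singleton, not_or] at hc
  have hac : a ≠ c := fun h => hc.1 h.symm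
  have hbc : b ≠ c := fun h => hc.2 h.symm
  refine ⟨c, hct, hac, hbc, (Finset.eq_of_subset_of_card_le ?_ ?_).symm⟩
  · intro v hv
    simp only [Finset.mem_insert, Finset.mem_singleton] at hv
    rcases hv with rfl | rfl | rfl <;> assumption
  · rw [h3, Finset.card_eq_three.2 ⟨a, b, c, hab, hac, hbc, rfl⟩]

/-- The logarithmic lengths in terms of the three vertices of a face. -/
theorem edgeLog_face {u : T.AngleSpace} {t : T.Face} (hA : IsHypAngles (u t)) {a b c : V}
    (hab : a ≠ b) (hac : a ≠ c) (hbc : b ≠ c) (ha : a ∈ t.1) (hb : b ∈ t.1) (hc : c ∈ t.1)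
    {e : Finset V} (he : e = {a, b}) :
    edgeLog (u t) (fun v => (v : V) ∈ e) =
      Real.log ((coshSide (u t ⟨a, ha⟩) (u t ⟨b, hb⟩) (u t ⟨c, hc⟩) - 1) / 2) := by
  refine edgeLog_eq_log_coshSide (card_face_coe t) hA (by simpa using hab) (by simpa using hbc)
    (by simpa using hac) _ ?_ ?_ ?_
  · simp [he]
  · simp [he]
  · simp [he, hac.symm, hbc.symm]

theorem one_lt_coshSide_face {u : T.AngleSpace} {t : T.Face} (hA : IsHypAngles (u t)) {a b c : V}
    (hab : a ≠ b) (hac : a ≠ c) (hbc : b ≠ c) (ha : a ∈ t.1) (hb : b ∈ t.1) (hc : c ∈ t.1) :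
    1 < coshSide (u t ⟨a, ha⟩) (u t ⟨b, hb⟩) (u t ⟨c, hc⟩) := by
  have hs := hA.2
  rw [sum_of_card_eq_three (card_face_coe t) (a := ⟨a, ha⟩) (b := ⟨b, hb⟩) (c := ⟨c, hc⟩)
    (by simpa using hab) (by simpa using hbc) (by simpa using hac)] at hs
  exact one_lt_coshSide (hA.1 _) (hA.1 _) (hA.1 _) hs

/-- Lengths match in the angle data of a geodesic triangulation. -/
theorem isMatched_of_isUniform {u : T.AngleSpace} (hu : u ∈ T.angleSystems) (h : IsUniform u) :
    IsMatched u := by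
  obtain ⟨G, _, _, hG, D, hD⟩ := h
  have := hG.t2
  intro e s t hst hs ht
  obtain ⟨a, b, hab, he⟩ := Finset.card_eq_two.1 (edge_card e)
  have hae : a ∈ e.1 := by simp [he]
  have hbe : b ∈ e.1 := by simp [he]
  -- the length of an edge in a face is the one computed from the angles
  have hlen : ∀ r : T.Face, ∀ hr : e.1 ⊆ r.1, edgeLog (u r) (fun v => (v : V) ∈ e.1) =
      Real.log ((Real.cosh (dist (D.pos r ⟨a, hr hae⟩) (D.pos r ⟨b, hr hbe⟩)) - 1) / 2) := by
    intro r hr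
    obtain ⟨c, hc, hac, hbc, -⟩ := exists_third_vertex r hab (hr hae) (hr hbe)
    have hA := isHypAngles_of_mem_angleSystems hu r
    rw [edgeLog_face hA hab hac hbc (hr hae) (hr hbe) hc he]
    set a' : (r.1 : Finset V) := ⟨a, hr hae⟩
    set b' : (r.1 : Finset V) := ⟨b, hr hbe⟩
    set c' : (r.1 : Finset V) := ⟨c, hc⟩
    have hab' : a' ≠ b' := fun h => hab (congrArg Subtype.val h)
    have hac' : a' ≠ c' := fun h => hac (congrArg Subtype.val h)
    have hbc' : b' ≠ c' := fun h => hbc (congrArg Subtype.val h)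
    have hpos : ∀ x y z : (r.1 : Finset V), x ≠ y → y ≠ z → x ≠ z →
        0 < dist (D.pos r x) (D.pos r y) := by
      intro x y z hxy hyz hxz
      refine lt_of_le_of_ne dist_nonneg fun h0 => ?_
      have h1 := D.nondegenerate r x y z hxy hyz hxz
      rw [dist_eq_zero.1 h0.symm, dist_self, zero_add] at h1
      exact lt_irrefl _ h1
    have hsin : ∀ v, 0 < Real.sin (u r v) := fun v =>
      Real.sin_pos_of_pos_of_lt_pi (hu.2.1 r v).1 (hu.2.1 r v).2
    rw [cosh_eq_coshSide (a := dist (D.pos r b') (D.pos r c')) (b := dist (D.pos r a') (D.pos r c'))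
      (hpos b' c' a' hbc' hac'.symm hab'.symm) (hpos a' c' b' hac' hbc'.symm hab')
      (hpos a' b' c' hab' hbc' hac') (hsin a') (hsin b') (C := u r c')]
    · rw [hD r a' b' c' hab' hac' hbc', cosh_dist_law (D.pos r a') (D.pos r b') (D.pos r c')]
      ring
    · rw [hD r b' a' c' hab'.symm hbc' hac', cosh_dist_law (D.pos r b') (D.pos r a') (D.pos r c'),
        dist_comm (D.pos r b') (D.pos r a')]
      ring
    · rw [hD r c' a' b' hac'.symm hbc'.symm hab', cosh_dist_law (D.pos r c') (D.pos r a')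
        (D.pos r b'), dist_comm (D.pos r c') (D.pos r a'), dist_comm (D.pos r c') (D.pos r b')]
      ring
  -- the images of the edge in the surface coincide
  have hpair : ∀ r q : T.Face, r ≠ q → ∀ (hr : e.1 ⊆ r.1), e.1 ⊆ q.1 →
      hypHull (D.pos r '' {v | (v : V) ∈ q.1}) =
        hypSegment (D.pos r ⟨a, hr hae⟩) (D.pos r ⟨b, hr hbe⟩) := by
    intro r q hrq hr hq
    have hset : {v : (r.1 : Finset V) | (v : V) ∈ q.1} = {⟨a, hr hae⟩, ⟨b, hr hbe⟩} := by
      ext v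
      constructor
      · intro hv
        obtain ⟨c, hc, hac, hbc, hrc⟩ := exists_third_vertex r hab (hr hae) (hr hbe)
        have hv3 : (v : V) ∈ ({a, b, c} : Finset V) := hrc ▸ v.2
        simp only [Finset.mem_insert, Finset.mem_singleton] at hv3
        rcases hv3 with h | h | h
        · exact Or.inl (Subtype.ext h)
        · exact Or.inr (Subtype.ext h)
        · exfalso
          refine hrq (Subtype.ext (Finset.eq_of_subset_of_card_le ?_ ?_))
          · rw [hrc]
            intro w hw
            simp only [Finset.mem_insert, Finset.mem_singleton] at hw
            rcases hw with rfl | rfl | rfl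
            · exact hq hae
            · exact hq hbe
            · exact h ▸ hv
          · rw [T.card_face r.1 r.2, T.card_face q.1 q.2]
      · rintro (rfl | rfl)
        · exact hq hae
        · exact hq hbe
    rw [hset, Set.image_pair]
    ext z
    exact mem_hypHull_pair_iff
  have himage := D.inter s t hst
  rw [Set.inter_comm, D.inter t s hst.symm, hpair s t hst hs ht, hpair t s hst.symm ht hs]
    at himage
  have hsub : ∀ r : T.Face, ∀ hr : e.1 ⊆ r.1,
      hypSegment (D.pos r ⟨a, hr hae⟩) (D.pos r ⟨b, hr hbe⟩) ⊆ hypHull (Set.range (D.pos r)) := by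
    intro r hr z hz
    refine hypHull_mono ?_ (mem_hypHull_pair_iff.2 hz)
    rintro _ (rfl | rfl) <;> exact ⟨_, rfl⟩
  have hle : ∀ r q : T.Face, ∀ (hr : e.1 ⊆ r.1) (hq : e.1 ⊆ q.1),
      D.map r '' hypSegment (D.pos r ⟨a, hr hae⟩) (D.pos r ⟨b, hr hbe⟩) =
        D.map q '' hypSegment (D.pos q ⟨a, hq hae⟩) (D.pos q ⟨b, hq hbe⟩) →
      dist (D.pos q ⟨a, hq hae⟩) (D.pos q ⟨b, hq hbe⟩) ≤
        dist (D.pos r ⟨a, hr hae⟩) (D.pos r ⟨b, hr hbe⟩) := by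
    intro r q hr hq him
    refine dist_le_of_image_eq ((D.continuousOn_map r).mono (hsub r hr))
      ((D.continuousOn_map q).mono (hsub q hq)) ((D.injOn_map q).mono (hsub q hq)) ?_ ?_ him.subset
      ?_ ?_
    · exact fun e he => (D.isometric_map r e he).mono (Set.inter_subset_inter_left _ (hsub r hr))
    · exact fun e he => (D.isometric_map q e he).mono (Set.inter_subset_inter_left _ (hsub q hq))
    · rw [D.map_pos, D.map_pos]
    · rw [D.map_pos, D.map_pos]
  rw [hlen s hs, hlen t ht, le_antisymm (hle t s ht hs himage.symm) (hle s t hs ht himage)]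

end SurfaceTriangulation

/-! ### The cyclic order of the faces around a vertex -/

section Involutions

variable {D : Type*} {ρ τ : D → D}

/-- An orbit of the product of two fixed-point free involutions does not contain an element together
with its image under the first involution: the corresponding relation would be conjugate
to one that says that one of the involutions has a fixed point. -/
theorem iterate_comp_ne_left (hρ : ρ.Involutive) (hτ : τ.Involutive) (hρf : ∀ d, ρ d ≠ d)
    (hτf : ∀ d, τ d ≠ d) : ∀ (k : ℕ) (d : D), (τ ∘ ρ)^[k] d ≠ ρ d
  | 0, d => fun h => hρf d h.symm
  | 1, d => fun h => hτf (ρ d) h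
  | k + 2, d => by
    intro h
    rw [Function.iterate_succ_apply', Function.iterate_succ_apply] at h
    refine iterate_comp_ne_left hρ hτ hρf hτf k ((τ ∘ ρ) d) (hρ.injective ?_)
    rw [hρ]
    exact hτ.injective (h.trans (hτ _).symm)

theorem iterate_comp_ne_right (hρ : ρ.Involutive) (hτ : τ.Involutive) (hρf : ∀ d, ρ d ≠ d)
    (hτf : ∀ d, τ d ≠ d) : ∀ (k : ℕ) (d : D), (τ ∘ ρ)^[k] d ≠ τ d
  | 0, d => fun h => hτf d h.symm
  | k + 1, d => by
    intro h
    rw [Function.iterate_succ_apply'] at h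
    refine iterate_comp_ne_left hρ hτ hρf hτf k d (hρ.injective ?_)
    rw [hρ]
    exact hτ.injective h

end Involutions

namespace SurfaceTriangulation

variable {V : Type*} [Fintype V] [DecidableEq V] {T : SurfaceTriangulation V}

variable (T) in
/-- The flags at the vertex `v`: pairs of a face at `v` and another vertex of it. -/
abbrev Flag (v : V) : Type _ := {p : V × T.Face // p.1 ∈ p.2.1 ∧ v ∈ p.2.1 ∧ v ≠ p.1}

theorem Flag.exists_vertex {v : V} (d : T.Flag v) :
    ∃ d' : T.Flag v, d'.1.2 = d.1.2 ∧ d'.1.1 ≠ d.1.1 := by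
  obtain ⟨⟨w, t⟩, hw, hv, hvw⟩ := d
  obtain ⟨c, hc, hvc, hwc, -⟩ := exists_third_vertex t hvw hv hw
  exact ⟨⟨⟨c, t⟩, hc, hv, hvc⟩, rfl, hwc.symm⟩

theorem Flag.exists_face {v : V} (d : T.Flag v) :
    ∃ d' : T.Flag v, d'.1.1 = d.1.1 ∧ d'.1.2 ≠ d.1.2 := by
  obtain ⟨⟨w, t⟩, hw, hv, hvw⟩ := d
  have hsub : ({v, w} : Finset V) ⊆ t.1 := by
    intro x hx
    rcases Finset.mem_insert.1 hx with rfl | hx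
    · exact hv
    · rw [Finset.mem_singleton.1 hx]; exact hw
  obtain ⟨s, hst, hs, -⟩ := exists_faces_of_edge t hsub (Finset.card_pair hvw)
  exact ⟨⟨⟨w, s⟩, hs (by simp), hs (by simp), hvw⟩, rfl, hst⟩

/-- The flag with the same face and the other vertex. -/
def Flag.flipVertex {v : V} (d : T.Flag v) : T.Flag v := d.exists_vertex.choose

/-- The flag with the same vertex and the other face at the edge. -/
def Flag.flipFace {v : V} (d : T.Flag v) : T.Flag v := d.exists_face.choose

theorem Flag.eq_or_of_face_eq {v : V} {d d' : T.Flag v} (h : d'.1.2 = d.1.2) :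
    d' = d ∨ d' = d.flipVertex := by
  obtain ⟨h1, h2⟩ := d.exists_vertex.choose_spec
  change d.flipVertex.1.2 = d.1.2 at h1
  change d.flipVertex.1.1 ≠ d.1.1 at h2
  obtain ⟨c, -, -, -, hc⟩ := exists_third_vertex d.1.2 d.2.2.2 d.2.2.1 d.2.1
  have m1 : d'.1.1 ∈ ({v, d.1.1, c} : Finset V) := hc ▸ (h ▸ d'.2.1)
  have m2 : d.flipVertex.1.1 ∈ ({v, d.1.1, c} : Finset V) := hc ▸ (h1 ▸ d.flipVertex.2.1)
  simp only [Finset.mem_insert, Finset.mem_singleton] at m1 m2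
  have n1 := d'.2.2.2
  have n2 := d.flipVertex.2.2.2
  rcases m1 with m1 | m1 | m1
  · exact absurd m1.symm n1
  · exact Or.inl (Subtype.ext (Prod.ext m1 h))
  · rcases m2 with m2 | m2 | m2
    · exact absurd m2.symm n2
    · exact absurd m2 h2
    · exact Or.inr (Subtype.ext (Prod.ext (m1.trans m2.symm) (h.trans h1.symm)))

theorem Flag.eq_or_of_vertex_eq {v : V} {d d' : T.Flag v} (h : d'.1.1 = d.1.1) :
    d' = d ∨ d' = d.flipFace := by
  obtain ⟨h1, h2⟩ := d.exists_face.choose_spec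
  change d.flipFace.1.1 = d.1.1 at h1
  change d.flipFace.1.2 ≠ d.1.2 at h2
  have hsub : ∀ d' : T.Flag v, d'.1.1 = d.1.1 → ({v, d.1.1} : Finset V) ⊆ d'.1.2.1 := by
    intro d' h x hx
    rcases Finset.mem_insert.1 hx with rfl | hx
    · exact d'.2.2.1
    · rw [Finset.mem_singleton.1 hx, ← h]; exact d'.2.1
  rcases eq_or_eq_of_edge_subset (Finset.card_pair d.2.2.2) h2 (hsub _ h1) (hsub d rfl)
    (hsub d' h) with h3 | h3
  · exact Or.inr (Subtype.ext (Prod.ext (h.trans h1.symm) h3))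
  · exact Or.inl (Subtype.ext (Prod.ext h h3))

theorem Flag.flipVertex_face {v : V} (d : T.Flag v) : d.flipVertex.1.2 = d.1.2 :=
  d.exists_vertex.choose_spec.1

theorem Flag.flipVertex_vertex_ne {v : V} (d : T.Flag v) : d.flipVertex.1.1 ≠ d.1.1 :=
  d.exists_vertex.choose_spec.2

theorem Flag.flipFace_vertex {v : V} (d : T.Flag v) : d.flipFace.1.1 = d.1.1 :=
  d.exists_face.choose_spec.1

theorem Flag.flipFace_face_ne {v : V} (d : T.Flag v) : d.flipFace.1.2 ≠ d.1.2 :=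
  d.exists_face.choose_spec.2

theorem Flag.flipVertex_ne {v : V} (d : T.Flag v) : d.flipVertex ≠ d := fun h =>
  d.flipVertex_vertex_ne (by rw [h])

theorem Flag.flipFace_ne {v : V} (d : T.Flag v) : d.flipFace ≠ d := fun h =>
  d.flipFace_face_ne (by rw [h])

theorem Flag.flipVertex_involutive {v : V} :
    (Flag.flipVertex : T.Flag v → T.Flag v).Involutive := fun d =>
  ((Flag.eq_or_of_face_eq d.flipVertex_face.symm).resolve_left d.flipVertex_ne.symm).symm

theorem Flag.flipFace_involutive {v : V} :
    (Flag.flipFace : T.Flag v → T.Flag v).Involutive := fun d =>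
  ((Flag.eq_or_of_vertex_eq d.flipFace_vertex.symm).resolve_left d.flipFace_ne.symm).symm

/-- The faces around a vertex `v`, in cyclic order, and the vertices of the link of `v`. -/
theorem exists_cyclic_order (T : SurfaceTriangulation V) (v : V) :
    ∃ (n : ℕ) (w : ℕ → V) (f : ℕ → T.Face), 0 < n ∧ w n = w 0 ∧
      (∀ i, v ≠ w i ∧ w i ≠ w (i + 1) ∧ (f i).1 = {v, w i, w (i + 1)}) ∧
      (∀ i < n, ∀ j < n, w i = w j → i = j) ∧ (∀ i < n, ∀ j < n, f i = f j → i = j) ∧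
      ∀ t : T.Face, v ∈ t.1 → ∃ i < n, f i = t := by
  obtain ⟨t₀, ht₀, hvt₀⟩ := T.exists_face v
  obtain ⟨w₀, hw₀, hvw₀⟩ : ∃ w ∈ t₀, w ≠ v := by
    refine Finset.exists_mem_ne ?_ v
    rw [T.card_face t₀ ht₀]
    norm_num
  let d₀ : T.Flag v := ⟨⟨w₀, ⟨t₀, ht₀⟩⟩, hw₀, hvt₀, hvw₀.symm⟩
  set σ : T.Flag v → T.Flag v := Flag.flipFace ∘ Flag.flipVertex with hσ
  have hσi : Function.Injective σ :=
    Flag.flipFace_involutive.injective.comp Flag.flipVertex_involutive.injective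
  set n := Function.minimalPeriod σ d₀ with hn
  have hn0 : 0 < n :=
    Function.minimalPeriod_pos_of_mem_periodicPts (hσi.mem_periodicPts d₀)
  let d : ℕ → T.Flag v := fun i => σ^[i] d₀
  have hdn : ∀ i, d (i + n) = d i := fun i => by
    simp only [d, Function.iterate_add_apply]
    rw [hn, Function.iterate_minimalPeriod]
  have hd0 : d n = d 0 := by simpa using hdn 0
  have hsucc : ∀ i, d (i + 1) = (d i).flipVertex.flipFace := fun i =>
    Function.iterate_succ_apply' σ i d₀
  have hdinj : ∀ i < n, ∀ j < n, d i = d j → i = j := fun i hi j hj h =>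
    (Function.iterate_injOn_Iio_minimalPeriod (f := σ) (x := d₀)) hi hj h
  have hfv : ∀ i j, d i ≠ (d j).flipVertex := by
    have key : ∀ i k, d (i + k) ≠ (d i).flipVertex := fun i k => by
      have := iterate_comp_ne_left Flag.flipVertex_involutive Flag.flipFace_involutive
        Flag.flipVertex_ne Flag.flipFace_ne k (d i)
      rwa [← hσ, ← Function.iterate_add_apply, add_comm] at this
    intro i j h
    rcases le_total j i with hji | hij
    · obtain ⟨k, rfl⟩ := Nat.exists_eq_add_of_le hji
      exact key j k h
    · obtain ⟨k, rfl⟩ := Nat.exists_eq_add_of_le hij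
      refine key i k ?_
      rw [h, Flag.flipVertex_involutive]
  have hff : ∀ i j, d i ≠ (d j).flipFace := by
    have key : ∀ i k, d (i + k) ≠ (d i).flipFace := fun i k => by
      have := iterate_comp_ne_right Flag.flipVertex_involutive Flag.flipFace_involutive
        Flag.flipVertex_ne Flag.flipFace_ne k (d i)
      rwa [← hσ, ← Function.iterate_add_apply, add_comm] at this
    intro i j h
    rcases le_total j i with hji | hij
    · obtain ⟨k, rfl⟩ := Nat.exists_eq_add_of_le hji
      exact key j k h
    · obtain ⟨k, rfl⟩ := Nat.exists_eq_add_of_le hij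
      refine key i k ?_
      rw [h, Flag.flipFace_involutive]
  have hw1 : ∀ i, (d (i + 1)).1.1 = (d i).flipVertex.1.1 := fun i => by
    rw [hsucc, Flag.flipFace_vertex]
  refine ⟨n, fun i => (d i).1.1, fun i => (d i).1.2, hn0, congrArg (fun p => p.1.1) hd0,
    fun i => ⟨(d i).2.2.2, ?_, ?_⟩, fun i hi j hj h => ?_, fun i hi j hj h => ?_, ?_⟩
  · beta_reduce
    rw [hw1]
    exact (d i).flipVertex_vertex_ne.symm
  · have hne : (d i).1.1 ≠ (d (i + 1)).1.1 := by
      rw [hw1]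
      exact (d i).flipVertex_vertex_ne.symm
    have hmem : (d (i + 1)).1.1 ∈ (d i).1.2.1 := by
      rw [hw1, ← (d i).flipVertex_face]
      exact (d i).flipVertex.2.1
    symm
    refine Finset.eq_of_subset_of_card_le ?_ ?_
    · intro x hx
      simp only [Finset.mem_insert, Finset.mem_singleton] at hx
      rcases hx with rfl | rfl | rfl
      · exact (d i).2.2.1
      · exact (d i).2.1
      · exact hmem
    · rw [T.card_face _ (d i).1.2.2, Finset.card_eq_three.2
        ⟨_, _, _, (d i).2.2.2, (d (i + 1)).2.2.2, hne, rfl⟩]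
  · rcases Flag.eq_or_of_vertex_eq h with h' | h'
    · exact hdinj i hi j hj h'
    · exact absurd h' (hff i j)
  · rcases Flag.eq_or_of_face_eq h with h' | h'
    · exact hdinj i hi j hj h'
    · exact absurd h' (hfv i j)
  · have hcover : ∀ t : Finset V, Relation.ReflTransGen
        (fun a b : Finset V => a ∈ T.faces ∧ b ∈ T.faces ∧ v ∈ a ∩ b ∧ (a ∩ b).card = 2) t₀ t →
        ∃ i, (d i).1.2.1 = t := by
      intro t ht
      induction ht with
      | refl => exact ⟨0, rfl⟩
      | @tail a b _ hab ih =>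
        obtain ⟨i, hi⟩ := ih
        obtain ⟨-, hbF, hvab, hcard⟩ := hab
        obtain ⟨x, hx, hxv⟩ := Finset.exists_mem_ne (by rw [hcard]; norm_num) v (s := a ∩ b)
        have hxa := (Finset.mem_inter.1 hx).1
        have hxb := (Finset.mem_inter.1 hx).2
        have hvb := (Finset.mem_inter.1 hvab).2
        let p : T.Flag v := ⟨⟨x, (d i).1.2⟩, hi ▸ hxa, (d i).2.2.1, hxv.symm⟩
        let q : T.Flag v := ⟨⟨x, ⟨b, hbF⟩⟩, hxb, hvb, hxv.symm⟩
        have hqb : q.1.2.1 = b := rfl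
        have hp : p = d i ∨ p = (d i).flipVertex := Flag.eq_or_of_face_eq rfl
        have hq : q = p ∨ q = p.flipFace := Flag.eq_or_of_vertex_eq rfl
        rcases hq with hq | hq
        · exact ⟨i, by rw [← hqb, hq]⟩
        · rcases hp with hp | hp
          · -- the preceding face
            refine ⟨i + (n - 1), ?_⟩
            have h1 : d i = (d (i + (n - 1))).flipVertex.flipFace := by
              rw [← hsucc, ← hdn i]
              congr 1
              omega
            rw [← hqb, hq, hp, h1, Flag.flipFace_involutive, Flag.flipVertex_face]
          · exact ⟨i + 1, by rw [← hqb, hq, hp, hsucc]⟩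
    intro t hvt
    obtain ⟨i, hi⟩ := hcover t.1 (T.link_connected v t₀ ht₀ t.1 t.2 hvt₀ hvt)
    refine ⟨i % n, Nat.mod_lt _ hn0, Subtype.ext ?_⟩
    rw [← hi]
    simp only [d]
    rw [hn, Function.iterate_mod_minimalPeriod_eq]

end SurfaceTriangulation

/-! ### Complete fans in the plane -/

/-- The unit vector with argument `θ`. -/
def unitVec (θ : ℝ) : ℂ := ⟨Real.cos θ, Real.sin θ⟩

theorem unitVec_add (a b : ℝ) : unitVec (a + b) = unitVec a * unitVec b := by
  apply Complex.ext
  · simp [unitVec, Real.cos_add]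
  · simp [unitVec, Real.sin_add]; ring

theorem norm_unitVec (a : ℝ) : ‖unitVec a‖ = 1 := by
  rw [Complex.norm_def, Real.sqrt_eq_one, Complex.normSq_apply]
  have := Real.sin_sq_add_cos_sq a
  simp only [unitVec]
  linarith

theorem unitVec_mul_conj_re (a b : ℝ) :
    (unitVec a * (starRingEnd ℂ) (unitVec b)).re = Real.cos (a - b) := by
  simp [unitVec, Real.cos_sub]

theorem unitVec_zero : unitVec 0 = 1 := by
  apply Complex.ext <;> simp [unitVec]

theorem unitVec_two_pi : unitVec (2 * Real.pi) = 1 := by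
  apply Complex.ext <;> simp [unitVec]

theorem smul_unitVec_arg (z : ℂ) : z = ‖z‖ • unitVec (Complex.arg z) := by
  apply Complex.ext
  · simp [unitVec, Complex.norm_mul_cos_arg]
  · simp [unitVec, Complex.norm_mul_sin_arg]

theorem exists_polar (z : ℂ) : ∃ φ ∈ Set.Ico 0 (2 * Real.pi), z = ‖z‖ • unitVec φ := by
  have hpi := Real.pi_pos
  rcases le_or_gt 0 (Complex.arg z) with h | h
  · exact ⟨Complex.arg z, ⟨h, by linarith [Complex.arg_le_pi z]⟩, smul_unitVec_arg z⟩
  · refine ⟨Complex.arg z + 2 * Real.pi, ⟨by linarith [Complex.neg_pi_lt_arg z], by linarith⟩, ?_⟩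
    rw [unitVec_add, unitVec_two_pi, mul_one]
    exact smul_unitVec_arg z

theorem polar_unique {r r' φ φ' : ℝ} (hr : 0 < r) (hr' : 0 < r')
    (hφ : φ ∈ Set.Ico 0 (2 * Real.pi)) (hφ' : φ' ∈ Set.Ico 0 (2 * Real.pi))
    (h : r • unitVec φ = r' • unitVec φ') : r = r' ∧ φ = φ' := by
  have h1 : r = r' := by
    have := congrArg norm h
    rwa [norm_smul, norm_smul, norm_unitVec, norm_unitVec, mul_one, mul_one, Real.norm_of_nonneg
      hr.le, Real.norm_of_nonneg hr'.le] at this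
  refine ⟨h1, ?_⟩
  subst h1
  have h2 : unitVec φ = unitVec φ' := smul_right_injective ℂ hr.ne' h
  have hc : Real.cos φ = Real.cos φ' := (Complex.ext_iff.1 h2).1
  have hs : Real.sin φ = Real.sin φ' := (Complex.ext_iff.1 h2).2
  have h3 : Real.cos (φ - φ') = 1 := by
    rw [Real.cos_sub, hc, hs]
    have := Real.sin_sq_add_cos_sq φ'
    linarith
  obtain ⟨k, hk⟩ := (Real.cos_eq_one_iff _).1 h3
  have hpi := Real.pi_pos
  have hk0 : k = 0 := by
    have l1 : (k : ℝ) < 1 := by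
      by_contra! h
      nlinarith [hφ.1, hφ.2, hφ'.1, hφ'.2]
    have l2 : (-1 : ℝ) < k := by
      by_contra! h
      nlinarith [hφ.1, hφ.2, hφ'.1, hφ'.2]
    have l1' : k < 1 := by exact_mod_cast l1
    have l2' : -1 < k := by exact_mod_cast l2
    omega
  rw [hk0] at hk
  simp only [Int.cast_zero, zero_mul] at hk
  linarith

/-- A vector between two others is a nonnegative combination of them. -/
theorem exists_sector_coords {θ θ' φ : ℝ} (h1 : θ ≤ φ) (h2 : φ ≤ θ') (h3 : θ < θ')
    (h4 : θ' - θ < Real.pi) :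
    ∃ a b : ℝ, 0 ≤ a ∧ 0 ≤ b ∧ unitVec φ = a • unitVec θ + b • unitVec θ' := by
  have hs : 0 < Real.sin (θ' - θ) := Real.sin_pos_of_pos_of_lt_pi (by linarith) h4
  refine ⟨Real.sin (θ' - φ) / Real.sin (θ' - θ), Real.sin (φ - θ) / Real.sin (θ' - θ),
    div_nonneg (Real.sin_nonneg_of_nonneg_of_le_pi (by linarith) (by linarith)) hs.le,
    div_nonneg (Real.sin_nonneg_of_nonneg_of_le_pi (by linarith) (by linarith)) hs.le, ?_⟩
  have e := Real.sin_sq_add_cos_sq φ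
  apply Complex.ext
  · simp only [unitVec, Complex.add_re, Complex.smul_re, smul_eq_mul]
    field_simp
    simp only [Real.sin_sub]
    ring
  · simp only [unitVec, Complex.add_im, Complex.smul_im, smul_eq_mul]
    field_simp
    simp only [Real.sin_sub]
    ring

/-- The argument of a nonnegative combination of two vectors lies between their arguments. -/
theorem exists_polar_sector {θ θ' a b : ℝ} (h3 : θ < θ') (h4 : θ' - θ < Real.pi) (ha : 0 ≤ a)
    (hb : 0 ≤ b) (hab : a ≠ 0 ∨ b ≠ 0) :
    ∃ r φ : ℝ, 0 < r ∧ a • unitVec θ + b • unitVec θ' = r • unitVec φ ∧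
      (φ = θ ∧ b = 0 ∧ a = r ∨ φ = θ' ∧ a = 0 ∧ b = r ∨ φ ∈ Set.Ioo θ θ') := by
  have hs : 0 < Real.sin (θ' - θ) := Real.sin_pos_of_pos_of_lt_pi (by linarith) h4
  rcases hb.eq_or_lt with hb0 | hb0
  · subst hb0
    have ha0 : a ≠ 0 := by simpa using hab
    exact ⟨a, θ, lt_of_le_of_ne ha ha0.symm, by simp, Or.inl ⟨rfl, rfl, rfl⟩⟩
  rcases ha.eq_or_lt with ha0 | ha0
  · subst ha0
    exact ⟨b, θ', hb0, by simp, Or.inr (Or.inl ⟨rfl, rfl, rfl⟩)⟩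
  set δ := θ' - θ with hδ
  set ω : ℂ := (a : ℂ) + b • unitVec δ with hω
  have him : ω.im = b * Real.sin δ := by simp [hω, unitVec]
  have hre : ω.re = a + b * Real.cos δ := by simp [hω, unitVec]
  have him0 : 0 < ω.im := by rw [him]; positivity
  have hω0 : ω ≠ 0 := fun h => by rw [h] at him0; simp at him0
  have hn : 0 < ‖ω‖ := norm_pos_iff.2 hω0
  have hsin := Complex.norm_mul_sin_arg ω
  have hcos := Complex.norm_mul_cos_arg ω
  have harg0 : 0 < Complex.arg ω := by
    refine lt_of_le_of_ne (Complex.arg_nonneg_iff.2 him0.le) fun h => ?_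
    rw [← h, Real.sin_zero, mul_zero] at hsin
    exact him0.ne hsin
  have hargδ : Complex.arg ω < δ := by
    by_contra! h
    have h5 : 0 ≤ Real.sin (Complex.arg ω - δ) :=
      Real.sin_nonneg_of_nonneg_of_le_pi (by linarith) (by linarith [Complex.arg_le_pi ω])
    have h6 : ‖ω‖ * Real.sin (Complex.arg ω - δ) = - (a * Real.sin δ) := by
      rw [Real.sin_sub, mul_sub, ← mul_assoc, ← mul_assoc, hsin, hcos, him, hre]
      ring
    have h7 := mul_nonneg hn.le h5
    have h8 := mul_pos ha0 hs
    linarith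
  refine ⟨‖ω‖, θ + Complex.arg ω, hn, ?_, Or.inr (Or.inr ⟨by linarith, by linarith⟩)⟩
  have h5 := smul_unitVec_arg ω
  have h6 : unitVec θ' = unitVec θ * unitVec δ := by rw [← unitVec_add, hδ]; congr 1; ring
  have h7 : ‖ω‖ • unitVec (θ + Complex.arg ω) = unitVec θ * ω := by
    conv_rhs => rw [h5]
    rw [unitVec_add, mul_smul_comm]
  rw [h7, h6, hω, mul_add, mul_smul_comm, Complex.real_smul, mul_comm (a : ℂ)]

/-- Linear independence of two vectors that span a sector. -/
theorem sector_coords_unique {θ θ' a b a' b' : ℝ} (h3 : θ < θ') (h4 : θ' - θ < Real.pi)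
    (h : a • unitVec θ + b • unitVec θ' = a' • unitVec θ + b' • unitVec θ') : a = a' ∧ b = b' := by
  have hs : 0 < Real.sin (θ' - θ) := Real.sin_pos_of_pos_of_lt_pi (by linarith) h4
  have hr := congrArg Complex.re h
  have hi := congrArg Complex.im h
  simp only [unitVec, Complex.add_re, Complex.smul_re, smul_eq_mul, Complex.add_im,
    Complex.smul_im] at hr hi
  rw [Real.sin_sub] at hs
  constructor
  · refine mul_right_cancel₀ hs.ne' ?_
    linear_combination Real.sin θ' * hr - Real.cos θ' * hi
  · refine mul_right_cancel₀ hs.ne' ?_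
    linear_combination Real.cos θ * hi - Real.sin θ * hr

section Fan

variable {n : ℕ} {θ : ℕ → ℝ}

theorem exists_fan_coords (h0 : θ 0 = 0) (hn : θ n = 2 * Real.pi) (hlt : ∀ i < n, θ i < θ (i + 1))
    (hpi : ∀ i < n, θ (i + 1) - θ i < Real.pi) (z : ℂ) :
    ∃ i < n, ∃ a b : ℝ, 0 ≤ a ∧ 0 ≤ b ∧ z = a • unitVec (θ i) + b • unitVec (θ (i + 1)) := by
  classical
  obtain ⟨φ, hφ, hz⟩ := exists_polar z
  have hex : ∃ k, φ < θ k := ⟨n, by rw [hn]; exact hφ.2⟩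
  have hk := Nat.find_spec hex
  have hmin : ∀ m, m < Nat.find hex → ¬ φ < θ m := fun m hm => Nat.find_min hex hm
  have hkn : Nat.find hex ≤ n := Nat.find_min' hex (by rw [hn]; exact hφ.2)
  generalize Nat.find hex = k at hk hmin hkn
  obtain _ | i := k
  · rw [h0] at hk
    exact absurd hφ.1 (not_le.2 hk)
  have hi : i < n := hkn
  obtain ⟨a, b, ha, hb, hab⟩ := exists_sector_coords (not_lt.1 (hmin i (Nat.lt_succ_self i))) hk.le
    (hlt i hi) (hpi i hi)
  refine ⟨i, hi, ‖z‖ * a, ‖z‖ * b, by positivity, by positivity, ?_⟩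
  rw [mul_smul, mul_smul, ← smul_add, ← hab]
  exact hz

/-- Coordinates with respect to a complete fan are unique, as functions on the set of its rays. -/
theorem fan_coords_unique {V : Type*} [DecidableEq V] {w : ℕ → V} (h0 : θ 0 = 0)
    (hn : θ n = 2 * Real.pi) (hlt : ∀ i < n, θ i < θ (i + 1))
    (hpi : ∀ i < n, θ (i + 1) - θ i < Real.pi) (hw : w n = w 0) {i j : ℕ} (hi : i < n) (hj : j < n)
    {a b a' b' : ℝ} (ha : 0 ≤ a) (hb : 0 ≤ b) (ha' : 0 ≤ a') (hb' : 0 ≤ b')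
    (h : a • unitVec (θ i) + b • unitVec (θ (i + 1)) =
      a' • unitVec (θ j) + b' • unitVec (θ (j + 1))) :
    (Pi.single (w i) a + Pi.single (w (i + 1)) b : V → ℝ) =
      Pi.single (w j) a' + Pi.single (w (j + 1)) b' := by
  have hpi0 := Real.pi_pos
  have hmono : ∀ k l, k < l → l ≤ n → θ k < θ l := by
    intro k l hkl
    induction l, hkl using Nat.le_induction with
    | base => exact fun hl => hlt k hl
    | succ l hl ih => exact fun hln => (ih (by omega)).trans (hlt l (by omega))
  have hmono' : ∀ k l, k ≤ l → l ≤ n → θ k ≤ θ l := fun k l hkl hl => by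
    rcases hkl.eq_or_lt with rfl | hkl
    · exact le_rfl
    · exact (hmono k l hkl hl).le
  -- a nonzero combination lies on a ray of the fan or in the interior of a sector
  have normal : ∀ i < n, ∀ a b : ℝ, 0 ≤ a → 0 ≤ b → (a ≠ 0 ∨ b ≠ 0) →
      ∃ r φ : ℝ, 0 < r ∧ φ ∈ Set.Ico 0 (2 * Real.pi) ∧
        a • unitVec (θ i) + b • unitVec (θ (i + 1)) = r • unitVec φ ∧
        ((∃ k < n, φ = θ k ∧
          (Pi.single (w i) a + Pi.single (w (i + 1)) b : V → ℝ) = Pi.single (w k) r) ∨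
        φ ∈ Set.Ioo (θ i) (θ (i + 1))) := by
    intro i hi a b ha hb hab
    obtain ⟨r, φ, hr, hz, hφ⟩ := exists_polar_sector (hlt i hi) (hpi i hi) ha hb hab
    have hθ : ∀ k < n, θ k ∈ Set.Ico 0 (2 * Real.pi) := fun k hk =>
      ⟨h0 ▸ hmono' 0 k (Nat.zero_le _) hk.le, hn ▸ hmono k n hk le_rfl⟩
    rcases hφ with ⟨rfl, rfl, rfl⟩ | ⟨rfl, rfl, rfl⟩ | hφ
    · exact ⟨a, θ i, hr, hθ i hi, hz, Or.inl ⟨i, hi, rfl, by simp⟩⟩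
    · rcases Nat.lt_or_ge (i + 1) n with h | h
      · exact ⟨b, θ (i + 1), hr, hθ _ h, hz, Or.inl ⟨i + 1, h, rfl, by simp⟩⟩
      · have hin : i + 1 = n := by omega
        refine ⟨b, θ 0, hr, hθ 0 (by omega), ?_, Or.inl ⟨0, by omega, rfl, ?_⟩⟩
        · rw [hz, hin, hn, h0, unitVec_zero, unitVec_two_pi]
        · rw [hin, hw]; simp
    · refine ⟨r, φ, hr, ⟨?_, ?_⟩, hz, Or.inr hφ⟩
      · exact (h0 ▸ hmono' 0 i (Nat.zero_le _) hi.le).trans hφ.1.le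
      · exact hφ.2.trans_le (hn ▸ hmono' (i + 1) n hi le_rfl)
  have hzero : ∀ i < n, ∀ a b : ℝ, 0 ≤ a → 0 ≤ b →
      a • unitVec (θ i) + b • unitVec (θ (i + 1)) = 0 → a = 0 ∧ b = 0 := by
    intro i hi a b ha hb h
    by_contra hne
    obtain ⟨r, φ, hr, -, hz, -⟩ := normal i hi a b ha hb (by tauto)
    rw [h] at hz
    have := congrArg norm hz
    rw [norm_zero, norm_smul, norm_unitVec, mul_one, Real.norm_of_nonneg hr.le] at this
    exact hr.ne this
  by_cases hab : a ≠ 0 ∨ b ≠ 0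
  · by_cases hab' : a' ≠ 0 ∨ b' ≠ 0
    · obtain ⟨r, φ, hr, hφ, hz, hcase⟩ := normal i hi a b ha hb hab
      obtain ⟨r', φ', hr', hφ', hz', hcase'⟩ := normal j hj a' b' ha' hb' hab'
      obtain ⟨rfl, rfl⟩ := polar_unique hr hr' hφ hφ' (by rw [← hz, h, hz'])
      have hno : ∀ k < n, ∀ i < n, θ k ∉ Set.Ioo (θ i) (θ (i + 1)) := by
        intro k hk i hi hmem
        rcases Nat.lt_or_ge i k with hik | hik
        · exact absurd hmem.2 (not_lt.2 (hmono' (i + 1) k hik hk.le))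
        · exact absurd hmem.1 (not_lt.2 (hmono' k i hik hi.le))
      rcases hcase with ⟨k, hk, hφk, hs⟩ | hI <;> rcases hcase' with ⟨k', hk', hφk', hs'⟩ | hI'
      · have : k = k' := by
          rcases lt_trichotomy k k' with hlt' | rfl | hlt'
          · exact absurd (hφk.symm.trans hφk') (hmono k k' hlt' hk'.le).ne
          · rfl
          · exact absurd (hφk'.symm.trans hφk) (hmono k' k hlt' hk.le).ne
        rw [hs, hs', this]
      · exact absurd (hφk ▸ hI') (hno k hk j hj)
      · exact absurd (hφk' ▸ hI) (hno k' hk' i hi)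
      · have : i = j := by
          rcases lt_trichotomy i j with hlt' | rfl | hlt'
          · exact absurd (hI.2.trans_le (hmono' (i + 1) j hlt' hj.le)) (not_lt.2 hI'.1.le)
          · rfl
          · exact absurd (hI'.2.trans_le (hmono' (j + 1) i hlt' hi.le)) (not_lt.2 hI.1.le)
        subst this
        obtain ⟨rfl, rfl⟩ := sector_coords_unique (hlt i hi) (hpi i hi) h
        rfl
    · push Not at hab'
      rw [hab'.1, hab'.2] at h
      obtain ⟨rfl, rfl⟩ := hzero i hi a b ha hb (by rw [h]; simp)
      simp at hab
  · push Not at hab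
    rw [hab.1, hab.2] at h ⊢
    obtain ⟨rfl, rfl⟩ := hzero j hj a' b' ha' hb' (by rw [← h]; simp)
    simp

end Fan

namespace SurfaceTriangulation

variable {V : Type*} [Fintype V] [DecidableEq V] {T : SurfaceTriangulation V}

/-- The directions of the edges at a vertex `v`, when the triangles at `v` are laid out around a point
of the plane. -/
structure IsLayout (u : T.AngleSpace) (v : V) (dir : V → ℂ) : Prop where
  norm_eq : ∀ w, ‖dir w‖ = 1
  angle : ∀ (t : T.Face) (hv : v ∈ t.1) (a b : V), a ∈ t.1 → b ∈ t.1 → v ≠ a → v ≠ b → a ≠ b →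
    (dir a * (starRingEnd ℂ) (dir b)).re = Real.cos (u t ⟨v, hv⟩)
  angle_add : ∀ (s t : T.Face) (hs : v ∈ s.1) (ht : v ∈ t.1) (w a b : V), s ≠ t → v ≠ w → v ≠ a →
    v ≠ b → w ≠ a → w ≠ b → w ∈ s.1 → a ∈ s.1 → w ∈ t.1 → b ∈ t.1 →
    (dir a * (starRingEnd ℂ) (dir b)).re = Real.cos (u s ⟨v, hs⟩ + u t ⟨v, ht⟩)
  exists_coords : ∀ z : ℂ, ∃ t : T.Face, v ∈ t.1 ∧ ∃ l : V → ℝ, (∀ x, 0 ≤ l x) ∧ l v = 0 ∧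
    (∀ x ∉ t.1, l x = 0) ∧ z = ∑ x, l x • dir x
  coords_unique : ∀ (s t : T.Face), v ∈ s.1 → v ∈ t.1 → ∀ l m : V → ℝ, (∀ x, 0 ≤ l x) →
    (∀ x, 0 ≤ m x) → l v = 0 → m v = 0 → (∀ x ∉ s.1, l x = 0) → (∀ x ∉ t.1, m x = 0) →
    ∑ x, l x • dir x = ∑ x, m x • dir x → l = m

/-- Since the angles at `v` add up to `2π`, the triangles at `v` can be laid out around a point. -/
theorem exists_isLayout {u : T.AngleSpace} (hu : u ∈ T.angleSystems) (v : V) :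
    ∃ dir : V → ℂ, IsLayout u v dir := by
  classical
  obtain ⟨n, w, f, hn0, hwn, hface, hwinj, hfinj, hcover⟩ := T.exists_cyclic_order v
  have hvf : ∀ i, v ∈ (f i).1 := fun i => by rw [(hface i).2.2]; simp
  set δ : ℕ → ℝ := fun i => u (f i) ⟨v, hvf i⟩ with hδ
  set θ : ℕ → ℝ := fun i => ∑ k ∈ Finset.range i, δ k with hθ
  have hθs : ∀ i, θ (i + 1) = θ i + δ i := fun i => Finset.sum_range_succ δ i
  have hθ0 : θ 0 = 0 := Finset.sum_range_zero δ
  have hδp : ∀ i, 0 < δ i ∧ δ i < Real.pi := fun i => hu.2.1 (f i) ⟨v, hvf i⟩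
  have hθn : θ n = 2 * Real.pi := by
    rw [← hu.2.2 v, vertexAngle]
    have h1 : θ n = ∑ i ∈ Finset.range n,
        (fun t : T.Face => if h : v ∈ t.1 then u t ⟨v, h⟩ else 0) (f i) :=
      Finset.sum_congr rfl fun i _ => by simp only [hδ, dif_pos (hvf i)]
    rw [h1, ← Finset.sum_image (g := f) (f := fun t : T.Face =>
      if h : v ∈ t.1 then u t ⟨v, h⟩ else 0)]
    · refine Finset.sum_subset (Finset.subset_univ _) fun t _ ht => dif_neg fun hvt => ht ?_
      obtain ⟨i, hi, rfl⟩ := hcover t hvt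
      exact Finset.mem_image_of_mem f (Finset.mem_range.2 hi)
    · intro i hi j hj h
      exact hfinj i (Finset.mem_range.1 hi) j (Finset.mem_range.1 hj) h
  have hlt : ∀ i < n, θ i < θ (i + 1) := fun i _ => by rw [hθs]; linarith [(hδp i).1]
  have hltpi : ∀ i < n, θ (i + 1) - θ i < Real.pi := fun i _ => by
    rw [hθs]; linarith [(hδp i).2]
  let dir : V → ℂ := fun x => if h : ∃ i < n, w i = x then unitVec (θ h.choose) else 1
  have hdir' : ∀ i < n, dir (w i) = unitVec (θ i) := by
    intro i hi
    have h : ∃ j < n, w j = w i := ⟨i, hi, rfl⟩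
    have : dir (w i) = unitVec (θ h.choose) := dif_pos h
    rw [this, hwinj _ h.choose_spec.1 _ hi h.choose_spec.2]
  have hdir : ∀ i ≤ n, dir (w i) = unitVec (θ i) := by
    intro i hi
    rcases hi.eq_or_lt with rfl | hi
    · rw [hwn, hdir' 0 hn0, hθ0, hθn, unitVec_zero, unitVec_two_pi]
    · exact hdir' i hi
  have hstep : ∀ i < n, dir (w (i + 1)) = dir (w i) * unitVec (δ i) := fun i hi => by
    rw [hdir (i + 1) hi, hdir i hi.le, hθs, unitVec_add]
  have hself : ∀ x, dir x * (starRingEnd ℂ) (dir x) = 1 → ∀ a b : ℝ,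
      (dir x * unitVec a * (starRingEnd ℂ) (dir x * unitVec b)).re = Real.cos (a - b) := by
    intro x hx a b
    rw [map_mul, mul_mul_mul_comm, hx, one_mul, unitVec_mul_conj_re]
  have hnorm : ∀ x, ‖dir x‖ = 1 := by
    intro x
    by_cases h : ∃ i < n, w i = x
    · obtain ⟨i, hi, rfl⟩ := h
      rw [hdir' i hi, norm_unitVec]
    · have : dir x = 1 := dif_neg h
      rw [this, norm_one]
  have hconj : ∀ x, dir x * (starRingEnd ℂ) (dir x) = 1 := fun x => by
    rw [Complex.mul_conj, Complex.normSq_eq_norm_sq, hnorm]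
    norm_num
  have hwsucc : ∀ i < n, ∀ j < n, w (i + 1) = w (j + 1) → i = j := by
    intro i hi j hj h
    rcases Nat.lt_or_ge (i + 1) n with h1 | h1 <;> rcases Nat.lt_or_ge (j + 1) n with h2 | h2
    · exact Nat.succ_injective (hwinj _ h1 _ h2 h)
    · rw [show j + 1 = n by omega, hwn] at h
      exact absurd (hwinj _ h1 _ hn0 h) (Nat.succ_ne_zero i)
    · rw [show i + 1 = n by omega, hwn] at h
      exact absurd (hwinj _ hn0 _ h2 h).symm (Nat.succ_ne_zero j)
    · omega
  have hmem : ∀ i x, x ∈ (f i).1 → v ≠ x → x = w i ∨ x = w (i + 1) := by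
    intro i x hx hvx
    rw [(hface i).2.2] at hx
    simp only [Finset.mem_insert, Finset.mem_singleton] at hx
    rcases hx with h | h
    · exact absurd h.symm hvx
    · exact h
  have hsplit : ∀ i < n, ∀ l : V → ℝ, l v = 0 → (∀ x ∉ (f i).1, l x = 0) →
      l = Pi.single (w i) (l (w i)) + Pi.single (w (i + 1)) (l (w (i + 1))) := by
    intro i _ l hlv hl
    funext x
    have hne := (hface i).2.1
    by_cases hx1 : x = w i
    · subst hx1
      simp [hne]
    · by_cases hx2 : x = w (i + 1)
      · subst hx2
        simp [hne.symm]
      · rw [Pi.add_apply, Pi.single_eq_of_ne hx1, Pi.single_eq_of_ne hx2, add_zero]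
        by_cases hxv : x = v
        · rw [hxv, hlv]
        · refine hl x fun hxf => ?_
          rcases hmem i x hxf (Ne.symm hxv) with h | h
          · exact hx1 h
          · exact hx2 h
  have hsumsingle : ∀ i < n, ∀ a b : ℝ,
      ∑ x, (Pi.single (w i) a + Pi.single (w (i + 1)) b : V → ℝ) x • dir x =
        a • unitVec (θ i) + b • unitVec (θ (i + 1)) := by
    intro i hi a b
    simp only [Pi.add_apply, add_smul, Finset.sum_add_distrib]
    rw [Finset.sum_eq_single (w i), Finset.sum_eq_single (w (i + 1)), Pi.single_eq_same,
      Pi.single_eq_same, hdir i hi.le, hdir (i + 1) hi]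
    · intro x _ hx
      rw [Pi.single_eq_of_ne hx, zero_smul]
    · simp
    · intro x _ hx
      rw [Pi.single_eq_of_ne hx, zero_smul]
    · simp
  refine ⟨dir, hnorm, ?_, ?_, ?_, ?_⟩
  · intro t hv a b ha hb hva hvb hab
    obtain ⟨i, hi, rfl⟩ := hcover t hv
    have h1 := hself (w i) (hconj _) 0 (δ i)
    have h2 := hself (w i) (hconj _) (δ i) 0
    rw [unitVec_zero, mul_one] at h1 h2
    rw [zero_sub, Real.cos_neg, ← hstep i hi] at h1
    rw [sub_zero, ← hstep i hi] at h2
    rcases hmem i a ha hva with rfl | rfl <;> rcases hmem i b hb hvb with rfl | rfl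
    · exact absurd rfl hab
    · exact h1
    · exact h2
    · exact absurd rfl hab
  · intro s t hs ht x a b hst hvx hva hvb hxa hxb hxs has hxt hbt
    obtain ⟨i, hi, rfl⟩ := hcover s hs
    obtain ⟨j, hj, rfl⟩ := hcover t ht
    have hij : i ≠ j := fun h => hst (by rw [h])
    have ha : x = w i ∧ a = w (i + 1) ∨ x = w (i + 1) ∧ a = w i := by
      rcases hmem i x hxs hvx with h | h <;> rcases hmem i a has hva with h' | h'
      · exact absurd (h.trans h'.symm) hxa
      · exact Or.inl ⟨h, h'⟩
      · exact Or.inr ⟨h, h'⟩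
      · exact absurd (h.trans h'.symm) hxa
    have hb : x = w j ∧ b = w (j + 1) ∨ x = w (j + 1) ∧ b = w j := by
      rcases hmem j x hxt hvx with h | h <;> rcases hmem j b hbt hvb with h' | h'
      · exact absurd (h.trans h'.symm) hxb
      · exact Or.inl ⟨h, h'⟩
      · exact Or.inr ⟨h, h'⟩
      · exact absurd (h.trans h'.symm) hxb
    have hback : ∀ i < n, dir (w i) = dir (w (i + 1)) * unitVec (- δ i) := fun i hi => by
      rw [hstep i hi, mul_assoc, ← unitVec_add, add_neg_cancel, unitVec_zero, mul_one]
    rcases ha with ⟨h1, h2⟩ | ⟨h1, h2⟩ <;> rcases hb with ⟨h3, h4⟩ | ⟨h3, h4⟩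
    · exact absurd (hwinj i hi j hj (h1.symm.trans h3)) hij
    · rw [h2, h4, hstep i hi, hback j hj, ← h1, ← h3, hself x (hconj x), sub_neg_eq_add]
    · rw [h2, h4, hback i hi, hstep j hj, ← h1, ← h3, hself x (hconj x), ← Real.cos_neg]
      congr 1
      simp only [hδ]
      ring
    · exact absurd (hwsucc i hi j hj (h1.symm.trans h3)) hij
  · intro z
    obtain ⟨i, hi, a, b, ha, hb, hz⟩ := exists_fan_coords hθ0 hθn hlt hltpi z
    have hsup : ∀ x, x ≠ w i → x ≠ w (i + 1) →
        (Pi.single (w i) a + Pi.single (w (i + 1)) b : V → ℝ) x = 0 := fun x h1 h2 => by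
      rw [Pi.add_apply, Pi.single_eq_of_ne h1, Pi.single_eq_of_ne h2, add_zero]
    refine ⟨f i, hvf i, Pi.single (w i) a + Pi.single (w (i + 1)) b, fun x => ?_,
      hsup v (hface i).1 (hface (i + 1)).1, fun x hx => hsup x ?_ ?_, ?_⟩
    · have hns : ∀ (y : V) (c : ℝ), 0 ≤ c → 0 ≤ (Pi.single y c : V → ℝ) x := fun y c hc => by
        rw [Pi.single_apply]
        split_ifs
        · exact hc
        · exact le_rfl
      exact add_nonneg (hns _ a ha) (hns _ b hb)
    · rintro rfl
      exact hx (by rw [(hface i).2.2]; simp)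
    · rintro rfl
      exact hx (by rw [(hface i).2.2]; simp)
    · rw [hsumsingle i hi, hz]
  · intro s t hs ht l m hl hm hlv hmv hls hmt hsum
    obtain ⟨i, hi, rfl⟩ := hcover s hs
    obtain ⟨j, hj, rfl⟩ := hcover t ht
    rw [hsplit i hi l hlv hls, hsplit j hj m hmv hmt]
    rw [hsplit i hi l hlv hls, hsplit j hj m hmv hmt, hsumsingle i hi, hsumsingle j hj] at hsum
    exact fan_coords_unique hθ0 hθn hlt hltpi hwn hi hj (hl _) (hl _) (hm _) (hm _) hsum

end SurfaceTriangulation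

/-! ### Laying out the triangles at a vertex in the Lorentz model -/

/-- The determinant of the Gram matrix of the unit normals of the sides of a hyperbolic triangle with
angles `A`, `B`, `C`, up to sign. -/
def angleGram (A B C : ℝ) : ℝ :=
  Real.cos A ^ 2 + Real.cos B ^ 2 + Real.cos C ^ 2 + 2 * Real.cos A * Real.cos B * Real.cos C - 1

theorem coshSide_sq_sub_one {A B C : ℝ} (hA : Real.sin A ≠ 0) (hB : Real.sin B ≠ 0) :
    coshSide A B C ^ 2 - 1 = angleGram A B C / (Real.sin A * Real.sin B) ^ 2 := by
  have h1 := Real.sin_sq_add_cos_sq A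
  have h2 := Real.sin_sq_add_cos_sq B
  rw [coshSide, angleGram, eq_div_iff (by positivity), div_pow, sub_mul, div_mul_cancel₀ _
    (by positivity), one_mul, mul_pow]
  linear_combination (-1 : ℝ) * Real.sin B ^ 2 * h1 + (Real.cos A ^ 2 - 1) * h2

/-- The hyperbolic sine of the side between the angles `A` and `B`. -/
theorem sqrt_coshSide_sq_sub_one {A B C : ℝ} (hA : 0 < Real.sin A) (hB : 0 < Real.sin B) :
    √(coshSide A B C ^ 2 - 1) = √(angleGram A B C) / (Real.sin A * Real.sin B) := by
  rw [coshSide_sq_sub_one hA.ne' hB.ne', Real.sqrt_div' _ (by positivity),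
    Real.sqrt_sq (by positivity)]

theorem angleGram_perm (A B C : ℝ) : angleGram A B C = angleGram A C B := by
  simp only [angleGram]; ring

theorem angleGram_rot (A B C : ℝ) : angleGram A B C = angleGram B C A := by
  simp only [angleGram]; ring

theorem angleGram_pos {A B C : ℝ} (hA : 0 < A) (hB : 0 < B) (hC : 0 < C)
    (hs : A + B + C < Real.pi) : 0 < angleGram A B C := by
  have h1 : 0 < Real.sin A := Real.sin_pos_of_pos_of_lt_pi hA (by linarith)
  have h2 : 0 < Real.sin B := Real.sin_pos_of_pos_of_lt_pi hB (by linarith)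
  have h3 := coshSide_sq_sub_one (C := C) h1.ne' h2.ne'
  have h4 := one_lt_coshSide hA hB hC hs
  have h5 : 0 < coshSide A B C ^ 2 - 1 := by nlinarith
  rw [h3] at h5
  exact (div_pos_iff_of_pos_right (by positivity)).1 h5

/-- The first law of cosines for sides that are computed from the angles. -/
theorem coshSide_law {A B C : ℝ} (hA : 0 < A) (hB : 0 < B) (hC : 0 < C)
    (hs : A + B + C < Real.pi) :
    coshSide B C A = coshSide A B C * coshSide A C B -
      √(coshSide A B C ^ 2 - 1) * √(coshSide A C B ^ 2 - 1) * Real.cos A := by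
  have h1 : 0 < Real.sin A := Real.sin_pos_of_pos_of_lt_pi hA (by linarith)
  have h2 : 0 < Real.sin B := Real.sin_pos_of_pos_of_lt_pi hB (by linarith)
  have h3 : 0 < Real.sin C := Real.sin_pos_of_pos_of_lt_pi hC (by linarith)
  have hD := Real.mul_self_sqrt (angleGram_pos hA hB hC hs).le
  rw [sqrt_coshSide_sq_sub_one h1 h2, sqrt_coshSide_sq_sub_one h1 h3, angleGram_perm A C B,
    div_mul_div_comm, hD]
  have e1 := Real.sin_sq_add_cos_sq A
  simp only [coshSide, angleGram]
  field_simp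
  linear_combination (Real.cos A + Real.cos B * Real.cos C) * e1

namespace SurfaceTriangulation

variable {V : Type*} [Fintype V] [DecidableEq V] {T : SurfaceTriangulation V}

open Classical in
/-- The hyperbolic cosine of the length of the edge `ab`, read off from the angles of a face at this
edge, and `1` if there is no such face. -/
def edgeCosh (u : T.AngleSpace) (a b : V) : ℝ :=
  if h : a ≠ b ∧ ∃ t : T.Face, a ∈ t.1 ∧ b ∈ t.1 then
    1 + 2 * Real.exp (edgeLog (u h.2.choose) fun v => (v : V) ∈ ({a, b} : Finset V))
  else 1

theorem edgeCosh_self (u : T.AngleSpace) (a : V) : edgeCosh u a a = 1 := by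
  simp [edgeCosh]

theorem edgeCosh_eq {u : T.AngleSpace} (hu : u ∈ T.angleSystems) (hm : IsMatched u) {t : T.Face}
    {a b c : V} (hab : a ≠ b) (hac : a ≠ c) (hbc : b ≠ c) (ha : a ∈ t.1) (hb : b ∈ t.1)
    (hc : c ∈ t.1) :
    edgeCosh u a b = coshSide (u t ⟨a, ha⟩) (u t ⟨b, hb⟩) (u t ⟨c, hc⟩) := by
  have h : a ≠ b ∧ ∃ t : T.Face, a ∈ t.1 ∧ b ∈ t.1 := ⟨hab, t, ha, hb⟩
  obtain ⟨has, hbs⟩ := h.2.choose_spec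
  rw [edgeCosh, dif_pos h]
  generalize h.2.choose = s at has hbs
  have hsub : ∀ r : T.Face, a ∈ r.1 → b ∈ r.1 → ({a, b} : Finset V) ⊆ r.1 := by
    intro r ha hb x hx
    rcases Finset.mem_insert.1 hx with rfl | hx
    · exact ha
    · rw [Finset.mem_singleton.1 hx]; exact hb
  have hst : edgeLog (u s) (fun v => (v : V) ∈ ({a, b} : Finset V)) =
      edgeLog (u t) (fun v => (v : V) ∈ ({a, b} : Finset V)) := by
    rcases eq_or_ne s t with rfl | hst
    · rfl
    · exact hm (edgeOf t (hsub t ha hb) (Finset.card_pair hab)) s t hst (hsub s has hbs)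
        (hsub t ha hb)
  have hA := isHypAngles_of_mem_angleSystems hu t
  have h1 := one_lt_coshSide_face hA hab hac hbc ha hb hc
  rw [hst, edgeLog_face hA hab hac hbc ha hb hc rfl, Real.exp_log (by linarith)]
  ring

/-- The angles of a face, as three numbers. -/
theorem face_angles {u : T.AngleSpace} (hu : u ∈ T.angleSystems) {t : T.Face}
    {a b c : V} (hab : a ≠ b) (hac : a ≠ c) (hbc : b ≠ c) (ha : a ∈ t.1) (hb : b ∈ t.1)
    (hc : c ∈ t.1) : 0 < u t ⟨a, ha⟩ ∧ 0 < u t ⟨b, hb⟩ ∧ 0 < u t ⟨c, hc⟩ ∧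
      u t ⟨a, ha⟩ + u t ⟨b, hb⟩ + u t ⟨c, hc⟩ < Real.pi := by
  have hA := isHypAngles_of_mem_angleSystems hu t
  have hs := hA.2
  rw [sum_of_card_eq_three (card_face_coe t) (a := ⟨a, ha⟩) (b := ⟨b, hb⟩) (c := ⟨c, hc⟩)
    (by simpa using hab) (by simpa using hbc) (by simpa using hac)] at hs
  exact ⟨hA.1 _, hA.1 _, hA.1 _, hs⟩

theorem one_lt_edgeCosh {u : T.AngleSpace} (hu : u ∈ T.angleSystems) (hm : IsMatched u)
    {t : T.Face} {a b : V} (hab : a ≠ b) (ha : a ∈ t.1) (hb : b ∈ t.1) : 1 < edgeCosh u a b := by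
  obtain ⟨c, hc, hac, hbc, -⟩ := exists_third_vertex t hab ha hb
  rw [edgeCosh_eq hu hm hab hac hbc ha hb hc]
  exact one_lt_coshSide_face (isHypAngles_of_mem_angleSystems hu t) hab hac hbc ha hb hc

theorem edgeCosh_comm {u : T.AngleSpace} (hu : u ∈ T.angleSystems) (hm : IsMatched u)
    {t : T.Face} {a b : V} (ha : a ∈ t.1) (hb : b ∈ t.1) : edgeCosh u a b = edgeCosh u b a := by
  rcases eq_or_ne a b with rfl | hab
  · rfl
  obtain ⟨c, hc, hac, hbc, -⟩ := exists_third_vertex t hab ha hb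
  rw [edgeCosh_eq hu hm hab hac hbc ha hb hc, edgeCosh_eq hu hm hab.symm hbc hac hb ha hc,
    coshSide_swap]

/-- The law of cosines at the vertex `a` of a face. -/
theorem edgeCosh_law {u : T.AngleSpace} (hu : u ∈ T.angleSystems) (hm : IsMatched u) {t : T.Face}
    {a b c : V} (hab : a ≠ b) (hac : a ≠ c) (hbc : b ≠ c) (ha : a ∈ t.1) (hb : b ∈ t.1)
    (hc : c ∈ t.1) :
    edgeCosh u b c = edgeCosh u a b * edgeCosh u a c -
      √(edgeCosh u a b ^ 2 - 1) * √(edgeCosh u a c ^ 2 - 1) * Real.cos (u t ⟨a, ha⟩) := by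
  obtain ⟨h1, h2, h3, h4⟩ := face_angles hu hab hac hbc ha hb hc
  rw [edgeCosh_eq hu hm hab hac hbc ha hb hc, edgeCosh_eq hu hm hac hab hbc.symm ha hc hb,
    edgeCosh_eq hu hm hbc hab.symm hac.symm hb hc ha]
  exact coshSide_law h1 h2 h3 h4

/-- The law of sines: the altitude of a face from its vertex `c`. -/
theorem edgeCosh_law_sin {u : T.AngleSpace} (hu : u ∈ T.angleSystems) (hm : IsMatched u)
    {t : T.Face} {a b c : V} (hab : a ≠ b) (hac : a ≠ c) (hbc : b ≠ c) (ha : a ∈ t.1)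
    (hb : b ∈ t.1) (hc : c ∈ t.1) :
    √(edgeCosh u a c ^ 2 - 1) * Real.sin (u t ⟨a, ha⟩) =
      √(edgeCosh u b c ^ 2 - 1) * Real.sin (u t ⟨b, hb⟩) := by
  have hsin : ∀ v, 0 < Real.sin (u t v) := fun v =>
    Real.sin_pos_of_pos_of_lt_pi (hu.2.1 t v).1 (hu.2.1 t v).2
  have s1 := hsin ⟨a, ha⟩
  have s2 := hsin ⟨b, hb⟩
  have s3 := hsin ⟨c, hc⟩
  rw [edgeCosh_eq hu hm hac hab hbc.symm ha hc hb, edgeCosh_eq hu hm hbc hab.symm hac.symm hb hc ha,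
    sqrt_coshSide_sq_sub_one s1 s3, sqrt_coshSide_sq_sub_one s2 s3,
    ← angleGram_rot (u t ⟨a, ha⟩), angleGram_perm (u t ⟨a, ha⟩)]
  field_simp

/-- A system of developing maps for the triangulation: for every vertex `v` the vectors `N v w` are
the positions of the vertices of the triangles at `v` when these are laid out around a point of the
hyperbolic plane, in the Lorentz model.  The hyperbolic cosines of the edge lengths are `k a b`. -/
structure IsFrameSystem (T : SurfaceTriangulation V) (k : V → V → ℝ) (N : V → V → ℝ × ℂ) :
    Prop where
  future : ∀ (t : T.Face) (v w : V), v ∈ t.1 → w ∈ t.1 → IsFuture (N v w)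
  diag : ∀ a, k a a = 1
  gram : ∀ (t : T.Face) (v a b : V), v ∈ t.1 → a ∈ t.1 → b ∈ t.1 →
    lorentzForm (N v a) (N v b) = k a b
  /-- the two developments of a pair of adjacent faces at the ends of the common edge agree -/
  gram_opposite : ∀ (s t : T.Face) (v w a b : V), s ≠ t → v ≠ w → v ∈ s.1 → v ∈ t.1 → w ∈ s.1 →
    w ∈ t.1 → a ∈ s.1 → b ∈ t.1 → v ≠ a → w ≠ a → v ≠ b → w ≠ b →
    lorentzForm (N v a) (N v b) = lorentzForm (N w a) (N w b)
  /-- the triangles at `v` do not overlap; since the weight of `v` may have any sign, this is said of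
  the infinite sectors at `v` that they span -/
  coords_unique : ∀ (v : V) (s t : T.Face), v ∈ s.1 → v ∈ t.1 → ∀ l m : V → ℝ,
    (∀ x, x ≠ v → 0 ≤ l x) → (∀ x, x ≠ v → 0 ≤ m x) →
    (∀ x ∉ s.1, l x = 0) → (∀ x ∉ t.1, m x = 0) →
    ∑ x, l x • N v x = ∑ x, m x • N v x → l = m
  /-- the sectors at `v` cover everything -/
  exists_coords : ∀ (v : V) (X : ℝ × ℂ), ∃ t : T.Face, v ∈ t.1 ∧ ∃ l : V → ℝ,
    (∀ x, x ≠ v → 0 ≤ l x) ∧ (∀ x ∉ t.1, l x = 0) ∧ X = ∑ x, l x • N v x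

theorem lorentzForm_polar (k k' : ℝ) (z z' : ℂ) (r r' : ℝ) :
    lorentzForm (k, r • z) (k', r' • z') = k * k' - r * r' * (z * (starRingEnd ℂ) z').re := by
  rw [lorentzForm_apply]
  simp
  ring

/-- An angle system with matching lengths has developing maps. -/
theorem IsMatched.exists_isFrameSystem {u : T.AngleSpace} (hu : u ∈ T.angleSystems)
    (hm : IsMatched u) : ∃ N, IsFrameSystem T (edgeCosh u) N := by
  choose dir hdir using exists_isLayout hu
  let S : V → V → ℝ := fun v w => √(edgeCosh u v w ^ 2 - 1)
  have hSself : ∀ v, S v v = 0 := fun v => by simp [S, edgeCosh_self]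
  have hSpos : ∀ (t : T.Face) (v w : V), v ≠ w → v ∈ t.1 → w ∈ t.1 → 0 < S v w := by
    intro t v w hvw hv hw
    have := one_lt_edgeCosh hu hm hvw hv hw
    exact Real.sqrt_pos.2 (by nlinarith)
  have hSsq : ∀ (t : T.Face) (v w : V), v ∈ t.1 → w ∈ t.1 →
      S v w * S v w = edgeCosh u v w ^ 2 - 1 := by
    intro t v w hv hw
    refine Real.mul_self_sqrt ?_
    rcases eq_or_ne v w with rfl | hvw
    · simp [edgeCosh_self]
    · have := one_lt_edgeCosh hu hm hvw hv hw
      nlinarith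
  let N : V → V → ℝ × ℂ := fun v w => (edgeCosh u v w, S v w • dir v w)
  have hNf : ∀ v w a b, lorentzForm (N v a) (N w b) = edgeCosh u v a * edgeCosh u w b -
      S v a * S w b * (dir v a * (starRingEnd ℂ) (dir w b)).re := fun v w a b =>
    lorentzForm_polar _ _ _ _ _ _
  have hgram : ∀ (t : T.Face) (v a b : V), v ∈ t.1 → a ∈ t.1 → b ∈ t.1 →
      lorentzForm (N v a) (N v b) = edgeCosh u a b := by
    intro t v a b hv ha hb
    rw [hNf]
    rcases eq_or_ne v a with rfl | hva
    · rw [edgeCosh_self, hSself]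
      ring
    rcases eq_or_ne v b with rfl | hvb
    · rw [edgeCosh_self, hSself, edgeCosh_comm hu hm hv ha]
      ring
    rcases eq_or_ne a b with rfl | hab
    · rw [Complex.mul_conj, Complex.normSq_eq_norm_sq, (hdir v).norm_eq, hSsq t v a hv ha,
        edgeCosh_self]
      simp
      ring
    · rw [(hdir v).angle t hv a b ha hb hva hvb hab]
      exact (edgeCosh_law hu hm hva hvb hab hv ha hb).symm
  have hfut : ∀ (t : T.Face) (v w : V), v ∈ t.1 → w ∈ t.1 → IsFuture (N v w) := by
    intro t v w hv hw
    refine isFuture_of_self_pos ?_ ?_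
    · rcases eq_or_ne v w with rfl | hvw
      · simp [N, edgeCosh_self]
      · exact one_pos.trans (one_lt_edgeCosh hu hm hvw hv hw)
    · rw [hgram t v w w hv hw hw, edgeCosh_self]
      exact one_pos
  have hfst : ∀ (v : V) (l : V → ℝ), (∑ x, l x • N v x).1 = ∑ x, l x * edgeCosh u v x := by
    intro v l
    rw [Prod.fst_sum]
    rfl
  have hsnd : ∀ (v : V) (l : V → ℝ), (∑ x, l x • N v x).2 = ∑ x, (l x * S v x) • dir v x := by
    intro v l
    rw [Prod.snd_sum]
    simp only [N, Prod.smul_snd, smul_smul]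
  refine ⟨N, hfut, edgeCosh_self u, hgram, ?_, ?_, ?_⟩
  · intro s t v w a b hst hvw hvs hvt hws hwt ha hb hva hwa hvb hwb
    rw [hNf, hNf, (hdir v).angle_add s t hvs hvt w a b hst hvw hva hvb hwa hwb hws ha hwt hb,
      (hdir w).angle_add s t hws hwt v a b hst hvw.symm hwa hwb hva hvb hvs ha hvt hb,
      Real.cos_add, Real.cos_add]
    have hK := hSpos s v w hvw hvs hws
    have hK2 := hSsq s v w hvs hws
    have hcomm := edgeCosh_comm hu hm hvs hws
    have hSc : S w v = S v w := by simp only [S, hcomm]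
    have va := edgeCosh_law hu hm hvw hva hwa hvs hws ha
    have wa := edgeCosh_law hu hm hvw.symm hwa hva hws hvs ha
    have vb := edgeCosh_law hu hm hvw hvb hwb hvt hwt hb
    have wb := edgeCosh_law hu hm hvw.symm hwb hvb hwt hvt hb
    have sina := edgeCosh_law_sin hu hm hvw hva hwa hvs hws ha
    have sinb := edgeCosh_law_sin hu hm hvw hvb hwb hvt hwt hb
    change edgeCosh u w a = edgeCosh u v w * edgeCosh u v a - S v w * S v a * _ at va
    change edgeCosh u v a = edgeCosh u w v * edgeCosh u w a - S w v * S w a * _ at wa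
    change edgeCosh u w b = edgeCosh u v w * edgeCosh u v b - S v w * S v b * _ at vb
    change edgeCosh u v b = edgeCosh u w v * edgeCosh u w b - S w v * S w b * _ at wb
    change S v a * _ = S w a * _ at sina
    change S v b * _ = S w b * _ at sinb
    rw [← hcomm, hSc] at wa wb
    generalize edgeCosh u v w = K at *
    generalize S v w = σ at *
    -- both sides are symmetric in the two ends of the edge after multiplication by `sinh²`
    refine mul_left_cancel₀ (mul_pos hK hK).ne' ?_
    have va' : σ * (S v a * Real.cos (u s ⟨v, hvs⟩)) = K * edgeCosh u v a - edgeCosh u w a := by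
      linarith
    have wa' : σ * (S w a * Real.cos (u s ⟨w, hws⟩)) = K * edgeCosh u w a - edgeCosh u v a := by
      linarith
    have vb' : σ * (S v b * Real.cos (u t ⟨v, hvt⟩)) = K * edgeCosh u v b - edgeCosh u w b := by
      linarith
    have wb' : σ * (S w b * Real.cos (u t ⟨w, hwt⟩)) = K * edgeCosh u w b - edgeCosh u v b := by
      linarith
    have e1 : σ * σ * (edgeCosh u v a * edgeCosh u v b - S v a * S v b *
        (Real.cos (u s ⟨v, hvs⟩) * Real.cos (u t ⟨v, hvt⟩) -
          Real.sin (u s ⟨v, hvs⟩) * Real.sin (u t ⟨v, hvt⟩))) =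
        σ * σ * (edgeCosh u v a * edgeCosh u v b) -
          (σ * (S v a * Real.cos (u s ⟨v, hvs⟩))) * (σ * (S v b * Real.cos (u t ⟨v, hvt⟩))) +
        σ * σ * ((S v a * Real.sin (u s ⟨v, hvs⟩)) * (S v b * Real.sin (u t ⟨v, hvt⟩))) := by ring
    have e2 : σ * σ * (edgeCosh u w a * edgeCosh u w b - S w a * S w b *
        (Real.cos (u s ⟨w, hws⟩) * Real.cos (u t ⟨w, hwt⟩) -
          Real.sin (u s ⟨w, hws⟩) * Real.sin (u t ⟨w, hwt⟩))) =
        σ * σ * (edgeCosh u w a * edgeCosh u w b) -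
          (σ * (S w a * Real.cos (u s ⟨w, hws⟩))) * (σ * (S w b * Real.cos (u t ⟨w, hwt⟩))) +
        σ * σ * ((S w a * Real.sin (u s ⟨w, hws⟩)) * (S w b * Real.sin (u t ⟨w, hwt⟩))) := by ring
    rw [e1, e2, va', vb', wa', wb', sina, sinb, hK2]
    ring
  · intro v s t hvs hvt l m hl hm' hls hmt hsum
    have h2 := congrArg Prod.snd hsum
    rw [hsnd, hsnd] at h2
    have hnn : ∀ l : V → ℝ, (∀ x, x ≠ v → 0 ≤ l x) → ∀ x, 0 ≤ l x * S v x := by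
      intro l hl x
      rcases eq_or_ne x v with rfl | hx
      · rw [hSself, mul_zero]
      · exact mul_nonneg (hl x hx) (Real.sqrt_nonneg _)
    have h3 := (hdir v).coords_unique s t hvs hvt (fun x => l x * S v x) (fun x => m x * S v x)
      (hnn l hl) (hnn m hm') (by simp [hSself]) (by simp [hSself])
      (fun x hx => by simp [hls x hx]) (fun x hx => by simp [hmt x hx]) h2
    have h4 : ∀ x, x ≠ v → l x = m x := by
      intro x hx
      by_cases hxs : x ∈ s.1
      · exact mul_right_cancel₀ (hSpos s v x hx.symm hvs hxs).ne' (congrFun h3 x)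
      · by_cases hxt : x ∈ t.1
        · exact mul_right_cancel₀ (hSpos t v x hx.symm hvt hxt).ne' (congrFun h3 x)
        · rw [hls x hxs, hmt x hxt]
    have h5 := congrArg Prod.fst hsum
    rw [hfst, hfst, ← Finset.add_sum_erase _ _ (Finset.mem_univ v),
      ← Finset.add_sum_erase (a := v) (f := fun x => m x * edgeCosh u v x) _
        (Finset.mem_univ v),
      Finset.sum_congr rfl fun x hx => by rw [h4 x (Finset.ne_of_mem_erase hx)],
      edgeCosh_self, mul_one, mul_one] at h5
    funext x
    rcases eq_or_ne x v with rfl | hx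
    · exact add_right_cancel h5
    · exact h4 x hx
  · intro v X
    obtain ⟨t, hvt, l, hl, hlv, hlt, hX⟩ := (hdir v).exists_coords X.2
    let m : V → ℝ := fun x => l x / S v x
    have hmv : m v = 0 := by simp [m, hlv]
    have hmS : ∀ x, m x * S v x = l x := by
      intro x
      rcases eq_or_ne v x with rfl | hx
      · rw [hmv, hlv, zero_mul]
      · by_cases hxt : x ∈ t.1
        · exact div_mul_cancel₀ _ (hSpos t v x hx hvt hxt).ne'
        · simp [m, hlt x hxt]
    let c : ℝ := X.1 - ∑ x, m x * edgeCosh u v x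
    refine ⟨t, hvt, m + Pi.single v c, fun x hx => ?_, fun x hx => ?_, ?_⟩
    · rw [Pi.add_apply, Pi.single_eq_of_ne hx, add_zero]
      exact div_nonneg (hl x) (Real.sqrt_nonneg _)
    · have hxv : x ≠ v := by rintro rfl; exact hx hvt
      rw [Pi.add_apply, Pi.single_eq_of_ne hxv, add_zero]
      simp [m, hlt x hx]
    · have hsing : ∑ x, (m + Pi.single v c : V → ℝ) x • N v x = ∑ x, m x • N v x + c • N v v := by
        simp only [Pi.add_apply, add_smul, Finset.sum_add_distrib]
        rw [Finset.sum_eq_single (a := v) (f := fun x => (Pi.single v c : V → ℝ) x • N v x)]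
        · rw [Pi.single_eq_same]
        · intro x _ hx
          rw [Pi.single_eq_of_ne hx, zero_smul]
        · simp
      rw [hsing]
      refine Prod.ext ?_ ?_
      · rw [Prod.fst_add, hfst]
        simp [N, edgeCosh_self, c]
      · rw [Prod.snd_add, hsnd]
        simp only [hmS, ← hX]
        simp [N, hSself]

end SurfaceTriangulation

/-! ### The geometric realization as a hyperbolic surface -/

theorem continuousOn_invFunOn_of_isCompact {X Y : Type*} [TopologicalSpace X] [TopologicalSpace Y]
    [T2Space Y] [Nonempty X] {f : X → Y} {K : Set X} (hK : IsCompact K) (hf : ContinuousOn f K)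
    (hinj : Set.InjOn f K) : ContinuousOn (Function.invFunOn f K) (f '' K) := by
  rw [continuousOn_iff_isClosed]
  intro C hC
  refine ⟨f '' (K ∩ C), ((hK.inter_right hC).image_of_continuousOn
    (hf.mono Set.inter_subset_left)).isClosed, ?_⟩
  ext y
  constructor
  · rintro ⟨hy, x, hx, rfl⟩
    rw [Set.mem_preimage, hinj.leftInvOn_invFunOn hx] at hy
    exact ⟨⟨x, ⟨hx, hy⟩, rfl⟩, x, hx, rfl⟩
  · rintro ⟨⟨x, ⟨hx, hxC⟩, rfl⟩, -⟩
    refine ⟨?_, x, hx, rfl⟩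
    rw [Set.mem_preimage, hinj.leftInvOn_invFunOn hx]
    exact hxC

namespace SurfaceTriangulation

variable {V : Type*} [Fintype V] [DecidableEq V] {T : SurfaceTriangulation V}

variable (T) in
/-- The geometric realization of the triangulation: systems of nonnegative weights on the vertices with
sum `1` that are supported on a face.  The vertices are numbered in order that the realization be
a type in the lowest universe. -/
def Realization : Type :=
  {p : Fin (Fintype.card V) → ℝ // (∀ i, 0 ≤ p i) ∧ ∑ i, p i = 1 ∧
    ∃ t : T.Face, ∀ v ∉ t.1, p (Fintype.equivFin V v) = 0}

instance : TopologicalSpace (Realization T) := inferInstanceAs (TopologicalSpace (Subtype _))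

instance : T2Space (Realization T) := inferInstanceAs (T2Space (Subtype _))

/-- The barycentric coordinates of a point of the realization. -/
def bary (p : Realization T) (v : V) : ℝ := p.1 (Fintype.equivFin V v)

theorem bary_nonneg (p : Realization T) (v : V) : 0 ≤ bary p v := p.2.1 _

theorem sum_bary (p : Realization T) : ∑ v, bary p v = 1 := by
  rw [← p.2.2.1, ← (Fintype.equivFin V).sum_comp]
  rfl

theorem bary_injective : Function.Injective (bary : Realization T → V → ℝ) := by
  intro p q h
  refine Subtype.ext (funext fun i => ?_)
  have := congrFun h ((Fintype.equivFin V).symm i)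
  simpa [bary] using this

theorem continuous_bary (v : V) : Continuous fun p : Realization T => bary p v :=
  (continuous_apply _).comp continuous_subtype_val

theorem exists_bary_eq (t : T.Face) {l : V → ℝ} (hl : ∀ v, 0 ≤ l v) (hs : ∑ v, l v = 1)
    (ht : ∀ v ∉ t.1, l v = 0) : ∃ p : Realization T, bary p = l := by
  refine ⟨⟨fun i => l ((Fintype.equivFin V).symm i), fun i => hl _, ?_, t, fun v hv => ?_⟩, ?_⟩
  · rw [← hs, ← (Fintype.equivFin V).symm.sum_comp]
  · simpa using ht v hv
  · funext v
    simp [bary]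

/-- The closed simplex of a face in the realization. -/
def carrier (t : T.Face) : Set (Realization T) := {p | ∀ v ∉ t.1, bary p v = 0}

theorem exists_mem_carrier (p : Realization T) : ∃ t, p ∈ carrier t := p.2.2.2

theorem mem_face_of_pos {p : Realization T} {t : T.Face} (hp : p ∈ carrier t) {v : V}
    (hv : 0 < bary p v) : v ∈ t.1 := by
  by_contra h
  exact hv.ne' (hp v h)

theorem isClosed_carrier (t : T.Face) : IsClosed (carrier t) := by
  have : carrier t = ⋂ v, ⋂ (_ : v ∉ t.1), {p | bary p v = 0} := by
    ext p
    simp [carrier]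
  rw [this]
  exact isClosed_iInter fun v => isClosed_iInter fun _ =>
    isClosed_eq (continuous_bary v) continuous_const

instance : CompactSpace (Realization T) := by
  refine isCompact_iff_compactSpace.1 ?_
  have hclosed : IsClosed {p : Fin (Fintype.card V) → ℝ | (∀ i, 0 ≤ p i) ∧ ∑ i, p i = 1 ∧
      ∃ t : T.Face, ∀ v ∉ t.1, p (Fintype.equivFin V v) = 0} := by
    have h1 : IsClosed {p : Fin (Fintype.card V) → ℝ | ∀ i, 0 ≤ p i} := by
      simp only [Set.ofPred_forall]
      exact isClosed_iInter fun i => isClosed_le continuous_const (continuous_apply i)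
    have h2 : IsClosed {p : Fin (Fintype.card V) → ℝ | ∑ i, p i = 1} :=
      isClosed_eq (continuous_finsetSum _ fun i _ => continuous_apply i) continuous_const
    have h3 : IsClosed {p : Fin (Fintype.card V) → ℝ |
        ∃ t : T.Face, ∀ v ∉ t.1, p (Fintype.equivFin V v) = 0} := by
      simp only [Set.ofPred_exists, Set.ofPred_forall]
      exact isClosed_iUnion_of_finite fun t => isClosed_iInter fun v => isClosed_iInter fun _ =>
        isClosed_eq (continuous_apply _) continuous_const
    exact h1.inter (h2.inter h3)
  refine (isCompact_univ_pi fun _ => isCompact_Icc (a := (0 : ℝ)) (b := 1)).of_isClosed_subset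
    hclosed ?_
  rintro p ⟨h0, h1, -⟩ i _
  exact ⟨h0 i, h1 ▸ Finset.single_le_sum (fun i _ => h0 i) (Finset.mem_univ i)⟩

theorem exists_vertex (T : SurfaceTriangulation V) (v : V) :
    ∃ p : Realization T, bary p = Pi.single v 1 := by
  obtain ⟨t, ht, hvt⟩ := T.exists_face v
  refine exists_bary_eq ⟨t, ht⟩ (fun w => ?_) ?_ fun w hw => ?_
  · rw [Pi.single_apply]
    split_ifs <;> norm_num
  · simp
  · exact Pi.single_eq_of_ne (by rintro rfl; exact hw hvt) _

variable (T) in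
/-- The vertices of the realization. -/
def realizationVertex (v : V) : Realization T := (exists_vertex T v).choose

theorem bary_realizationVertex (v : V) : bary (realizationVertex T v) = Pi.single v 1 :=
  (exists_vertex T v).choose_spec

/-- The open star of a vertex. -/
def openStar (v : V) : Set (Realization T) := {p | 0 < bary p v}

/-- The closed star of a vertex. -/
def closedStar (v : V) : Set (Realization T) := {p | ∃ t : T.Face, v ∈ t.1 ∧ p ∈ carrier t}

theorem isOpen_openStar (v : V) : IsOpen (openStar v : Set (Realization T)) :=
  isOpen_lt continuous_const (continuous_bary v)

theorem openStar_subset_closedStar (v : V) :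
    (openStar v : Set (Realization T)) ⊆ closedStar v := fun p hp =>
  let ⟨t, ht⟩ := exists_mem_carrier p
  ⟨t, mem_face_of_pos ht hp, ht⟩

theorem isCompact_closedStar (v : V) : IsCompact (closedStar v : Set (Realization T)) := by
  have : (closedStar v : Set (Realization T)) = ⋃ t : T.Face, ⋃ (_ : v ∈ t.1), carrier t := by
    ext p
    simp [closedStar]
  rw [this]
  refine IsClosed.isCompact ?_
  exact isClosed_iUnion_of_finite fun t => isClosed_iUnion_of_finite fun _ => isClosed_carrier t

variable {k : V → V → ℝ} {N : V → V → ℝ × ℂ}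

/-- The developing map of the star of `v`, in the Lorentz model and without normalization. -/
def develop (N : V → V → ℝ × ℂ) (v : V) (p : Realization T) : ℝ × ℂ := ∑ x, bary p x • N v x

/-- The developing map of the star of `v`. -/
def starMap (N : V → V → ℝ × ℂ) (v : V) (p : Realization T) : ℍ := ofLorentz (develop N v p)

theorem continuous_develop (v : V) : Continuous (develop N v : Realization T → ℝ × ℂ) :=
  continuous_finsetSum _ fun x _ => (continuous_bary x).smul continuous_const

theorem develop_realizationVertex (v w : V) : develop N v (realizationVertex T w) = N v w := by
  rw [develop, bary_realizationVertex, Finset.sum_eq_single w]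
  · simp
  · intro x _ hx
    rw [Pi.single_eq_of_ne hx, zero_smul]
  · simp

namespace IsFrameSystem

theorem isFuture_develop (hN : IsFrameSystem T k N) {v : V} {p : Realization T}
    (hp : p ∈ closedStar v) : IsFuture (develop N v p) := by
  obtain ⟨t, hv, hp⟩ := hp
  obtain ⟨j, hj⟩ : ∃ j, bary p j ≠ 0 := by
    by_contra! h
    have := sum_bary p
    rw [Finset.sum_eq_zero fun i _ => h i] at this
    exact zero_ne_one this
  refine isFuture_sum (fun i _ => bary_nonneg p i) (fun i _ hi => ?_) (Finset.mem_univ j) hj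
  refine hN.future t v i hv ?_
  by_contra h
  exact hi (hp i h)

theorem continuousOn_starMap (hN : IsFrameSystem T k N) (v : V) :
    ContinuousOn (starMap N v : Realization T → ℍ) (closedStar v) :=
  continuousOn_ofLorentz.comp (continuous_develop v).continuousOn fun _ hp =>
    hN.isFuture_develop hp

theorem injOn_starMap (hN : IsFrameSystem T k N) (v : V) :
    Set.InjOn (starMap N v : Realization T → ℍ) (closedStar v) := by
  intro p hp q hq h
  obtain ⟨c, hc, hpq⟩ := (ofLorentz_eq_iff (hN.isFuture_develop hp) (hN.isFuture_develop hq)).1 h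
  obtain ⟨s, hvs, hps⟩ := hp
  obtain ⟨t, hvt, hqt⟩ := hq
  have h1 : bary p = fun x => c * bary q x := by
    refine hN.coords_unique v s t hvs hvt _ _ (fun x _ => bary_nonneg p x)
      (fun x _ => mul_nonneg hc.le (bary_nonneg q x)) hps (fun x hx => by rw [hqt x hx, mul_zero]) ?_
    simp only [mul_smul, ← Finset.smul_sum]
    exact hpq
  have h2 := sum_bary p
  rw [h1, ← Finset.mul_sum, sum_bary, mul_one] at h2
  rw [h2] at h1
  exact bary_injective (by simpa using h1)

/-- The complement of the image of an open star is a finite union of closed cones. -/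
theorem isOpen_image_openStar (hN : IsFrameSystem T k N) (v : V) :
    IsOpen (starMap N v '' (openStar v : Set (Realization T))) := by
  let L : (V → ℝ) →ₗ[ℝ] ℝ × ℂ := ∑ x, (LinearMap.proj x).smulRight (N v x)
  have hL : ∀ l, L l = ∑ x, l x • N v x := fun l => by simp [L]
  let W : T.Face → Submodule ℝ (V → ℝ) := fun t =>
    { carrier := {l | ∀ x ∉ t.1, l x = 0}
      add_mem' := fun {a b} ha hb x hx => by rw [Pi.add_apply, ha x hx, hb x hx, add_zero]
      zero_mem' := fun _ _ => rfl
      smul_mem' := fun c a ha x hx => by rw [Pi.smul_apply, ha x hx, smul_zero] }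
  let C : T.Face → Set (ℝ × ℂ) := fun t =>
    (L.domRestrict (W t)) '' {l | (∀ x, x ≠ v → 0 ≤ l.1 x) ∧ l.1 v ≤ 0}
  have hC : ∀ t : T.Face, v ∈ t.1 → IsClosed (C t) := by
    intro t hvt
    have hker : LinearMap.ker (L.domRestrict (W t)) = ⊥ := by
      rw [LinearMap.ker_eq_bot']
      rintro ⟨l, hl⟩ h
      -- positive and negative parts have the same image
      have h : ∑ x, l x • N v x = 0 := (hL l).symm.trans h
      have h1 : (fun x => max (l x) 0) = fun x => max (-l x) 0 := by
        refine hN.coords_unique v t t hvt hvt _ _ (fun x _ => le_max_right _ _)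
          (fun x _ => le_max_right _ _) (fun x hx => by simp [hl x hx])
          (fun x hx => by simp [hl x hx]) ?_
        rw [← sub_eq_zero, ← Finset.sum_sub_distrib, ← h]
        refine Finset.sum_congr rfl fun x _ => ?_
        rw [← sub_smul]
        congr 1
        rcases le_total 0 (l x) with h | h
        · rw [max_eq_left h, max_eq_right (by linarith), sub_zero]
        · rw [max_eq_right h, max_eq_left (by linarith), zero_sub, neg_neg]
      refine Subtype.ext (funext fun x => ?_)
      have h2 : max (l x) 0 = max (-l x) 0 := congrFun h1 x
      change l x = 0
      rcases le_total 0 (l x) with h | h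
      · rw [max_eq_left h, max_eq_right (by linarith)] at h2
        exact h2
      · rw [max_eq_right h, max_eq_left (by linarith)] at h2
        linarith
    refine (LinearMap.isClosedEmbedding_of_injective hker).isClosedMap _ ?_
    have hc : ∀ x, Continuous fun l : W t => l.1 x := fun x =>
      (continuous_apply x).comp continuous_subtype_val
    have h1 : IsClosed {l : W t | ∀ x, x ≠ v → 0 ≤ l.1 x} := by
      simp only [Set.ofPred_forall]
      exact isClosed_iInter fun x => isClosed_iInter fun _ =>
        isClosed_le continuous_const (hc x)
    exact h1.inter (isClosed_le (hc v) continuous_const)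
  have hcompl : (starMap N v '' (openStar v : Set (Realization T)))ᶜ =
      ⋃ t : T.Face, ⋃ (_ : v ∈ t.1), toLorentz ⁻¹' C t := by
    ext z
    simp only [Set.mem_compl_iff, Set.mem_iUnion, Set.mem_preimage]
    constructor
    · intro hz
      obtain ⟨t, hvt, l, hl, hlt, hX⟩ := hN.exists_coords v (toLorentz z)
      refine ⟨t, hvt, ⟨l, hlt⟩, ⟨hl, ?_⟩, (hL l).trans hX.symm⟩
      change l v ≤ 0
      by_contra! hlv
      have hl0 : ∀ x, 0 ≤ l x := fun x => by
        rcases eq_or_ne x v with rfl | hx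
        · exact hlv.le
        · exact hl x hx
      have hs : 0 < ∑ x, l x := Finset.sum_pos' (fun x _ => hl0 x) ⟨v, Finset.mem_univ v, hlv⟩
      obtain ⟨p, hp⟩ := exists_bary_eq t (l := fun x => (∑ x, l x)⁻¹ * l x)
        (fun x => mul_nonneg (inv_nonneg.2 hs.le) (hl0 x))
        (by rw [← Finset.mul_sum, inv_mul_cancel₀ hs.ne']) (fun x hx => by rw [hlt x hx, mul_zero])
      refine hz ⟨p, ?_, ?_⟩
      · change 0 < bary p v
        rw [hp]
        exact mul_pos (inv_pos.2 hs) hlv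
      · rw [starMap, develop, hp]
        simp only [mul_smul, ← Finset.smul_sum, ← hX]
        rw [ofLorentz_smul (isFuture_toLorentz z) (inv_pos.2 hs), ofLorentz_toLorentz]
    · rintro ⟨t, hvt, ⟨l, hlt⟩, ⟨hl, hlv⟩, hX⟩ ⟨p, hp, rfl⟩
      have hX : ∑ x, l x • N v x = toLorentz (starMap N v p) := (hL l).symm.trans hX
      have hps := openStar_subset_closedStar v hp
      have hF := hN.isFuture_develop hps
      obtain ⟨s, hvs, hps⟩ := hps
      rw [starMap, toLorentz_ofLorentz hF] at hX
      have hc : 0 < (√(lorentzForm (develop N v p) (develop N v p)))⁻¹ :=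
        inv_pos.2 (Real.sqrt_pos.2 hF.self_pos)
      generalize (√(lorentzForm (develop N v p) (develop N v p)))⁻¹ = c at hX hc
      have h1 : l = fun x => c * bary p x := by
        refine hN.coords_unique v t s hvt hvs _ _ hl
          (fun x _ => mul_nonneg hc.le (bary_nonneg p x)) hlt
          (fun x hx => by rw [hps x hx, mul_zero]) ?_
        simp only [mul_smul, ← Finset.smul_sum]
        exact hX
      have h2 : l v = c * bary p v := congrFun h1 v
      have h3 : 0 < c * bary p v := mul_pos hc hp
      have h4 : l v ≤ 0 := hlv
      linarith
  rw [← isClosed_compl_iff, hcompl]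
  exact isClosed_iUnion_of_finite fun t => isClosed_iUnion_of_finite fun hvt =>
    (hC t hvt).preimage continuous_toLorentz

theorem isOpenMap_starMap (hN : IsFrameSystem T k N) (v : V) :
    IsOpenMap ((openStar v : Set (Realization T)).domRestrict (starMap N v)) := by
  intro W hW
  obtain ⟨W', hW', rfl⟩ := isOpen_induced_iff.1 hW
  have h : (openStar v : Set (Realization T)).domRestrict (starMap N v) ''
      (Subtype.val ⁻¹' W') = starMap N v '' (openStar v : Set (Realization T)) \
        starMap N v '' ((closedStar v : Set (Realization T)) \ (openStar v ∩ W')) := by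
    ext z
    constructor
    · rintro ⟨⟨p, hp⟩, hpW, rfl⟩
      refine ⟨⟨p, hp, rfl⟩, ?_⟩
      rintro ⟨q, ⟨hq, hq'⟩, hqp⟩
      have : q = p := hN.injOn_starMap v hq (openStar_subset_closedStar v hp) hqp
      exact hq' (this ▸ ⟨hp, hpW⟩)
    · rintro ⟨⟨p, hp, rfl⟩, hz⟩
      refine ⟨⟨p, hp⟩, ?_, rfl⟩
      by_contra hpW
      exact hz ⟨p, ⟨openStar_subset_closedStar v hp, fun h => hpW h.2⟩, rfl⟩
  rw [h]
  refine (hN.isOpen_image_openStar v).sdiff (IsCompact.isClosed ?_)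
  exact ((isCompact_closedStar v).diff ((isOpen_openStar v).inter hW')).image_of_continuousOn
    ((hN.continuousOn_starMap v).mono Set.sdiff_subset)

/-- The chart of the realization on the open star of a vertex. -/
def chart (hN : IsFrameSystem T k N) (v : V) : OpenPartialHomeomorph (Realization T) ℍ :=
  haveI : Nonempty (Realization T) := ⟨realizationVertex T v⟩
  OpenPartialHomeomorph.ofContinuousOpenRestrict
    (Set.InjOn.toPartialEquiv (starMap N v) (openStar v)
      ((hN.injOn_starMap v).mono (openStar_subset_closedStar v)))
    ((hN.continuousOn_starMap v).mono (openStar_subset_closedStar v))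
    (hN.isOpenMap_starMap v)
    (isOpen_openStar v)

theorem exists_pos (p : Realization T) : ∃ v, 0 < bary p v := by
  by_contra! h
  have h1 := sum_bary p
  have h2 := Finset.sum_nonpos fun v (_ : v ∈ Finset.univ) => h v
  linarith

/-- The hyperbolic atlas of the realization: a chart on the open star of each vertex. -/
@[reducible] def chartedSpace (hN : IsFrameSystem T k N) : ChartedSpace ℍ (Realization T) where
  atlas := Set.range hN.chart
  chartAt p := hN.chart (exists_pos p).choose
  mem_chart_source p := (exists_pos p).choose_spec
  chart_mem_atlas _ := ⟨_, rfl⟩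

/-- The developments around two common vertices of `s` and `t` have the same Gram matrix. -/
theorem gram_eq (hN : IsFrameSystem T k N) {s t : T.Face} {v w a b : V} (hvs : v ∈ s.1)
    (hvt : v ∈ t.1) (hws : w ∈ s.1) (hwt : w ∈ t.1) (ha : a ∈ s.1) (hb : b ∈ t.1) :
    lorentzForm (N v a) (N v b) = lorentzForm (N w a) (N w b) := by
  by_cases hat : a ∈ t.1
  · rw [hN.gram t v a b hvt hat hb, hN.gram t w a b hwt hat hb]
  by_cases hbs : b ∈ s.1
  · rw [hN.gram s v a b hvs ha hbs, hN.gram s w a b hws ha hbs]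
  rcases eq_or_ne v w with rfl | hvw
  · rfl
  exact hN.gram_opposite s t v w a b (fun h => hat (h ▸ ha)) hvw hvs hvt hws hwt ha hb
    (fun h => hat (h ▸ hvt)) (fun h => hat (h ▸ hwt)) (fun h => hbs (h ▸ hvs))
    (fun h => hbs (h ▸ hws))

theorem lorentzForm_develop (hN : IsFrameSystem T k N) {s t : T.Face} {v w : V} (hvs : v ∈ s.1)
    (hvt : v ∈ t.1) (hws : w ∈ s.1) (hwt : w ∈ t.1) {p q : Realization T} (hp : p ∈ carrier s)
    (hq : q ∈ carrier t) :
    lorentzForm (develop N v p) (develop N v q) = lorentzForm (develop N w p) (develop N w q) := by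
  simp only [develop, map_sum, LinearMap.sum_apply, map_smul, LinearMap.smul_apply]
  refine Finset.sum_congr rfl fun b _ => ?_
  by_cases hb : b ∈ t.1
  · congr 1
    refine Finset.sum_congr rfl fun a _ => ?_
    by_cases ha : a ∈ s.1
    · rw [hN.gram_eq hvs hvt hws hwt ha hb]
    · rw [hp a ha, zero_smul, zero_smul]
  · rw [hq b hb, zero_smul, zero_smul]

/-- The developing maps at the ends of an edge differ by an isometry. -/
theorem dist_starMap (hN : IsFrameSystem T k N) {s t : T.Face} {v w : V} (hvs : v ∈ s.1)
    (hvt : v ∈ t.1) (hws : w ∈ s.1) (hwt : w ∈ t.1) {p q : Realization T} (hp : p ∈ carrier s)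
    (hq : q ∈ carrier t) :
    dist (starMap N v p) (starMap N v q) = dist (starMap N w p) (starMap N w q) :=
  dist_ofLorentz_eq (hN.isFuture_develop ⟨s, hvs, hp⟩) (hN.isFuture_develop ⟨t, hvt, hq⟩)
    (hN.isFuture_develop ⟨s, hws, hp⟩) (hN.isFuture_develop ⟨t, hwt, hq⟩)
    (hN.lorentzForm_develop hvs hvt hws hwt hp hq) (hN.lorentzForm_develop hvs hvs hws hws hp hp)
    (hN.lorentzForm_develop hvt hvt hwt hwt hq hq)

theorem isClosedHyperbolicSurface (hN : IsFrameSystem T k N) :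
    letI := hN.chartedSpace
    IsClosedHyperbolicSurface (Realization T) := by
  let := hN.chartedSpace
  refine ⟨inferInstance, inferInstance, ?_⟩
  rintro _ ⟨v, rfl⟩ _ ⟨w, rfl⟩ z hz
  refine ⟨_, self_mem_nhdsWithin, fun x hx y hy => ?_⟩
  have key : ∀ x ∈ ((hN.chart v).symm ≫ₕ hN.chart w).source,
      0 < bary ((hN.chart v).symm x) v ∧ 0 < bary ((hN.chart v).symm x) w ∧
        starMap N v ((hN.chart v).symm x) = x := by
    intro x hx
    rw [OpenPartialHomeomorph.trans_source] at hx
    exact ⟨(hN.chart v).map_target hx.1, hx.2, (hN.chart v).right_inv hx.1⟩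
  obtain ⟨hxv, hxw, hx'⟩ := key x hx
  obtain ⟨hyv, hyw, hy'⟩ := key y hy
  obtain ⟨s, hs⟩ := exists_mem_carrier ((hN.chart v).symm x)
  obtain ⟨t, ht⟩ := exists_mem_carrier ((hN.chart v).symm y)
  have h := hN.dist_starMap (mem_face_of_pos hs hxw) (mem_face_of_pos ht hyw)
    (mem_face_of_pos hs hxv) (mem_face_of_pos ht hyv) hs ht
  rw [hx', hy'] at h
  exact h

end IsFrameSystem

end SurfaceTriangulation

namespace SurfaceTriangulation

variable {V : Type*} [Fintype V] [DecidableEq V] {T : SurfaceTriangulation V}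
  {k : V → V → ℝ} {N : V → V → ℝ × ℂ}

/-! ### The geodesic triangulation of the realization -/

theorem face_nonempty (t : T.Face) : t.1.Nonempty := by
  rw [← Finset.card_pos, T.card_face t.1 t.2]
  norm_num

/-- A vertex of a face; the face is developed around it. -/
def baseVertex (t : T.Face) : V := (face_nonempty t).choose

theorem baseVertex_mem (t : T.Face) : baseVertex t ∈ t.1 := (face_nonempty t).choose_spec

/-- The vertices of the hyperbolic triangle that belongs to a face. -/
def facePos (N : V → V → ℝ × ℂ) (t : T.Face) (v : (t.1 : Finset V)) : ℍ :=
  ofLorentz (N (baseVertex t) v)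

/-- The map from the hyperbolic triangle that belongs to a face to the realization. -/
def faceMap (N : V → V → ℝ × ℂ) (t : T.Face) : ℍ → Realization T :=
  haveI : Nonempty (Realization T) := ⟨realizationVertex T (baseVertex t)⟩
  Function.invFunOn (starMap N (baseVertex t)) (carrier t)

theorem carrier_subset_closedStar {t : T.Face} {v : V} (hv : v ∈ t.1) :
    carrier t ⊆ closedStar v := fun _ hp => ⟨t, hv, hp⟩

namespace IsFrameSystem

theorem toLorentz_facePos (hN : IsFrameSystem T k N) (t : T.Face) (v : (t.1 : Finset V)) :
    toLorentz (facePos N t v) = N (baseVertex t) v := by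
  rw [facePos, toLorentz_ofLorentz (hN.future t _ _ (baseVertex_mem t) v.2),
    hN.gram t _ _ _ (baseVertex_mem t) v.2 v.2, hN.diag]
  simp

theorem cosh_dist_facePos (hN : IsFrameSystem T k N) (t : T.Face) (a b : (t.1 : Finset V)) :
    Real.cosh (dist (facePos N t a) (facePos N t b)) = k a b := by
  rw [cosh_dist_eq_lorentzForm, hN.toLorentz_facePos, hN.toLorentz_facePos,
    hN.gram t _ _ _ (baseVertex_mem t) a.2 b.2]

theorem faceMap_starMap (hN : IsFrameSystem T k N) {t : T.Face} {p : Realization T}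
    (hp : p ∈ carrier t) : faceMap N t (starMap N (baseVertex t) p) = p := by
  have : Nonempty (Realization T) := ⟨p⟩
  exact ((hN.injOn_starMap (baseVertex t)).mono
    (carrier_subset_closedStar (baseVertex_mem t))).leftInvOn_invFunOn hp

/-- A subsimplex of the realization of a face is developed onto the hyperbolic hull of its
vertices. -/
theorem hypHull_facePos (hN : IsFrameSystem T k N) (t : T.Face) (A : Set (t.1 : Finset V)) :
    hypHull (facePos N t '' A) = starMap N (baseVertex t) ''
      {p : Realization T | ∀ x, bary p x ≠ 0 → ∃ h : x ∈ t.1, (⟨x, h⟩ : (t.1 : Finset V)) ∈ A} := by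
  have hsum : ∀ l : V → ℝ, (∀ x ∉ t.1, l x = 0) →
      ∑ v : (t.1 : Finset V), l v • N (baseVertex t) v = ∑ x, l x • N (baseVertex t) x := by
    intro l hl
    rw [Finset.sum_coe_sort t.1 fun x => l x • N (baseVertex t) x]
    refine Finset.sum_subset (Finset.subset_univ _) fun x _ hx => ?_
    rw [hl x hx, zero_smul]
  ext z
  rw [mem_hypHull_image_iff]
  simp only [hN.toLorentz_facePos]
  constructor
  · rintro ⟨l, hl, hlA, hz⟩
    let m : V → ℝ := fun x => if h : x ∈ t.1 then l ⟨x, h⟩ else 0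
    have hm : ∀ v : (t.1 : Finset V), m v = l v := fun v => dif_pos v.2
    have hmt : ∀ x ∉ t.1, m x = 0 := fun x hx => dif_neg hx
    have hm0 : ∀ x, 0 ≤ m x := fun x => by
      by_cases h : x ∈ t.1
      · exact (hl ⟨x, h⟩).trans_eq (hm ⟨x, h⟩).symm
      · exact (hmt x h).ge
    simp only [← hm] at hz
    rw [hsum m hmt] at hz
    obtain ⟨j, hj⟩ : ∃ j, m j ≠ 0 := by
      by_contra! h
      have h0 := isFuture_toLorentz z
      rw [hz, Finset.sum_eq_zero (fun j _ => by rw [h j, zero_smul])] at h0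
      simp [IsFuture] at h0
    have hs : 0 < ∑ x, m x :=
      Finset.sum_pos' (fun x _ => hm0 x) ⟨j, Finset.mem_univ j, lt_of_le_of_ne (hm0 j) hj.symm⟩
    obtain ⟨p, hp⟩ := exists_bary_eq t (l := fun x => (∑ x, m x)⁻¹ * m x)
      (fun x => mul_nonneg (inv_nonneg.2 hs.le) (hm0 x))
      (by rw [← Finset.mul_sum, inv_mul_cancel₀ hs.ne']) (fun x hx => by rw [hmt x hx, mul_zero])
    refine ⟨p, fun x hx => ?_, ?_⟩
    · rw [hp] at hx
      have hx : m x ≠ 0 := right_ne_zero_of_mul hx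
      have hxt : x ∈ t.1 := by_contra fun h => hx (hmt x h)
      refine ⟨hxt, by_contra fun h => hx ?_⟩
      exact (hm ⟨x, hxt⟩).trans (hlA _ h)
    · rw [starMap, develop, hp]
      simp only [mul_smul, ← Finset.smul_sum, ← hz]
      rw [ofLorentz_smul (isFuture_toLorentz z) (inv_pos.2 hs), ofLorentz_toLorentz]
  · rintro ⟨p, hp, rfl⟩
    have hpt : p ∈ carrier t := fun x hx => by
      by_contra h
      exact hx (hp x h).1
    have hF := hN.isFuture_develop (carrier_subset_closedStar (baseVertex_mem t) hpt)
    rw [starMap, toLorentz_ofLorentz hF]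
    have hc : 0 < (√(lorentzForm (develop N (baseVertex t) p) (develop N (baseVertex t) p)))⁻¹ :=
      inv_pos.2 (Real.sqrt_pos.2 hF.self_pos)
    generalize (√(lorentzForm (develop N (baseVertex t) p) (develop N (baseVertex t) p)))⁻¹ = c at hc
    refine ⟨fun v => c * bary p v, fun v => mul_nonneg hc.le (bary_nonneg p v), fun v hv => ?_, ?_⟩
    · have : bary p v = 0 := by
        by_contra h
        exact hv (hp v h).2
      beta_reduce
      rw [this, mul_zero]
    · rw [hsum (fun x => c * bary p x) (fun x hx => by rw [hpt x hx, mul_zero]), develop,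
        Finset.smul_sum]
      simp only [mul_smul]

theorem hypHull_range_facePos (hN : IsFrameSystem T k N) (t : T.Face) :
    hypHull (Set.range (facePos N t)) = starMap N (baseVertex t) '' carrier t := by
  rw [← Set.image_univ, hN.hypHull_facePos]
  congr 1
  ext p
  constructor
  · intro h x hx
    by_contra hne
    exact hx (h x hne).1
  · intro h x hx
    exact ⟨by_contra fun hxt => hx (h x hxt), trivial⟩

theorem faceMap_image (hN : IsFrameSystem T k N) {t : T.Face} {S : Set (Realization T)}
    (hS : S ⊆ carrier t) : faceMap N t '' (starMap N (baseVertex t) '' S) = S := by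
  rw [Set.image_image]
  ext p
  constructor
  · rintro ⟨q, hq, rfl⟩
    beta_reduce
    rwa [hN.faceMap_starMap (hS hq)]
  · exact fun hp => ⟨p, hp, hN.faceMap_starMap (hS hp)⟩

/-- The realization, with the hyperbolic structure given by the developing maps, is triangulated by
the hyperbolic triangles that belong to the faces. -/
def geodesicTriangulation (hN : IsFrameSystem T k N) :
    letI := hN.chartedSpace
    T.GeodesicTriangulation (Realization T) :=
  letI := hN.chartedSpace
  { pos := facePos N
    nondegenerate := by
      intro t a b c hab hbc hac
      refine lt_of_le_of_ne (dist_triangle _ _ _) fun h => ?_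
      have hmem : facePos N t b ∈ hypSegment (facePos N t a) (facePos N t c) := h.symm
      obtain ⟨r, s, hr, hs, hrs⟩ := mem_hypSegment_iff.1 hmem
      simp only [hN.toLorentz_facePos] at hrs
      have hsing : ∀ (x : V) (c : ℝ), ∑ y, (Pi.single x c : V → ℝ) y • N (baseVertex t) y =
          c • N (baseVertex t) x := by
        intro x c
        rw [Finset.sum_eq_single x]
        · rw [Pi.single_eq_same]
        · intro y _ hy
          rw [Pi.single_eq_of_ne hy, zero_smul]
        · simp
      have hnn : ∀ (x : V) (c : ℝ), 0 ≤ c → ∀ y, 0 ≤ (Pi.single x c : V → ℝ) y := by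
        intro x c hc y
        rw [Pi.single_apply]
        split_ifs
        · exact hc
        · exact le_rfl
      have hsup : ∀ (x : (t.1 : Finset V)) (c : ℝ), ∀ y ∉ t.1, (Pi.single (x : V) c : V → ℝ) y = 0 :=
        fun x c y hy => Pi.single_eq_of_ne (by rintro rfl; exact hy x.2) _
      have h1 := hN.coords_unique (baseVertex t) t t (baseVertex_mem t) (baseVertex_mem t)
        (Pi.single (b : V) 1) (Pi.single (a : V) r + Pi.single (c : V) s)
        (fun x _ => hnn _ _ zero_le_one x) (fun x _ => add_nonneg (hnn _ _ hr x) (hnn _ _ hs x))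
        (hsup b 1) (fun y hy => by rw [Pi.add_apply, hsup a r y hy, hsup c s y hy, add_zero]) (by
          simp only [Pi.add_apply, add_smul, Finset.sum_add_distrib]
          rw [hsing, hsing, hsing, one_smul, hrs])
      have h2 := congrFun h1 b
      have hba : (b : V) ≠ a := fun h => hab (Subtype.ext h.symm)
      have hbc' : (b : V) ≠ c := fun h => hbc (Subtype.ext h)
      rw [Pi.add_apply, Pi.single_eq_same, Pi.single_eq_of_ne hba, Pi.single_eq_of_ne hbc'] at h2
      norm_num at h2
    map := faceMap N
    continuousOn_map := by
      intro t
      have : Nonempty (Realization T) := ⟨realizationVertex T (baseVertex t)⟩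
      rw [hN.hypHull_range_facePos]
      have hsub := carrier_subset_closedStar (baseVertex_mem t)
      exact continuousOn_invFunOn_of_isCompact (isClosed_carrier t).isCompact
        ((hN.continuousOn_starMap _).mono hsub) ((hN.injOn_starMap _).mono hsub)
    injOn_map := by
      intro t
      rw [hN.hypHull_range_facePos]
      rintro _ ⟨p, hp, rfl⟩ _ ⟨q, hq, rfl⟩ h
      rw [hN.faceMap_starMap hp, hN.faceMap_starMap hq] at h
      rw [h]
    isometric_map := by
      rintro t _ ⟨w, rfl⟩ z hz
      refine ⟨_, self_mem_nhdsWithin, ?_⟩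
      rw [hN.hypHull_range_facePos]
      rintro _ ⟨⟨p, hp, rfl⟩, hpw⟩ _ ⟨⟨q, hq, rfl⟩, hqw⟩
      rw [Set.mem_preimage, hN.faceMap_starMap hp] at hpw
      beta_reduce
      rw [hN.faceMap_starMap hp, hN.faceMap_starMap hq]
      have hw : w ∈ t.1 := mem_face_of_pos hp hpw
      exact hN.dist_starMap hw hw (baseVertex_mem t) (baseVertex_mem t) hp hq
    vertexPoint := realizationVertex T
    map_pos := by
      intro t v
      have h : facePos N t v = starMap N (baseVertex t) (realizationVertex T (v : V)) := by
        rw [starMap, develop_realizationVertex, facePos]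
      rw [h]
      refine hN.faceMap_starMap fun x hx => ?_
      rw [bary_realizationVertex]
      exact Pi.single_eq_of_ne (by rintro rfl; exact hx v.2) _
    cover := by
      intro p
      obtain ⟨t, ht⟩ := exists_mem_carrier p
      exact ⟨t, by rwa [hN.hypHull_range_facePos, hN.faceMap_image subset_rfl]⟩
    inter := by
      intro s t _
      have hset : {p : Realization T | ∀ x, bary p x ≠ 0 →
          ∃ h : x ∈ t.1, (⟨x, h⟩ : (t.1 : Finset V)) ∈ {v : (t.1 : Finset V) | (v : V) ∈ s.1}} =
          carrier s ∩ carrier t := by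
        ext p
        constructor
        · refine fun h => ⟨fun x hx => ?_, fun x hx => ?_⟩
          · by_contra hne
            exact hx (h x hne).2
          · by_contra hne
            exact hx (h x hne).1
        · rintro ⟨h1, h2⟩ x hx
          exact ⟨by_contra fun h => hx (h2 x h), by_contra fun h => hx (h1 x h)⟩
      rw [hN.hypHull_range_facePos, hN.hypHull_range_facePos, hN.hypHull_facePos, hset,
        hN.faceMap_image subset_rfl, hN.faceMap_image subset_rfl,
        hN.faceMap_image Set.inter_subset_right] }

end IsFrameSystem

/-- An angle system with matching lengths is uniform. -/
theorem IsMatched.isUniform {u : T.AngleSpace} (hu : u ∈ T.angleSystems) (hm : IsMatched u) :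
    IsUniform u := by
  obtain ⟨N, hN⟩ := hm.exists_isFrameSystem hu
  refine ⟨Realization T, inferInstance, hN.chartedSpace, hN.isClosedHyperbolicSurface,
    hN.geodesicTriangulation, ?_⟩
  intro t v a b hva hvb hab
  change u t v = hypAngle (facePos N t v) (facePos N t a) (facePos N t b)
  have hva' : (v : V) ≠ a := fun h => hva (Subtype.ext h)
  have hvb' : (v : V) ≠ b := fun h => hvb (Subtype.ext h)
  have hab' : (a : V) ≠ b := fun h => hab (Subtype.ext h)
  have hsinh : ∀ c : (t.1 : Finset V),
      Real.sinh (dist (facePos N t v) (facePos N t c)) = √(edgeCosh u v c ^ 2 - 1) := by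
    intro c
    rw [← hN.cosh_dist_facePos t v c, ← Real.sinh_sq, Real.sqrt_sq]
    exact Real.sinh_nonneg_iff.2 dist_nonneg
  have h1 := cosh_dist_law (facePos N t v) (facePos N t a) (facePos N t b)
  rw [hN.cosh_dist_facePos, hN.cosh_dist_facePos, hN.cosh_dist_facePos, hsinh, hsinh,
    edgeCosh_law hu hm hva' hvb' hab' v.2 a.2 b.2] at h1
  have hpos : ∀ c : (t.1 : Finset V), (v : V) ≠ c → 0 < √(edgeCosh u v c ^ 2 - 1) := by
    intro c hc
    have := one_lt_edgeCosh hu hm hc v.2 c.2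
    exact Real.sqrt_pos.2 (by nlinarith)
  have h2 := mul_left_cancel₀ (mul_pos (hpos a hva') (hpos b hvb')).ne' (sub_right_injective h1)
  refine Real.injOn_cos ⟨(hu.2.1 t v).1.le, (hu.2.1 t v).2.le⟩
    ⟨InnerProductGeometry.angle_nonneg _ _, InnerProductGeometry.angle_le_pi _ _⟩ h2

end SurfaceTriangulation

end

theorem proposition2p2 {V : Type*} [Fintype V] [DecidableEq V] (T : SurfaceTriangulation V)
    (x : T.AngleSpace) (hx : x ∈ T.angleSystems)
    (hns : SurfaceTriangulation.IsNonsingular (SurfaceTriangulation.Psi x))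
    (hD : SurfaceTriangulation.IsDelaunay (SurfaceTriangulation.Psi x)) :
    ∃! u : T.AngleSpace, u ∈ T.angleSystems ∧
      SurfaceTriangulation.ConformallyEquivalent x u ∧ SurfaceTriangulation.IsUniform u := by
  obtain ⟨u, hu, hux, hm⟩ := SurfaceTriangulation.exists_isMatched x hx fun e => (hD e).1
  have hxu : x - u ∈ T.conformalDeformations := by
    rw [← neg_sub]
    exact Submodule.neg_mem _ hux
  refine ⟨u, ⟨hu, hxu, hm.isUniform hu⟩, ?_⟩
  rintro u' ⟨hu', hxu', hU'⟩
  refine hm.eq_of_sub_mem hu hu' (SurfaceTriangulation.isMatched_of_isUniform hu' hU') ?_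
  have h : u' - u = (x - u) - (x - u') := by abel
  rw [h]
  exact Submodule.sub_mem _ hxu hxu'
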